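/- Let $\{\xi_k\}_{k\ge 0}$ be a stationary, centered, circularly symmetric complex Gaussian process with spectral measure $F(dt)=dt/(2\pi)$ on $(-\pi,\pi]$, i.e. $\mathbb{E}[\xi_k\overline{\xi_l}]=\int_{-\pi}^{\pi}e^{-i(k-l)t}\,\frac{dt}{2\pi}=\delta_{kl}$ (equivalently, the $\xi_k$ are i.i.d. standard complex Gaussian variables). Let $\mathbb{D}=\{z\in\mathbb{C}:|z|<1\}$, let $X_{\mathrm{hyp}}(z)=\sum_{k=0}^{\infty}\xi_k z^k$ for $z\in\mathbb{D}$ (the hyperbolic Gaussian analytic function), and let $\mathcal{Z}=\{z\in\mathbb{D}:X_{\mathrm{hyp}}(z)=0\}$ be its zero set. For $n\ge 0$, a locally integrable function $\rho_n\ge 0$ on $\mathbb{D}^n$ is an $n$-point correlation function of $\mathcal{Z}$ (with respect to Lebesgue measure) if for every Borel $f:\mathbb{C}^n\to[0,\infty]$ $$\mathbb{E}\Big[\sum_{\substack{z_1,\dots,z_n\in\mathcal{Z}\\ \text{pairwise distinct}}} f(z_1,\dots,z_n)\Big]=\int_{\mathbb{D}^n} f(\mathbf{a})\,\rho_n(\mathbf{a})\,d\mathbf{a}.$$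 Then for every $n$ the zeros of $X_{\mathrm{hyp}}$ have the $n$-point correlation function $$\rho_n(a_1,\dots,a_n)=\frac{1}{\pi^n}\det\Big(\frac{1}{(1-a_p\overline{a_q})^2}\Big)_{p,q=1}^n,\qquad (a_1,\dots,a_n)\in\mathbb{D}^n .$$ Consequently $\mathcal{Z}$ is a simple point process on $\mathbb{D}$ (almost surely locally finite, with measurable counts of points in Borel sets) and it is the determinantal point process on $\mathbb{D}$, with respect to Lebesgue measure, with the Bergman kernel $K(z,w)=\pi^{-1}(1-z\overline{w})^{-2}$; that is, $\rho_n(\mathbf{a})=\det(K(a_p,a_q))_{p,q=1}^n$ for all $n$. -/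

import Mathlib

open MeasureTheory ProbabilityTheory Set
open scoped ENNReal ComplexConjugate

noncomputable section

/-- The normalized Lebesgue measure `dt / (2π)` on `𝕋 = (-π, π]`. -/
def uniformSpectralMeasure : Measure ℝ :=
  ENNReal.ofReal (2 * Real.pi)⁻¹ • (volume.restrict (Ioc (-Real.pi) Real.pi))

/-- `ξ` is a stationary, centered, (circularly symmetric) complex Gaussian process with spectral
measure `F` on `𝕋 = (-π, π]`: `E[ξ_k conj ξ_l] = γ(k - l)` with `γ(m) = ∫_𝕋 e^{-imt} F(dt)`.
Only the coefficients with index `k ≥ 0` enter the power series, so the process is indexed by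
`ℕ`; a process indexed by `ℤ` restricts to one of this kind. -/
structure IsStationaryComplexGaussian {Ω : Type*} [MeasurableSpace Ω] (P : Measure Ω)
    (ξ : ℕ → Ω → ℂ) (F : Measure ℝ) : Prop where
  gaussian : IsGaussianProcess ξ P
  centered : ∀ k, ∫ ω, ξ k ω ∂P = 0
  circular : ∀ k l, ∫ ω, ξ k ω * ξ l ω ∂P = 0
  spectral : ∀ k l, ∫ ω, ξ k ω * conj (ξ l ω) ∂P =
    ∫ t in Ioc (-Real.pi) Real.pi,
      Complex.exp (-(Complex.I * (((k : ℤ) - (l : ℤ) : ℤ) : ℂ) * (t : ℂ))) ∂F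

/-- The open unit disk `𝔻`. -/
def openUnitDisk : Set ℂ := {z | ‖z‖ < 1}

/-- The random power series `X(z) = ∑_{k ≥ 0} ξ_k z^k`. -/
def gaussianPowerSeries {Ω : Type*} (ξ : ℕ → Ω → ℂ) (ω : Ω) (z : ℂ) : ℂ :=
  ∑' k : ℕ, ξ k ω * z ^ k

/-- The zeros of `X` in the unit disk. As a point process this set stands for
`∑_{z ∈ 𝔻 : X(z) = 0} δ_z`. -/
def zeroSet {Ω : Type*} (ξ : ℕ → Ω → ℂ) (ω : Ω) : Set ℂ :=
  {z | z ∈ openUnitDisk ∧ gaussianPowerSeries ξ ω z = 0}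

/-- The random set `Z` is a (simple) point process on `D`: it lies in `D`, it has almost surely
finitely many points in every compact subset of `D`, and the number of its points in a Borel set
is a random variable. -/
structure IsSimplePointProcess {Ω : Type*} [MeasurableSpace Ω] (P : Measure Ω)
    (D : Set ℂ) (Z : Ω → Set ℂ) : Prop where
  subset : ∀ᵐ ω ∂P, Z ω ⊆ D
  locallyFinite : ∀ᵐ ω ∂P, ∀ C : Set ℂ, IsCompact C → C ⊆ D → (Z ω ∩ C).Finite
  measurable_count : ∀ B : Set ℂ, MeasurableSet B →
    AEMeasurable (fun ω => (Z ω ∩ B).encard) P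

/-- `ρ` is (a version of) the `n`-point correlation function of `Z`, with respect to Lebesgue
measure on `D`: for every Borel `f ≥ 0`, the expectation of the sum of `f (z₁, …, zₙ)` over all
`n`-tuples of pairwise distinct points of `Z` is the integral of `f * ρ` over `Dⁿ`. -/
structure IsCorrelationFunction {Ω : Type*} [MeasurableSpace Ω] (P : Measure Ω)
    (D : Set ℂ) (Z : Ω → Set ℂ) (n : ℕ) (ρ : (Fin n → ℂ) → ℝ) : Prop where
  nonneg : ∀ a ∈ Set.univ.pi (fun _ : Fin n => D), 0 ≤ ρ a
  locallyIntegrable : LocallyIntegrableOn ρ (Set.univ.pi fun _ : Fin n => D)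
  campbell : ∀ f : (Fin n → ℂ) → ℝ≥0∞, Measurable f →
    ∫⁻ ω, ∑' a : {a : Fin n → ℂ // Function.Injective a ∧ ∀ i, a i ∈ Z ω}, f a.1 ∂P =
      ∫⁻ a in Set.univ.pi (fun _ : Fin n => D), f a * ENNReal.ofReal (ρ a)

/-- `Z` is the determinantal point process on `D` with correlation kernel `K`, with respect to
Lebesgue measure: its `n`-point correlation function is `det (K (a_p, a_q))` for every `n`. -/
structure IsDeterminantalPointProcess {Ω : Type*} [MeasurableSpace Ω] (P : Measure Ω)
    (D : Set ℂ) (Z : Ω → Set ℂ) (K : ℂ → ℂ → ℂ) : Prop where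
  pointProcess : IsSimplePointProcess P D Z
  correlation : ∀ n : ℕ, ∃ ρ : (Fin n → ℂ) → ℝ, IsCorrelationFunction P D Z n ρ ∧
    ∀ a ∈ Set.univ.pi (fun _ : Fin n => D),
      (ρ a : ℂ) = (Matrix.of fun p q : Fin n => K (a p) (a q)).det

/-- The Bergman kernel `π⁻¹ (1 - z w̄)⁻²` of the unit disk. -/
def bergmanKernel (z w : ℂ) : ℂ := (Real.pi : ℂ)⁻¹ * ((1 - z * conj w) ^ 2)⁻¹

end

/-! The covariance conditions force the coefficients to be i.i.d. standard complex Gaussians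
(`IsStationaryComplexGaussian.map_eq_gaussianSeq`). Hence `X(z) = c + z Y(z)`, where `c` is Gaussian
and independent of `Y`, and `Y` has the law of `X`. The zeros of `X` form the fibre of `φ(z) = -z
Y(z)` over `c`. Averaging over `c` and applying the area formula (`lintegral_tsum_fiber`) turns a
sum over zeros into an integral over `a ∈ 𝔻`, weighted by `|φ'(a)|²` and by the Gaussian density at
`φ(a)`.

When `c = φ(a)`, one has `X(z) = z Y(z) - a Y(a) = (z - a) / (1 - ā z) · V(z)`. The coefficients of
`V` are orthonormal combinations of those of `Y`, except for the zeroth one, `Y(a)`, whose variance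
is `1 / (1 - |a|²)`. The factor `exp(-|a Y(a)|²)` of the density corrects exactly this variance, so
under the tilted measure `V` again has the law of `X`, up to the mass `1 - |a|²`
(`lintegral_blaschkeQuotient`). Since `φ'(a) = -V(a) / (1 - |a|²)`, this yields a Palm formula
(`lintegral_tsum_regularZeros_of_blaschke`): a zero at `a` costs `1 / (π (1 - |a|²))`, and the rest
is a Blaschke factor times a copy of `X` weighted by `|X(a)|²`.

Iterating over `n` zeros (`lintegral_tsum_tuples_mul`) gives `ρ_n(a) = palmWeight n a · E ∏
|X(a_i)|²`. With `S = (1 / (1 - a_p ā_q))`, the first factor is `π⁻ⁿ det S` by Cauchy's recursion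
(`palmWeight_eq`), and the second is the permanent of `S` by Wick's formula
(`lintegral_prod_powerSumSq`). Borchardt's identity (`borchardt`) says that `det S · perm S` is the
determinant of the matrix of squared entries. -/

/-! ### Cauchy matrices: determinant recursion and Borchardt's identity -/

/-- The Cauchy-type matrix `1 / (1 - x_i y_j)`. -/
noncomputable def cauchyLike {n : ℕ} (x y : Fin n → ℂ) : Matrix (Fin n) (Fin n) ℂ :=
  Matrix.of fun i j => (1 - x i * y j)⁻¹

theorem cauchyLike_apply {n : ℕ} (x y : Fin n → ℂ) (i j : Fin n) :
    cauchyLike x y i j = (1 - x i * y j)⁻¹ := rfl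

/-- One elimination step on a Cauchy matrix. It rests on `(x - a)(y - b) = (1 - xb)(1 - ay) - (1 -
ab)(1 - xy)`: the eliminated entry is the old one times a row factor and a column factor. -/
theorem cauchyLike_schur {a b x y : ℂ} (h1 : 1 - x * b ≠ 0) (h2 : 1 - a * y ≠ 0)
    (h3 : 1 - x * y ≠ 0) :
    (1 - x * y)⁻¹ - (1 - a * b) / (1 - x * b) * (1 - a * y)⁻¹ =
      (x - a) / (1 - x * b) * ((y - b) / (1 - a * y) * (1 - x * y)⁻¹) := by
  rw [eq_comm, ← sub_eq_zero]
  have : (x - a) / (1 - x * b) * ((y - b) / (1 - a * y) * (1 - x * y)⁻¹) -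
      ((1 - x * y)⁻¹ - (1 - a * b) / (1 - x * b) * (1 - a * y)⁻¹) =
      ((x - a) * (y - b) - (1 - x * b) * (1 - a * y) + (1 - a * b) * (1 - x * y)) *
        ((1 - x * b)⁻¹ * (1 - a * y)⁻¹ * (1 - x * y)⁻¹) := by
    generalize hu : 1 - x * b = u at *
    generalize hv : 1 - a * y = v at *
    generalize hw : 1 - x * y = w at *
    field_simp
    ring
  rw [this]
  ring

theorem det_cauchyLike_cons {n : ℕ} (a b : ℂ) (x y : Fin n → ℂ) (hab : 1 - a * b ≠ 0)
    (hxb : ∀ i, 1 - x i * b ≠ 0) (hay : ∀ j, 1 - a * y j ≠ 0)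
    (hxy : ∀ i j, 1 - x i * y j ≠ 0) :
    (cauchyLike (Fin.cons a x : Fin (n + 1) → ℂ) (Fin.cons b y : Fin (n + 1) → ℂ)).det =
      (1 - a * b)⁻¹ * (∏ i, (x i - a) / (1 - x i * b)) * (∏ j, (y j - b) / (1 - a * y j)) *
        (cauchyLike x y).det := by
  set A := cauchyLike (Fin.cons a x : Fin (n + 1) → ℂ) (Fin.cons b y : Fin (n + 1) → ℂ) with hA
  -- Multiples of row 0 that clear the rest of column 0; the entry `0` keeps row 0 itself.
  let c : Fin (n + 1) → ℂ := Fin.cons 0 fun i => (1 - a * b) / (1 - x i * b)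
  let B : Matrix (Fin (n + 1)) (Fin (n + 1)) ℂ := Matrix.of fun i j => A i j - c i * A 0 j
  have hdet : A.det = B.det := by
    refine Matrix.det_eq_of_forall_row_eq_smul_add_const c 0 rfl ?_
    intro i j
    simp only [B, Matrix.of_apply, c, Fin.cons_zero]
    ring
  have hB0 : ∀ i : Fin n, B i.succ 0 = 0 := by
    intro i
    simp only [B, Matrix.of_apply, c, hA, cauchyLike_apply, Fin.cons_succ, Fin.cons_zero]
    rw [div_mul_eq_mul_div, mul_inv_cancel₀ hab, one_div, sub_self]
  have hB : ∀ i j : Fin n, B i.succ j.succ =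
      (x i - a) / (1 - x i * b) * ((y j - b) / (1 - a * y j) * cauchyLike x y i j) := by
    intro i j
    simp only [B, Matrix.of_apply, c, hA, cauchyLike_apply, Fin.cons_succ, Fin.cons_zero]
    exact cauchyLike_schur (hxb i) (hay j) (hxy i j)
  rw [hdet, Matrix.det_succ_column_zero, Fin.sum_univ_succ]
  simp only [hB0, mul_zero, zero_mul, Finset.sum_const_zero, add_zero, Fin.val_zero, pow_zero,
    one_mul]
  have hsub : B.submatrix (Fin.succAbove 0) Fin.succ = Matrix.of fun i j =>
      (x i - a) / (1 - x i * b) *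
        (Matrix.of fun i j => (y j - b) / (1 - a * y j) * cauchyLike x y i j) i j := by
    ext i j
    simp only [Matrix.submatrix_apply, Fin.succAbove_zero, hB, Matrix.of_apply]
  rw [hsub, Matrix.det_mul_column, Matrix.det_mul_row]
  have hB00 : B 0 0 = (1 - a * b)⁻¹ := by
    simp [B, c, hA, cauchyLike_apply]
  rw [hB00]
  ring

/-- Permutations are split by the image `p` of `0`. The remaining bijection is described through
`Equiv.swap 0 p` on one side and `p.succAbove` on the other; the two differ by a fixed permutation
`τ`, which is harmless because no signs occur. -/
theorem Matrix.permanent_succ_row_zero {n : ℕ} (M : Matrix (Fin (n + 1)) (Fin (n + 1)) ℂ) :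
    M.permanent = ∑ j, M 0 j * (M.submatrix Fin.succ j.succAbove).permanent := by
  rw [← Matrix.permanent_transpose, Matrix.permanent]
  rw [← Equiv.Perm.decomposeFin.symm.sum_comp, Fintype.sum_prod_type]
  refine Finset.sum_congr rfl fun p _ => ?_
  rw [← Matrix.permanent_transpose, Matrix.permanent, Finset.mul_sum]
  have key : ∃ τ : Equiv.Perm (Fin n), ∀ i, p.succAbove (τ i) = Equiv.swap 0 p i.succ := by
    refine Fin.cases ⟨1, fun i => by simp⟩ (fun q => ⟨q.cycleRange, fun i => ?_⟩) p
    rw [Fin.succAbove_cycleRange]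
  obtain ⟨τ, hτ⟩ := key
  refine Eq.trans (Finset.sum_congr rfl fun e _ => ?_)
    (Equiv.sum_comp (Equiv.mulLeft τ)
      (fun e : Equiv.Perm (Fin n) => M 0 p * ∏ i, M i.succ (p.succAbove (e i))))
  rw [Fin.prod_univ_succ]
  simp [Matrix.transpose_apply, hτ]

open Polynomial in
-- Induction on `n`, with the first node replaced by a variable `t`. Expanding along the first row
-- and clearing the denominators `1 - t y_l` turns the identity into `D * P = T` between polynomials
-- in `t` of degree at most `2n`, which is checked at `2n + 1` points.
theorem borchardt {n : ℕ} (x y : Fin n → ℂ) (hx : Function.Injective x)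
    (hy : Function.Injective y) (hy0 : ∀ j, y j ≠ 0) (hxy : ∀ i j, 1 - x i * y j ≠ 0) :
    (cauchyLike x y).det * (cauchyLike x y).permanent =
      (Matrix.of fun i j => (cauchyLike x y i j) ^ 2).det := by
  induction n with
  | zero => simp [Matrix.permanent_isEmpty]
  | succ n ih =>
    set M := cauchyLike x y with hM
    let S : Matrix (Fin (n + 1)) (Fin (n + 1)) ℂ := Matrix.of fun i j => (M i j) ^ 2
    let d : Fin (n + 1) → ℂ := fun j => (M.submatrix Fin.succ j.succAbove).det
    let q : Fin (n + 1) → ℂ := fun j => (M.submatrix Fin.succ j.succAbove).permanent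
    have hs : ∀ j, (S.submatrix Fin.succ j.succAbove).det = d j * q j := by
      intro j
      exact (ih (x ∘ Fin.succ) (y ∘ j.succAbove) (hx.comp (Fin.succ_injective n))
        (hy.comp Fin.succAbove_right_injective) (fun i => hy0 _) (fun i k => hxy _ _)).symm
    let Q : Fin (n + 1) → ℂ[X] := fun j => ∏ l ∈ Finset.univ.erase j, (1 - X * C (y l))
    have hQdeg : ∀ j, (Q j).natDegree ≤ n := by
      intro j
      refine (natDegree_prod_le _ _).trans ?_
      refine (Finset.sum_le_card_nsmul _ _ 1 fun l _ => ?_).trans ?_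
      · compute_degree
      · simp
    let D : ℂ[X] := ∑ j : Fin (n + 1), C ((-1) ^ (j : ℕ) * d j) * Q j
    let P : ℂ[X] := ∑ j : Fin (n + 1), C (q j) * Q j
    let T : ℂ[X] := ∑ j : Fin (n + 1), C ((-1) ^ (j : ℕ) * (d j * q j)) * Q j ^ 2
    have hDdeg : D.natDegree ≤ n := natDegree_sum_le_of_forall_le _ _ fun j _ =>
      (natDegree_C_mul_le _ _).trans (hQdeg j)
    have hPdeg : P.natDegree ≤ n := natDegree_sum_le_of_forall_le _ _ fun j _ =>
      (natDegree_C_mul_le _ _).trans (hQdeg j)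
    have hTdeg : T.natDegree ≤ 2 * n := natDegree_sum_le_of_forall_le _ _ fun j _ =>
      (natDegree_C_mul_le _ _).trans (natDegree_pow_le.trans (by have := hQdeg j; omega))
    have hRdeg : (D * P - T).natDegree ≤ 2 * n :=
      (natDegree_sub_le _ _).trans (max_le (natDegree_mul_le.trans (by omega)) hTdeg)
    -- evaluation of the polynomials through matrices whose first row is changed
    let Mt : ℂ → Matrix (Fin (n + 1)) (Fin (n + 1)) ℂ := fun t =>
      Matrix.updateRow M 0 fun j => (1 - t * y j)⁻¹
    let St : ℂ → Matrix (Fin (n + 1)) (Fin (n + 1)) ℂ := fun t =>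
      Matrix.updateRow S 0 fun j => ((1 - t * y j)⁻¹) ^ 2
    have hsubM : ∀ t (j : Fin (n + 1)), (Mt t).submatrix Fin.succ j.succAbove =
        M.submatrix Fin.succ j.succAbove := by
      intro t j
      ext i k
      simp [Mt]
    have hsubS : ∀ t (j : Fin (n + 1)), (St t).submatrix Fin.succ j.succAbove =
        S.submatrix Fin.succ j.succAbove := by
      intro t j
      ext i k
      simp [St]
    have hQeval : ∀ t, (∀ j, 1 - t * y j ≠ 0) → ∀ j, (Q j).eval t =
        (∏ l, (1 - t * y l)) * (1 - t * y j)⁻¹ := by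
      intro t ht j
      rw [← Finset.mul_prod_erase _ _ (Finset.mem_univ j)]
      simp only [Q, eval_prod, eval_sub, eval_one, eval_mul, eval_X, eval_C]
      field_simp [ht j]
    have hDeval : ∀ t, (∀ j, 1 - t * y j ≠ 0) →
        D.eval t = (∏ l, (1 - t * y l)) * (Mt t).det := by
      intro t ht
      rw [Matrix.det_succ_row_zero, Finset.mul_sum]
      simp only [D, eval_finsetSum, eval_mul, eval_C]
      refine Finset.sum_congr rfl fun j _ => ?_
      rw [hQeval t ht, hsubM]
      simp only [Mt, Matrix.updateRow_self, d]
      ring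
    have hPeval : ∀ t, (∀ j, 1 - t * y j ≠ 0) →
        P.eval t = (∏ l, (1 - t * y l)) * (Mt t).permanent := by
      intro t ht
      rw [Matrix.permanent_succ_row_zero, Finset.mul_sum]
      simp only [P, eval_finsetSum, eval_mul, eval_C]
      refine Finset.sum_congr rfl fun j _ => ?_
      rw [hQeval t ht, hsubM]
      simp only [Mt, Matrix.updateRow_self, q]
      ring
    have hTeval : ∀ t, (∀ j, 1 - t * y j ≠ 0) →
        T.eval t = (∏ l, (1 - t * y l)) ^ 2 * (St t).det := by
      intro t ht
      rw [Matrix.det_succ_row_zero, Finset.mul_sum]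
      simp only [T, eval_finsetSum, eval_mul, eval_C, eval_pow]
      refine Finset.sum_congr rfl fun j _ => ?_
      rw [hQeval t ht, hsubS, hs]
      simp only [St, Matrix.updateRow_self]
      ring
    -- At `t = 1 / y_j` only the `j`-th term of each sum survives. The terms match because the
    -- minors of `S` factor as `d j * q j`, which is the induction hypothesis.
    have hroot1 : ∀ j, (D * P - T).eval (y j)⁻¹ = 0 := by
      intro j
      have hz : ∀ l, l ≠ j → (Q l).eval (y j)⁻¹ = 0 := by
        intro l hl
        simp only [Q, eval_prod, eval_sub, eval_one, eval_mul, eval_X, eval_C]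
        refine Finset.prod_eq_zero (Finset.mem_erase.2 ⟨hl.symm, Finset.mem_univ j⟩) ?_
        rw [inv_mul_cancel₀ (hy0 j), sub_self]
      have h1 : D.eval (y j)⁻¹ = (-1) ^ (j : ℕ) * d j * (Q j).eval (y j)⁻¹ := by
        simp only [D, eval_finsetSum, eval_mul, eval_C]
        exact Finset.sum_eq_single j (fun l _ hl => by rw [hz l hl, mul_zero]) (by simp)
      have h2 : P.eval (y j)⁻¹ = q j * (Q j).eval (y j)⁻¹ := by
        simp only [P, eval_finsetSum, eval_mul, eval_C]
        exact Finset.sum_eq_single j (fun l _ hl => by rw [hz l hl, mul_zero]) (by simp)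
      have h3 : T.eval (y j)⁻¹ = (-1) ^ (j : ℕ) * (d j * q j) * (Q j).eval (y j)⁻¹ ^ 2 := by
        simp only [T, eval_finsetSum, eval_mul, eval_C, eval_pow]
        exact Finset.sum_eq_single j (fun l _ hl => by rw [hz l hl]; simp) (by simp)
      rw [eval_sub, eval_mul, h1, h2, h3]
      ring
    -- Here row 0 coincides with row `k.succ`, so both determinants vanish.
    have hroot2 : ∀ k : Fin n, (D * P - T).eval (x k.succ) = 0 := by
      intro k
      have hne : (0 : Fin (n + 1)) ≠ k.succ := (Fin.succ_ne_zero k).symm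
      have h1 : (Mt (x k.succ)).det = 0 := by
        refine Matrix.det_zero_of_row_eq hne ?_
        ext j
        simp [Mt, hM, cauchyLike_apply]
      have h2 : (St (x k.succ)).det = 0 := by
        refine Matrix.det_zero_of_row_eq hne ?_
        ext j
        simp [St, S, hM, cauchyLike_apply]
      rw [eval_sub, eval_mul, hDeval _ (hxy _), hTeval _ (hxy _), h1, h2]
      ring
    have hzero : D * P - T = 0 := by
      -- These `(n + 1) + n` nodes exceed the degree bound `2n`; the two families are disjoint
      -- because `1 - x_k y_j ≠ 0`.
      let f : Fin (n + 1) ⊕ Fin n → ℂ := Sum.elim (fun j => (y j)⁻¹) (fun k => x k.succ)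
      have hf : Function.Injective f := by
        refine Function.Injective.sumElim (fun i j h => hy (inv_injective h))
          (hx.comp (Fin.succ_injective n)) ?_
        intro j k h
        apply hxy k.succ j
        rw [← h, inv_mul_cancel₀ (hy0 j), sub_self]
      refine eq_zero_of_natDegree_lt_card_of_eval_eq_zero _ hf ?_ ?_
      · rintro (j | k)
        · exact hroot1 j
        · exact hroot2 k
      · refine lt_of_le_of_lt hRdeg ?_
        simp
        omega
    have hfin := congrArg (eval (x 0)) hzero
    have hMt : Mt (x 0) = M := by
      ext i j
      refine Fin.cases ?_ (fun i => ?_) i <;> simp [Mt, hM, cauchyLike_apply]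
    have hSt : St (x 0) = S := by
      ext i j
      refine Fin.cases ?_ (fun i => ?_) i <;> simp [St, S, hM, cauchyLike_apply]
    rw [eval_sub, eval_mul, hDeval _ (hxy _), hTeval _ (hxy _), hPeval _ (hxy _), hMt, hSt,
      eval_zero] at hfin
    have hp : (∏ l, (1 - x 0 * y l)) ^ 2 ≠ 0 :=
      pow_ne_zero _ (Finset.prod_ne_zero_iff.2 fun l _ => hxy 0 l)
    apply mul_left_cancel₀ hp
    change _ = (∏ l, (1 - x 0 * y l)) ^ 2 * S.det
    linear_combination hfin

/-! ### The standard complex Gaussian and its infinite product -/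

/-- The density `π⁻¹ exp (-|z|²)`. -/
noncomputable def complexGaussianDensity (z : ℂ) : ℝ := Real.pi⁻¹ * Real.exp (-‖z‖ ^ 2)

theorem complexGaussianDensity_nonneg (z : ℂ) : 0 ≤ complexGaussianDensity z :=
  mul_nonneg (inv_nonneg.2 Real.pi_pos.le) (Real.exp_pos _).le

theorem measurable_complexGaussianDensity : Measurable complexGaussianDensity := by
  unfold complexGaussianDensity
  fun_prop

/-- The standard complex Gaussian distribution. -/
noncomputable def stdComplexGaussian : Measure ℂ :=
  volume.withDensity fun z => ENNReal.ofReal (complexGaussianDensity z)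

theorem integrable_complexGaussianDensity : Integrable complexGaussianDensity := by
  have h := GaussianFourier.integrable_cexp_neg_mul_sq_norm_add (V := ℂ)
    (b := 1) (by norm_num) 0 0
  have h2 := h.norm.const_mul Real.pi⁻¹
  refine h2.congr (Filter.Eventually.of_forall fun z => ?_)
  simp only [complexGaussianDensity, Complex.norm_exp]
  norm_num
  norm_cast

theorem integral_complexGaussianDensity_mul_cexp (t : ℂ) :
    ∫ z : ℂ, (complexGaussianDensity z : ℂ) * Complex.exp (Complex.I * ((t * z).re : ℂ)) =
      Complex.exp (-(‖t‖ ^ 2 / 4 : ℝ)) := by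
  have h := GaussianFourier.integral_cexp_neg_mul_sq_norm_add (V := ℂ)
    (b := 1) (by norm_num) Complex.I (conj t)
  have h2 : ∀ z : ℂ, (complexGaussianDensity z : ℂ) *
      Complex.exp (Complex.I * ((t * z).re : ℂ)) = (Real.pi : ℂ)⁻¹ *
      Complex.exp (-1 * (‖z‖ : ℂ) ^ 2 + Complex.I * (inner ℝ (conj t) z : ℝ)) := by
    intro z
    have : (inner ℝ (conj t) z : ℝ) = (t * z).re := by
      simp [Complex.inner, mul_comm]
    rw [this, Complex.exp_add, complexGaussianDensity]
    push_cast
    ring_nf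
  simp_rw [h2]
  rw [integral_const_mul, h, Complex.finrank_real_complex]
  have hpi : (Real.pi : ℂ) ≠ 0 := by exact_mod_cast Real.pi_ne_zero
  norm_num
  congr 1
  ring

theorem integral_stdComplexGaussian {E : Type*} [NormedAddCommGroup E] [NormedSpace ℝ E]
    (f : ℂ → E) :
    ∫ z, f z ∂stdComplexGaussian = ∫ z, complexGaussianDensity z • f z := by
  rw [stdComplexGaussian, integral_withDensity_eq_integral_toReal_smul]
  · simp only [ENNReal.toReal_ofReal (complexGaussianDensity_nonneg _)]
  · exact measurable_complexGaussianDensity.ennreal_ofReal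
  · exact Filter.Eventually.of_forall fun _ => ENNReal.ofReal_lt_top

theorem lintegral_stdComplexGaussian {f : ℂ → ℝ≥0∞} (hf : Measurable f) :
    ∫⁻ z, f z ∂stdComplexGaussian =
      ∫⁻ z, ENNReal.ofReal (complexGaussianDensity z) * f z := by
  rw [stdComplexGaussian, lintegral_withDensity_eq_lintegral_mul _
    measurable_complexGaussianDensity.ennreal_ofReal hf]
  rfl

theorem integral_complexGaussianDensity : ∫ z, complexGaussianDensity z = 1 := by
  have h := integral_complexGaussianDensity_mul_cexp 0
  simp only [zero_mul, Complex.zero_re, Complex.ofReal_zero, mul_zero, Complex.exp_zero,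
    mul_one, norm_zero] at h
  rw [integral_complex_ofReal] at h
  norm_num at h
  exact_mod_cast h

instance : IsProbabilityMeasure stdComplexGaussian := by
  constructor
  rw [stdComplexGaussian, withDensity_apply _ MeasurableSet.univ, Measure.restrict_univ,
    ← ofReal_integral_eq_lintegral_ofReal integrable_complexGaussianDensity
      (Filter.Eventually.of_forall complexGaussianDensity_nonneg),
    integral_complexGaussianDensity, ENNReal.ofReal_one]

theorem stdComplexGaussian_absolutelyContinuous : stdComplexGaussian ≪ volume :=
  withDensity_absolutelyContinuous _ _

instance : NullSingletonClass stdComplexGaussian :=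
  ⟨fun z => stdComplexGaussian_absolutelyContinuous (measure_singleton z)⟩

theorem integral_cexp_stdComplexGaussian (t : ℂ) :
    ∫ z, Complex.exp (Complex.I * ((t * z).re : ℂ)) ∂stdComplexGaussian =
      Complex.exp (-(‖t‖ ^ 2 / 4 : ℝ)) := by
  rw [integral_stdComplexGaussian, ← integral_complexGaussianDensity_mul_cexp t]
  rfl

theorem integral_cexp_pi_stdComplexGaussian {ι : Type*} [Fintype ι] (t : ι → ℂ) :
    ∫ x : ι → ℂ, Complex.exp (Complex.I * ((∑ i, t i * x i).re : ℂ))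
      ∂(Measure.pi fun _ => stdComplexGaussian) =
      Complex.exp (-((∑ i, ‖t i‖ ^ 2) / 4 : ℝ)) := by
  have h : ∀ x : ι → ℂ, Complex.exp (Complex.I * ((∑ i, t i * x i).re : ℂ)) =
      ∏ i, Complex.exp (Complex.I * ((t i * x i).re : ℂ)) := by
    intro x
    rw [← Complex.exp_sum, Complex.re_sum, Complex.ofReal_sum, Finset.mul_sum]
  simp_rw [h]
  rw [integral_fintype_prod_eq_prod (μ := fun _ : ι => stdComplexGaussian)
    (fun i z => Complex.exp (Complex.I * ((t i * z).re : ℂ)))]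
  simp_rw [integral_cexp_stdComplexGaussian]
  rw [← Complex.exp_sum, Finset.sum_neg_distrib, ← Complex.ofReal_sum, Finset.sum_div]

theorem measurable_cexp_sum {ι : Type*} (I : Finset ι) (t : ι → ℂ) :
    Measurable fun x : ι → ℂ => Complex.exp (Complex.I * ((∑ i ∈ I, t i * x i).re : ℂ)) := by
  fun_prop

/-- Finite measures on `ℂ^ι` are determined by their characteristic functions. -/
theorem measure_ext_of_integral_cexp {ι : Type*} [Fintype ι] {ν₁ ν₂ : Measure (ι → ℂ)}
    [IsFiniteMeasure ν₁] [IsFiniteMeasure ν₂]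
    (h : ∀ t : ι → ℂ, ∫ x, Complex.exp (Complex.I * ((∑ i, t i * x i).re : ℂ)) ∂ν₁ =
      ∫ x, Complex.exp (Complex.I * ((∑ i, t i * x i).re : ℂ)) ∂ν₂) : ν₁ = ν₂ := by
  classical
  refine Measure.ext_of_charFunDual (funext fun L => ?_)
  -- The vector representing the real functional `L` as `x ↦ Re ∑ t_i x_i`: `t_i = L(e_i) - i L(i
  -- e_i)`.
  let t : ι → ℂ := fun i => ⟨L (Pi.single i 1), -L (Pi.single i Complex.I)⟩
  have hL : ∀ x : ι → ℂ, L x = (∑ i, t i * x i).re := by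
    intro x
    conv_lhs => rw [← Finset.univ_sum_single x, map_sum]
    rw [Complex.re_sum]
    refine Finset.sum_congr rfl fun i _ => ?_
    have h1 : (Pi.single i (x i) : ι → ℂ) = (x i).re • (Pi.single i (1 : ℂ) : ι → ℂ) +
        (x i).im • (Pi.single i Complex.I : ι → ℂ) := by
      rw [← Pi.single_smul, ← Pi.single_smul, ← Pi.single_add]
      congr 1
      simp [Complex.re_add_im]
    rw [h1, map_add, map_smul, map_smul]
    simp [t, Complex.mul_re]
    ring
  rw [charFunDual_apply, charFunDual_apply]
  simp_rw [hL]
  simpa only [mul_comm] using h t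

/-- The law of an i.i.d. sequence of standard complex Gaussians. -/
noncomputable def gaussianSeq : Measure (ℕ → ℂ) := Measure.infinitePi fun _ => stdComplexGaussian

instance : IsProbabilityMeasure gaussianSeq := by unfold gaussianSeq; infer_instance

theorem integral_cexp_gaussianSeq_finset (I : Finset ℕ) (t : ℕ → ℂ) :
    ∫ x : ℕ → ℂ, Complex.exp (Complex.I * ((∑ k ∈ I, t k * x k).re : ℂ)) ∂gaussianSeq =
      Complex.exp (-((∑ k ∈ I, ‖t k‖ ^ 2) / 4 : ℝ)) := by
  have h := integral_cexp_pi_stdComplexGaussian (fun i : I => t i)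
  rw [← Measure.infinitePi_map_restrict (μ := fun _ : ℕ => stdComplexGaussian),
    integral_map (Finset.measurable_restrict I).aemeasurable
      (measurable_cexp_sum _ _).aestronglyMeasurable] at h
  rw [← Finset.sum_coe_sort I (fun k => ‖t k‖ ^ 2), ← h]
  refine integral_congr_ae (Filter.Eventually.of_forall fun x => ?_)
  simp only [Finset.restrict]
  rw [Finset.sum_coe_sort I (fun k => t k * x k)]

/-- A measure on the product is determined by its finite-dimensional marginals. Initial segments
suffice, since weights on any finite index set can be padded with zeros. -/
theorem eq_gaussianSeq_of_integral_cexp {ν : Measure (ℕ → ℂ)} [IsProbabilityMeasure ν]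
    (h : ∀ (K : ℕ) (t : ℕ → ℂ),
      ∫ x : ℕ → ℂ, Complex.exp (Complex.I * ((∑ k ∈ Finset.range K, t k * x k).re : ℂ)) ∂ν =
        Complex.exp (-((∑ k ∈ Finset.range K, ‖t k‖ ^ 2) / 4 : ℝ))) : ν = gaussianSeq := by
  refine ((Measure.isProjectiveLimit_infinitePi
    (fun _ : ℕ => stdComplexGaussian)).unique fun I => ?_).symm
  have : IsProbabilityMeasure (ν.map I.restrict) :=
    Measure.isProbabilityMeasure_map (Finset.measurable_restrict I).aemeasurable
  refine measure_ext_of_integral_cexp fun t => ?_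
  rw [integral_cexp_pi_stdComplexGaussian, integral_map
    (Finset.measurable_restrict I).aemeasurable (measurable_cexp_sum _ _).aestronglyMeasurable]
  let t' : ℕ → ℂ := fun k => if hk : k ∈ I then t ⟨k, hk⟩ else 0
  obtain ⟨K, hK⟩ : ∃ K, I ⊆ Finset.range K := ⟨I.sup id + 1, fun i hi =>
    Finset.mem_range.2 (Nat.lt_succ_of_le (Finset.le_sup (f := id) hi))⟩
  have h1 : ∀ x : ℕ → ℂ, ∑ i : I, t i * I.restrict x i = ∑ k ∈ Finset.range K, t' k * x k := by
    intro x
    rw [← Finset.sum_subset hK (fun k _ hk => by simp [t', hk]),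
      ← Finset.sum_coe_sort I (fun k => t' k * x k)]
    refine Finset.sum_congr rfl fun i _ => ?_
    simp [t']
  have h2 : ∑ i : I, ‖t i‖ ^ 2 = ∑ k ∈ Finset.range K, ‖t' k‖ ^ 2 := by
    rw [← Finset.sum_subset hK (fun k _ hk => by simp [t', hk]),
      ← Finset.sum_coe_sort I (fun k => ‖t' k‖ ^ 2)]
    refine Finset.sum_congr rfl fun i _ => ?_
    simp [t']
  simp_rw [h1, h2]
  exact h K t'

/-- Prepend an entry to a sequence. -/
def seqCons (c : ℂ) (x : ℕ → ℂ) : ℕ → ℂ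
  | 0 => c
  | n + 1 => x n

@[simp] theorem seqCons_zero (c : ℂ) (x : ℕ → ℂ) : seqCons c x 0 = c := rfl

@[simp] theorem seqCons_succ (c : ℂ) (x : ℕ → ℂ) (n : ℕ) : seqCons c x (n + 1) = x n := rfl

theorem measurable_seqCons : Measurable fun p : ℂ × (ℕ → ℂ) => seqCons p.1 p.2 := by
  refine measurable_pi_lambda _ fun n => ?_
  cases n with
  | zero => exact measurable_fst
  | succ n => exact (measurable_pi_apply n).comp measurable_snd

theorem gaussianSeq_eq_map_seqCons :
    (stdComplexGaussian.prod gaussianSeq).map (fun p => seqCons p.1 p.2) = gaussianSeq := by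
  have : IsProbabilityMeasure
      ((stdComplexGaussian.prod gaussianSeq).map (fun p => seqCons p.1 p.2)) :=
    Measure.isProbabilityMeasure_map measurable_seqCons.aemeasurable
  refine eq_gaussianSeq_of_integral_cexp fun K t => ?_
  rw [integral_map measurable_seqCons.aemeasurable (measurable_cexp_sum _ _).aestronglyMeasurable]
  cases K with
  | zero => simp
  | succ K =>
    have h : ∀ p : ℂ × (ℕ → ℂ), Complex.exp (Complex.I *
        ((∑ k ∈ Finset.range (K + 1), t k * seqCons p.1 p.2 k).re : ℂ)) =
        Complex.exp (Complex.I * ((t 0 * p.1).re : ℂ)) * Complex.exp (Complex.I *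
          ((∑ k ∈ Finset.range K, t (k + 1) * p.2 k).re : ℂ)) := by
      intro p
      rw [← Complex.exp_add, Finset.sum_range_succ', Complex.add_re]
      simp only [seqCons_zero, seqCons_succ]
      push_cast
      ring_nf
    simp_rw [h]
    rw [integral_prod_mul (fun z => Complex.exp (Complex.I * ((t 0 * z).re : ℂ)))
      (fun x : ℕ → ℂ => Complex.exp (Complex.I *
          ((∑ k ∈ Finset.range K, t (k + 1) * x k).re : ℂ))), integral_cexp_stdComplexGaussian,
      integral_cexp_gaussianSeq_finset _ (fun k => t (k + 1)), ← Complex.exp_add,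
      Finset.sum_range_succ' (fun k => ‖t k‖ ^ 2)]
    congr 1
    push_cast
    ring

/-- Integrates out the zeroth coefficient against its density, using that the shifted sequence is
independent of it and has the same law. -/
theorem lintegral_gaussianSeq {f : (ℕ → ℂ) → ℝ≥0∞} (hf : Measurable f) :
    ∫⁻ x, f x ∂gaussianSeq = ∫⁻ x, ∫⁻ c : ℂ, ENNReal.ofReal (complexGaussianDensity c) *
      f (seqCons c x) ∂volume ∂gaussianSeq := by
  conv_lhs => rw [← gaussianSeq_eq_map_seqCons]
  have hm : Measurable fun p : ℂ × (ℕ → ℂ) => f (seqCons p.1 p.2) := hf.comp measurable_seqCons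
  rw [lintegral_map hf measurable_seqCons, lintegral_prod_symm' _ hm]
  refine lintegral_congr fun x => ?_
  exact lintegral_stdComplexGaussian (hm.comp (measurable_id.prodMk measurable_const))

/-! ### The law of the coefficient process -/

theorem setIntegral_cexp_uniformSpectralMeasure (m : ℤ) :
    ∫ t in Ioc (-Real.pi) Real.pi, Complex.exp (-(Complex.I * (m : ℂ) * (t : ℂ)))
      ∂uniformSpectralMeasure = if m = 0 then 1 else 0 := by
  rw [uniformSpectralMeasure, Measure.restrict_smul, Measure.restrict_restrict measurableSet_Ioc,
    inter_self, integral_smul_measure, ENNReal.toReal_ofReal (by positivity),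
    ← intervalIntegral.integral_of_le (by linarith [Real.pi_pos])]
  have hpi : (Real.pi : ℂ) ≠ 0 := by exact_mod_cast Real.pi_ne_zero
  split_ifs with hm
  · simp [hm]
    field_simp
    norm_num
  · have hc : -(Complex.I * (m : ℂ)) ≠ 0 := by
      simp [hm]
    have h : ∀ t : ℝ, Complex.exp (-(Complex.I * (m : ℂ) * (t : ℂ))) =
        Complex.exp (-(Complex.I * (m : ℂ)) * t) := fun t => by ring_nf
    simp_rw [h]
    rw [integral_exp_mul_complex hc]
    have h2 : Complex.exp (-(Complex.I * (m : ℂ)) * (Real.pi : ℝ)) =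
        Complex.exp (-(Complex.I * (m : ℂ)) * ((-Real.pi : ℝ) : ℂ)) := by
      rw [Complex.exp_eq_exp_iff_exists_int]
      refine ⟨-m, ?_⟩
      push_cast
      ring
    rw [h2, sub_self, zero_div, smul_zero]

section
variable {Ω : Type*} [MeasurableSpace Ω] {P : Measure Ω} {ξ : ℕ → Ω → ℂ}

theorem IsStationaryComplexGaussian.integral_mul_conj
    (hξ : IsStationaryComplexGaussian P ξ uniformSpectralMeasure) (k l : ℕ) :
    ∫ ω, ξ k ω * conj (ξ l ω) ∂P = if k = l then 1 else 0 := by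
  rw [hξ.spectral k l]
  have h := setIntegral_cexp_uniformSpectralMeasure ((k : ℤ) - (l : ℤ))
  have h2 : ∀ t : ℝ, Complex.exp (-(Complex.I * (((k : ℤ) - (l : ℤ) : ℤ) : ℂ) * (t : ℂ))) =
    Complex.exp (-(Complex.I * (((k : ℤ) - (l : ℤ) : ℤ) : ℂ) * (t : ℂ))) := fun _ => rfl
  rw [h]
  simp only [sub_eq_zero, Nat.cast_inj]

/-- For `W = ∑ t_k ξ_k`, circularity gives `E W² = 0` and the spectral condition gives `E |W|² = ∑
|t_k|²`. As `(Re W)² = (|W|² + Re W²) / 2`, the real part is a centered real Gaussian of variance `∑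
|t_k|² / 2`. -/
theorem IsStationaryComplexGaussian.integral_cexp
    (hξ : IsStationaryComplexGaussian P ξ uniformSpectralMeasure) (K : ℕ) (t : ℕ → ℂ) :
    ∫ ω, Complex.exp (Complex.I * ((∑ k ∈ Finset.range K, t k * ξ k ω).re : ℂ)) ∂P =
      Complex.exp (-((∑ k ∈ Finset.range K, ‖t k‖ ^ 2) / 4 : ℝ)) := by
  have hprob := hξ.gaussian.isProbabilityMeasure
  set W : Ω → ℂ := fun ω => ∑ k ∈ Finset.range K, t k * ξ k ω with hW
  have hL2 : ∀ k, MemLp (ξ k) 2 P := fun k => (hξ.gaussian.hasGaussianLaw_eval k).memLp_two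
  have hint : ∀ k, Integrable (ξ k) P := fun k => (hL2 k).integrable (by norm_num)
  have hmul : ∀ k l, Integrable (fun ω => ξ k ω * ξ l ω) P := fun k l =>
    (hL2 k).integrable_mul (hL2 l)
  have hconj : ∀ k, MemLp (fun ω => conj (ξ k ω)) 2 P := fun k =>  (hL2 k).star
  have hmulc : ∀ k l, Integrable (fun ω => ξ k ω * conj (ξ l ω)) P := fun k l =>
    (hL2 k).integrable_mul (hconj l)
  have hWint : Integrable W P := integrable_finsetSum _ fun k _ => (hint k).const_mul _
  have hEW : ∫ ω, W ω ∂P = 0 := by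
    rw [integral_finsetSum _ fun k _ => (hint k).const_mul _]
    simp_rw [integral_const_mul, hξ.centered, mul_zero, Finset.sum_const_zero]
  have e1 : ∀ ω, W ω * W ω = ∑ k ∈ Finset.range K, ∑ l ∈ Finset.range K,
      t k * t l * (ξ k ω * ξ l ω) := by
    intro ω
    rw [hW, Finset.sum_mul_sum]
    exact Finset.sum_congr rfl fun k _ => Finset.sum_congr rfl fun l _ => by ring
  have e2 : ∀ ω, W ω * conj (W ω) = ∑ k ∈ Finset.range K, ∑ l ∈ Finset.range K,
      t k * conj (t l) * (ξ k ω * conj (ξ l ω)) := by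
    intro ω
    rw [hW, map_sum, Finset.sum_mul_sum]
    exact Finset.sum_congr rfl fun k _ => Finset.sum_congr rfl fun l _ => by
      rw [map_mul]; ring
  have hWW : Integrable (fun ω => W ω * W ω) P := by
    simp_rw [e1]
    exact integrable_finsetSum _ fun k _ => integrable_finsetSum _ fun l _ =>
      (hmul k l).const_mul _
  have hWWc : Integrable (fun ω => W ω * conj (W ω)) P := by
    simp_rw [e2]
    exact integrable_finsetSum _ fun k _ => integrable_finsetSum _ fun l _ =>
      (hmulc k l).const_mul _
  have hE2 : ∫ ω, W ω * W ω ∂P = 0 := by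
    simp_rw [e1]
    rw [integral_finsetSum _ fun k _ => integrable_finsetSum _ fun l _ =>
      (hmul k l).const_mul _]
    refine Finset.sum_eq_zero fun k _ => ?_
    rw [integral_finsetSum _ fun l _ => (hmul k l).const_mul _]
    refine Finset.sum_eq_zero fun l _ => ?_
    rw [integral_const_mul, hξ.circular, mul_zero]
  have hE2c : ∫ ω, W ω * conj (W ω) ∂P = ((∑ k ∈ Finset.range K, ‖t k‖ ^ 2 : ℝ) : ℂ) := by
    simp_rw [e2]
    rw [integral_finsetSum _ fun k _ => integrable_finsetSum _ fun l _ =>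
      (hmulc k l).const_mul _, Complex.ofReal_sum]
    refine Finset.sum_congr rfl fun k hk => ?_
    rw [integral_finsetSum _ fun l _ => (hmulc k l).const_mul _]
    simp_rw [integral_const_mul, hξ.integral_mul_conj]
    simp only [mul_ite, mul_one, mul_zero]
    rw [Finset.sum_ite_eq, if_pos hk, Complex.mul_conj, Complex.normSq_eq_norm_sq]
  -- the real part is a real Gaussian variable
  let Z : Ω → ℝ := fun ω => (W ω).re
  have hZ : HasGaussianLaw Z P := by
    let L : ((Finset.range K) → ℂ) →L[ℝ] ℝ :=
      ∑ k : Finset.range K, Complex.reCLM.comp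
        (((ContinuousLinearMap.mul ℝ ℂ) (t k)).comp (ContinuousLinearMap.proj k))
    have h := (hξ.gaussian.hasGaussianLaw (Finset.range K)).map_fun L
    refine h.congr (Filter.Eventually.of_forall fun ω => ?_)
    simp only [L, Z, hW, sum_apply, ContinuousLinearMap.comp_apply,
      Complex.reCLM_apply, Complex.re_sum, ContinuousLinearMap.mul_apply',
      ContinuousLinearMap.proj_apply, Finset.restrict]
    exact Finset.sum_coe_sort (Finset.range K) (fun k => (t k * ξ k ω).re)
  have hZ0 : ∫ ω, Z ω ∂P = 0 := by
    have h : ∫ ω, Z ω ∂P = (∫ ω, W ω ∂P).re := integral_re hWint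
    rw [h, hEW, Complex.zero_re]
  have hZ2 : ∫ ω, Z ω ^ 2 ∂P = (∑ k ∈ Finset.range K, ‖t k‖ ^ 2) / 2 := by
    have h : ∀ ω, Z ω ^ 2 = ((W ω * conj (W ω)).re + (W ω * W ω).re) / 2 := by
      intro ω
      simp only [Z, Complex.mul_re, Complex.conj_re, Complex.conj_im]
      ring
    simp_rw [h]
    have i1 : Integrable (fun ω => (W ω * conj (W ω)).re) P := hWWc.re
    have i2 : Integrable (fun ω => (W ω * W ω).re) P := hWW.re
    rw [integral_div, integral_add i1 i2]
    have h1 : ∫ ω, (W ω * conj (W ω)).re ∂P = (∫ ω, W ω * conj (W ω) ∂P).re := integral_re hWWc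
    have h2 : ∫ ω, (W ω * W ω).re ∂P = (∫ ω, W ω * W ω ∂P).re := integral_re hWW
    rw [h1, h2, hE2, hE2c, Complex.zero_re, add_zero, Complex.ofReal_re]
  have hvar : Var[Z; P] = (∑ k ∈ Finset.range K, ‖t k‖ ^ 2) / 2 := by
    rw [variance_of_integral_eq_zero hZ.aemeasurable hZ0, hZ2]
  have hlaw := hZ.map_eq_gaussianReal
  rw [hvar, hZ0] at hlaw
  have hchar := charFun_gaussianReal (μ := 0)
    (v := ((∑ k ∈ Finset.range K, ‖t k‖ ^ 2) / 2).toNNReal) 1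
  rw [← hlaw, charFun_apply_real, integral_map hZ.aemeasurable (by fun_prop),
    Real.coe_toNNReal _ (by positivity)] at hchar
  refine (integral_congr_ae (Filter.Eventually.of_forall fun ω => ?_)).trans (hchar.trans ?_)
  · simp only [Z, Complex.ofReal_one, one_mul]
    rw [mul_comm]
  · congr 1
    push_cast
    ring

/-- The law of the coefficient sequence is the infinite product of standard complex Gaussians. -/
theorem IsStationaryComplexGaussian.map_eq_gaussianSeq
    (hξ : IsStationaryComplexGaussian P ξ uniformSpectralMeasure) :
    P.map (fun ω k => ξ k ω) = gaussianSeq := by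
  have hprob := hξ.gaussian.isProbabilityMeasure
  have hm : AEMeasurable (fun ω k => ξ k ω) P := aemeasurable_pi_lambda _ hξ.gaussian.aemeasurable
  have : IsProbabilityMeasure (P.map (fun ω k => ξ k ω)) := Measure.isProbabilityMeasure_map hm
  refine eq_gaussianSeq_of_integral_cexp fun K t => ?_
  rw [integral_map hm (measurable_cexp_sum _ _).aestronglyMeasurable]
  exact hξ.integral_cexp K t

end

/-! ### Power series with subexponential coefficients -/

/-- The sum of the power series with coefficient sequence `x`. -/
noncomputable def powerSum (x : ℕ → ℂ) (z : ℂ) : ℂ := ∑' k : ℕ, x k * z ^ k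

/-- In `ℂ` summability is absolute summability, hence finiteness of a measurable `ℝ≥0∞`-valued sum.
-/
theorem measurableSet_summable {α : Type*} [MeasurableSpace α] {f : ℕ → α → ℂ}
    (hf : ∀ k, Measurable (f k)) : MeasurableSet {a | Summable fun k => f k a} := by
  have h : {a | Summable fun k => f k a} = {a | ∑' k, (‖f k a‖₊ : ℝ≥0∞) ≠ ∞} := by
    ext a
    rw [mem_ofPred_eq, mem_ofPred_eq, ENNReal.tsum_coe_ne_top_iff_summable,
      ← summable_norm_iff, ← NNReal.summable_coe]
    rfl
  rw [h]
  refine (measurableSet_eq_fun ?_ measurable_const).compl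
  exact Measurable.tsum fun k => (hf k).nnnorm.coe_nnreal_ennreal

theorem measurable_powerSum : Measurable fun p : (ℕ → ℂ) × ℂ => powerSum p.1 p.2 :=
  Measurable.tsum fun k => by fun_prop

theorem measurable_powerSum_left (z : ℂ) : Measurable fun x : ℕ → ℂ => powerSum x z :=
  measurable_powerSum.comp (measurable_id.prodMk measurable_const)

/-- The radius of convergence of the power series with coefficients `x` is at least one. -/
def IsSubexponential (x : ℕ → ℂ) : Prop :=
  ∀ m : ℕ, Summable fun k => x k * (((m : ℝ) / (m + 1) : ℝ) : ℂ) ^ k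

theorem measurableSet_isSubexponential : MeasurableSet {x | IsSubexponential x} := by
  have h : {x | IsSubexponential x} = ⋂ m : ℕ, {x : ℕ → ℂ | Summable fun k =>
      x k * (((m : ℝ) / (m + 1) : ℝ) : ℂ) ^ k} := by
    ext x
    simp [IsSubexponential]
  rw [h]
  exact MeasurableSet.iInter fun m => measurableSet_summable fun k => by fun_prop

theorem exists_nat_div_gt {r : ℝ} (hr : r < 1) : ∃ m : ℕ, r < (m : ℝ) / (m + 1) := by
  obtain ⟨m, hm⟩ := exists_nat_one_div_lt (sub_pos.2 hr)
  refine ⟨m, ?_⟩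
  have : (m : ℝ) / (m + 1) = 1 - 1 / (m + 1) := by
    field_simp
    ring
  rw [this]
  linarith

theorem IsSubexponential.summable_norm {x : ℕ → ℂ} (hx : IsSubexponential x) {r : ℝ}
    (h0 : 0 ≤ r) (hr : r < 1) : Summable fun k => ‖x k‖ * r ^ k := by
  obtain ⟨m, hm⟩ := exists_nat_div_gt hr
  refine Summable.of_nonneg_of_le (fun k => by positivity) (fun k => ?_) (hx m).norm
  rw [norm_mul, norm_pow, Complex.norm_real, Real.norm_of_nonneg (h0.trans hm.le)]
  gcongr

theorem IsSubexponential.summable {x : ℕ → ℂ} (hx : IsSubexponential x) {z : ℂ} (hz : ‖z‖ < 1) :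
    Summable fun k => x k * z ^ k := by
  rw [← summable_norm_iff]
  simpa only [norm_mul, norm_pow] using hx.summable_norm (norm_nonneg z) hz

theorem isSubexponential_of_summable_norm {x : ℕ → ℂ}
    (h : ∀ r : ℝ, 0 ≤ r → r < 1 → Summable fun k => ‖x k‖ * r ^ k) : IsSubexponential x := by
  intro m
  rw [← summable_norm_iff]
  have h1 : (m : ℝ) / (m + 1) < 1 := by
    rw [div_lt_one (by positivity)]
    linarith
  have h2 := h ((m : ℝ) / (m + 1)) (by positivity) h1
  refine h2.congr fun k => ?_
  rw [norm_mul, norm_pow, Complex.norm_real, Real.norm_of_nonneg (by positivity)]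

theorem IsSubexponential.differentiableOn {x : ℕ → ℂ} (hx : IsSubexponential x) :
    DifferentiableOn ℂ (powerSum x) (Metric.ball 0 1) := by
  intro z hz
  rw [mem_ball_zero_iff] at hz
  obtain ⟨r, hzr, hr⟩ := exists_between hz
  have hr0 : 0 ≤ r := (norm_nonneg z).trans hzr.le
  have h : DifferentiableOn ℂ (powerSum x) (Metric.ball 0 r) := by
    refine Complex.differentiableOn_tsum_of_summable_norm (hx.summable_norm hr0 hr)
      (fun k => by fun_prop) Metric.isOpen_ball fun k w hw => ?_
    rw [mem_ball_zero_iff] at hw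
    rw [norm_mul, norm_pow]
    gcongr
  exact (h.differentiableAt (Metric.isOpen_ball.mem_nhds
    (mem_ball_zero_iff.2 hzr))).differentiableWithinAt

/-! ### Zeros of a power series in the disk and measurability of their number -/

theorem openUnitDisk_eq_ball : openUnitDisk = Metric.ball 0 1 := by
  ext z
  simp [openUnitDisk]

theorem isOpen_openUnitDisk : IsOpen openUnitDisk := by
  rw [openUnitDisk_eq_ball]
  exact Metric.isOpen_ball

/-- The zeros in the unit disk of a power series, provided that it converges in the disk and does
not vanish identically. -/
def regularZeros (x : ℕ → ℂ) : Set ℂ :=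
  {z | (IsSubexponential x ∧ ∃ w ∈ openUnitDisk, powerSum x w ≠ 0) ∧
    z ∈ openUnitDisk ∧ powerSum x z = 0}

theorem regularZeros_subset (x : ℕ → ℂ) : regularZeros x ⊆ openUnitDisk := fun _ hz => hz.2.1

/-- Identity theorem on the connected disk. For degenerate `x` the set `regularZeros x` is empty by
definition, so the finiteness holds for every sequence and not only almost surely. -/
theorem finite_regularZeros_inter (x : ℕ → ℂ) {C : Set ℂ} (hC : IsCompact C)
    (hCD : C ⊆ openUnitDisk) : (regularZeros x ∩ C).Finite := by
  by_cases hx : IsSubexponential x ∧ ∃ w ∈ openUnitDisk, powerSum x w ≠ 0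
  · obtain ⟨hx, w, hw, hxw⟩ := hx
    by_contra hinf
    obtain ⟨z, hzC, hz⟩ := Set.Infinite.exists_accPt_of_subset_isCompact hinf hC inter_subset_right
    have hD : AnalyticOnNhd ℂ (powerSum x) (Metric.ball 0 1) :=
      hx.differentiableOn.analyticOnNhd Metric.isOpen_ball
    rw [openUnitDisk_eq_ball] at hCD hw
    have h := hD.eqOn_zero_of_preconnected_of_frequently_eq_zero
      (convex_ball (0 : ℂ) 1).isPreconnected (hCD hzC) ?_
    · exact hxw (h hw)
    · rw [accPt_iff_frequently_nhdsNE] at hz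
      exact hz.mono fun y hy => hy.1.2.2
  · convert Set.finite_empty
    ext z
    simp only [mem_inter_iff, mem_empty_iff_false, iff_false]
    exact fun h => hx h.1.1

/-- By continuity, a nonzero value is attained on an open set, so it can be sought among countably
many points. -/
theorem measurableSet_exists_powerSum_ne_zero :
    MeasurableSet {x | IsSubexponential x ∧ ∃ w ∈ openUnitDisk, powerSum x w ≠ 0} := by
  obtain ⟨D, hDc, hDd⟩ := TopologicalSpace.exists_countable_dense ℂ
  have h : {x | IsSubexponential x ∧ ∃ w ∈ openUnitDisk, powerSum x w ≠ 0} =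
      {x | IsSubexponential x} ∩ ⋃ q ∈ D ∩ openUnitDisk, {x | powerSum x q ≠ 0} := by
    ext x
    simp only [mem_ofPred_eq, mem_inter_iff, mem_iUnion, exists_prop]
    refine and_congr_right fun hx => ⟨?_, fun ⟨q, hq, h⟩ => ⟨q, hq.2, h⟩⟩
    rintro ⟨w, hw, hxw⟩
    have hopen : IsOpen (openUnitDisk ∩ powerSum x ⁻¹' {0}ᶜ) := by
      have := hx.differentiableOn.continuousOn
      rw [← openUnitDisk_eq_ball] at this
      exact this.isOpen_inter_preimage isOpen_openUnitDisk isOpen_compl_singleton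
    obtain ⟨q, hq, hqD⟩ := hDd.exists_mem_open hopen ⟨w, hw, hxw⟩
    exact ⟨q, ⟨hq, hqD.1⟩, hqD.2⟩
  rw [h]
  refine measurableSet_isSubexponential.inter (MeasurableSet.biUnion
    (hDc.mono inter_subset_left) fun q _ => ?_)
  exact (measurableSet_eq_fun (measurable_powerSum_left q) measurable_const).compl

/-- By compactness and continuity, the series has a zero on `C` exactly when its modulus becomes
arbitrarily small on a countable dense subset of `C`. -/
theorem measurableSet_regularZeros_inter_nonempty {C : Set ℂ} (hC : IsCompact C)
    (hCD : C ⊆ openUnitDisk) : MeasurableSet {x | (regularZeros x ∩ C).Nonempty} := by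
  obtain ⟨D, hDC, hDc, hDd⟩ := hC.isSeparable.exists_countable_dense_subset
  have h : {x | (regularZeros x ∩ C).Nonempty} =
      {x | IsSubexponential x ∧ ∃ w ∈ openUnitDisk, powerSum x w ≠ 0} ∩
        ⋂ m : ℕ, ⋃ q ∈ D, {x | ‖powerSum x q‖ < 1 / ((m : ℝ) + 1)} := by
    ext x
    simp only [mem_inter_iff, mem_iInter, mem_iUnion, exists_prop]
    constructor
    · rintro ⟨z, hz, hzC⟩
      refine ⟨hz.1, fun m => ?_⟩
      have hcont : ContinuousOn (powerSum x) C := by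
        refine hz.1.1.differentiableOn.continuousOn.mono ?_
        rwa [← openUnitDisk_eq_ball]
      have h1 : Filter.Tendsto (fun w => ‖powerSum x w‖) (nhdsWithin z C) (nhds 0) := by
        have := (hcont z hzC).norm.tendsto
        rwa [hz.2.2, norm_zero] at this
      have h2 := h1.eventually (gt_mem_nhds (by positivity : (0 : ℝ) < 1 / ((m : ℝ) + 1)))
      have h3 : ∃ᶠ y in nhdsWithin z D, True := by
        have := mem_closure_iff_nhdsWithin_neBot.1 (hDd hzC)
        exact Filter.frequently_true_iff_neBot _ |>.2 this
      have h4 := h3.and_eventually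
        ((h2.filter_mono (nhdsWithin_mono z hDC)).and self_mem_nhdsWithin)
      obtain ⟨q, -, hq1, hq2⟩ := h4.exists
      exact ⟨q, hq2, hq1⟩
    · rintro ⟨hx, hm⟩
      have hcont : ContinuousOn (fun z => ‖powerSum x z‖) C := by
        refine (hx.1.differentiableOn.continuousOn.mono ?_).norm
        rwa [← openUnitDisk_eq_ball]
      -- Used only to know that `C` is nonempty, so that the minimum exists.
      obtain ⟨q, hq, -⟩ := hm 0
      obtain ⟨z, hz, hmin⟩ := hC.exists_isMinOn ⟨q, hDC hq⟩ hcont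
      refine ⟨z, ⟨hx, hCD hz, ?_⟩, hz⟩
      by_contra hne
      obtain ⟨m, hm'⟩ := exists_nat_one_div_lt (norm_pos_iff.2 hne)
      obtain ⟨q, hq, hlt⟩ := hm m
      have := hmin (hDC hq)
      simp only [mem_ofPred_eq] at this hlt
      linarith
  rw [h]
  refine measurableSet_exists_powerSum_ne_zero.inter (MeasurableSet.iInter fun m =>
    MeasurableSet.biUnion hDc fun q _ => ?_)
  exact measurableSet_lt (measurable_powerSum_left q).norm measurable_const

theorem exists_disjoint_balls {D : Set ℂ} (hD : Dense D) (T : Finset ℂ) :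
    ∃ (f : T → D) (m : ℕ), (∀ z : T, (z : ℂ) ∈ Metric.closedBall (f z : ℂ) (1 / ((m : ℝ) + 1))) ∧
      Pairwise fun z w : T => Disjoint (Metric.closedBall (f z : ℂ) (1 / ((m : ℝ) + 1)))
        (Metric.closedBall (f w : ℂ) (1 / ((m : ℝ) + 1))) := by
  obtain ⟨δ, hδ, hsep⟩ : ∃ δ > 0, ∀ z ∈ T, ∀ w ∈ T, z ≠ w → δ ≤ dist z w := by
    by_cases hne : T.offDiag.Nonempty
    · obtain ⟨p, hp, hmin⟩ := T.offDiag.exists_min_image (fun p => dist p.1 p.2) hne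
      rw [Finset.mem_offDiag] at hp
      exact ⟨dist p.1 p.2, dist_pos.2 hp.2.2, fun z hz w hw hzw =>
        hmin (z, w) (Finset.mem_offDiag.2 ⟨hz, hw, hzw⟩)⟩
    · refine ⟨1, one_pos, fun z hz w hw hzw => (hne ⟨(z, w), ?_⟩).elim⟩
      exact Finset.mem_offDiag.2 ⟨hz, hw, hzw⟩
  -- A point common to the balls of `z` and `w` would give `dist z w` at most four radii,
  -- contradicting the separation `δ`.
  obtain ⟨m, hm⟩ := exists_nat_one_div_lt (by positivity : (0 : ℝ) < δ / 4)
  have h1 : ∀ z : T, ∃ q : D, dist (z : ℂ) q < 1 / ((m : ℝ) + 1) := by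
    intro z
    obtain ⟨q, hq, h⟩ := hD.exists_dist_lt (z : ℂ) (by positivity : (0 : ℝ) < 1 / ((m : ℝ) + 1))
    exact ⟨⟨q, hq⟩, h⟩
  choose f hf using h1
  refine ⟨f, m, fun z => (hf z).le, fun z w hzw => ?_⟩
  refine Set.disjoint_left.2 fun y hy1 hy2 => ?_
  have h2 := hsep z z.2 w w.2 fun h => hzw (Subtype.ext h)
  have h3 := dist_triangle (z : ℂ) (f z) w
  have h4 := dist_triangle (f z : ℂ) y w
  have h5 := dist_triangle y (f w : ℂ) w
  have h6 := hf z
  have h7 := hf w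
  rw [Metric.mem_closedBall] at hy1 hy2
  rw [dist_comm] at h7
  rw [dist_comm y] at hy1
  linarith

/-- There are at least `k` zeros in `C` exactly when `k` pairwise disjoint balls from a fixed
countable family each meet the zeros in `C`, a countable union of hitting events. -/
theorem measurableSet_le_encard {C : Set ℂ} (hC : IsCompact C) (hCD : C ⊆ openUnitDisk) (k : ℕ) :
    MeasurableSet {x | (k : ℕ∞) ≤ (regularZeros x ∩ C).encard} := by
  obtain ⟨D, hDc, hDd⟩ := TopologicalSpace.exists_countable_dense ℂ
  have : Countable D := hDc.to_subtype
  let B : D → ℕ → Set ℂ := fun q m => Metric.closedBall (q : ℂ) (1 / ((m : ℝ) + 1))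
  have h : {x | (k : ℕ∞) ≤ (regularZeros x ∩ C).encard} =
      ⋃ (m : ℕ) (f : {f : Fin k → D // Pairwise fun i j => Disjoint (B (f i) m) (B (f j) m)}),
        ⋂ i, {x | (regularZeros x ∩ (C ∩ B (f.1 i) m)).Nonempty} := by
    ext x
    simp only [mem_iUnion, mem_iInter, mem_ofPred_eq]
    constructor
    · intro hk
      obtain ⟨T, hT, hTk⟩ := Set.exists_subset_encard_eq hk
      have hTf : T.Finite := Set.finite_of_encard_eq_coe hTk
      lift T to Finset ℂ using hTf
      rw [Set.encard_coe_eq_coe_finsetCard, Nat.cast_inj] at hTk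
      obtain ⟨f, m, hmem, hdisj⟩ := exists_disjoint_balls hDd T
      let e : Fin k ≃ T := (T.equivFinOfCardEq hTk).symm
      refine ⟨m, ⟨fun i => f (e i), fun i j hij => hdisj (e.injective.ne hij)⟩, fun i => ?_⟩
      exact ⟨e i, (hT (e i).2).1, (hT (e i).2).2, hmem (e i)⟩
    · rintro ⟨m, f, hf⟩
      choose z hz using hf
      have hinj : Function.Injective z := by
        intro i j hij
        by_contra hne
        exact Set.disjoint_left.1 (f.2 hne) (hz i).2.2 (hij ▸ (hz j).2.2)
      have h1 : (range z).encard = k := by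
        rw [← image_univ, hinj.encard_image, encard_univ]
        simp
      rw [← h1]
      refine encard_le_encard ?_
      rintro _ ⟨i, rfl⟩
      exact ⟨(hz i).1, (hz i).2.1⟩
  rw [h]
  refine MeasurableSet.iUnion fun m => MeasurableSet.iUnion fun f => MeasurableSet.iInter fun i =>
    measurableSet_regularZeros_inter_nonempty (hC.inter_right Metric.isClosed_closedBall)
      (inter_subset_left.trans hCD)

/-! ### Measurability of sums over zeros -/

/-- The closed disk of radius `m / (m + 1)`. -/
def innerDisk (m : ℕ) : Set ℂ := Metric.closedBall 0 ((m : ℝ) / (m + 1))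

theorem innerDisk_subset (m : ℕ) : innerDisk m ⊆ openUnitDisk := by
  intro z hz
  rw [innerDisk, mem_closedBall_zero_iff] at hz
  refine lt_of_le_of_lt hz ?_
  rw [div_lt_one (by positivity)]
  linarith

theorem isCompact_innerDisk (m : ℕ) : IsCompact (innerDisk m) := isCompact_closedBall _ _

theorem innerDisk_mono : Monotone innerDisk := by
  intro m n hmn
  refine Metric.closedBall_subset_closedBall ?_
  have h : (m : ℝ) ≤ n := by exact_mod_cast hmn
  rw [div_le_div_iff₀ (by positivity) (by positivity)]
  nlinarith

theorem iUnion_innerDisk : ⋃ m, innerDisk m = openUnitDisk := by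
  refine Subset.antisymm (iUnion_subset innerDisk_subset) fun z hz => ?_
  obtain ⟨m, hm⟩ := exists_nat_div_gt (r := ‖z‖) hz
  exact mem_iUnion.2 ⟨m, mem_closedBall_zero_iff.2 hm.le⟩

/-- The counting measure of the zeros in a compact disk. -/
noncomputable def zeroMeasure (m : ℕ) (x : ℕ → ℂ) : Measure ℂ :=
  Measure.count.restrict (regularZeros x ∩ innerDisk m)

theorem finite_zeros_innerDisk (m : ℕ) (x : ℕ → ℂ) : (regularZeros x ∩ innerDisk m).Finite :=
  finite_regularZeros_inter x (isCompact_innerDisk m) (innerDisk_subset m)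

theorem zeroMeasure_apply (m : ℕ) (x : ℕ → ℂ) {B : Set ℂ} (hB : MeasurableSet B) :
    zeroMeasure m x B = ((regularZeros x ∩ (innerDisk m ∩ B)).encard : ℝ≥0∞) := by
  rw [zeroMeasure, Measure.restrict_apply hB, inter_comm, inter_assoc, Measure.count_apply]
  rw [← inter_assoc]
  exact ((finite_zeros_innerDisk m x).inter_of_left B).measurableSet

instance (m : ℕ) (x : ℕ → ℂ) : IsFiniteMeasure (zeroMeasure m x) := by
  constructor
  rw [zeroMeasure_apply m x MeasurableSet.univ, inter_univ,
    (finite_zeros_innerDisk m x).encard_eq_coe_toFinset_card]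
  exact ENNReal.natCast_lt_top _

theorem measurable_toENNReal_encard {C : Set ℂ} (hC : IsCompact C) (hCD : C ⊆ openUnitDisk) :
    Measurable fun x => ((regularZeros x ∩ C).encard : ℝ≥0∞) := by
  have h : (fun x => ((regularZeros x ∩ C).encard : ℝ≥0∞)) = fun x => ∑' k : ℕ,
      {x | ((k + 1 : ℕ) : ℕ∞) ≤ (regularZeros x ∩ C).encard}.indicator (fun _ => (1 : ℝ≥0∞)) x := by
    ext x
    rw [(finite_regularZeros_inter x hC hCD).encard_eq_coe_toFinset_card]
    set N := (finite_regularZeros_inter x hC hCD).toFinset.card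
    have h1 : ∀ k, {x | ((k + 1 : ℕ) : ℕ∞) ≤ (regularZeros x ∩ C).encard}.indicator
        (fun _ => (1 : ℝ≥0∞)) x = if k < N then 1 else 0 := by
      intro k
      rw [indicator_apply]
      refine if_congr ?_ rfl rfl
      rw [mem_ofPred_eq, (finite_regularZeros_inter x hC hCD).encard_eq_coe_toFinset_card,
        Nat.cast_le]
      exact Nat.succ_le_iff
    simp_rw [h1]
    rw [tsum_eq_sum (s := Finset.range N) (fun k hk => by simpa using hk)]
    rw [Finset.sum_congr rfl fun k hk => if_pos (Finset.mem_range.1 hk)]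
    simp
  rw [h]
  exact Measurable.tsum fun k => measurable_const.indicator (measurableSet_le_encard hC hCD _)

theorem measurable_zeroMeasure (m : ℕ) : Measurable (zeroMeasure m) := by
  refine Measurable.measure_of_isPiSystem (borel_eq_generateFrom_isClosed (α := ℂ) ▸
    BorelSpace.measurable_eq) isPiSystem_isClosed (fun B hB => ?_) ?_
  · simp_rw [zeroMeasure_apply m _ (IsClosed.measurableSet hB)]
    exact measurable_toENNReal_encard ((isCompact_innerDisk m).inter_right hB)
      (inter_subset_left.trans (innerDisk_subset m))
  · simp_rw [zeroMeasure_apply m _ MeasurableSet.univ, inter_univ]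
    exact measurable_toENNReal_encard (isCompact_innerDisk m) (innerDisk_subset m)

/-- The masses are finite but not uniformly bounded. Dividing by `1 + ν a univ`, which is never
zero, gives a kernel of mass at most one; the factor is restored afterwards. -/
theorem measurable_lintegral_finiteMeasure {α β : Type*} [MeasurableSpace α] [MeasurableSpace β]
    {ν : α → Measure β} (hν : Measurable ν) [∀ a, IsFiniteMeasure (ν a)] {f : α × β → ℝ≥0∞}
    (hf : Measurable f) : Measurable fun a => ∫⁻ b, f (a, b) ∂(ν a) := by
  have hu : Measurable fun a => 1 + ν a univ :=
    measurable_const.add (Measure.measurable_measure.1 hν univ MeasurableSet.univ)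
  let η : Kernel α β := ⟨fun a => (1 + ν a univ)⁻¹ • ν a, by
    refine Measure.measurable_of_measurable_coe _ fun s hs => ?_
    simp only [Measure.smul_apply, smul_eq_mul]
    exact hu.inv.mul (Measure.measurable_measure.1 hν s hs)⟩
  have hη : IsFiniteKernel η := by
    refine ⟨1, ENNReal.one_lt_top, fun a => ?_⟩
    change (1 + ν a univ)⁻¹ * ν a univ ≤ 1
    rw [mul_comm, ← div_eq_mul_inv]
    exact ENNReal.div_le_of_le_mul (by rw [one_mul]; exact le_add_self)
  have h : ∀ a, ∫⁻ b, f (a, b) ∂(ν a) = (1 + ν a univ) * ∫⁻ b, f (a, b) ∂(η a) := by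
    intro a
    change _ = _ * ∫⁻ b, f (a, b) ∂((1 + ν a univ)⁻¹ • ν a)
    rw [lintegral_smul_measure, smul_eq_mul, ← mul_assoc, ENNReal.mul_inv_cancel, one_mul]
    · exact (lt_of_lt_of_le one_pos le_self_add).ne'
    · exact ENNReal.add_ne_top.2 ⟨ENNReal.one_ne_top, measure_ne_top _ _⟩
  simp_rw [h]
  exact hu.mul hf.lintegral_kernel_prod_right'

theorem lintegral_zeroMeasure (m : ℕ) (x : ℕ → ℂ) (f : ℂ → ℝ≥0∞) :
    ∫⁻ z, f z ∂(zeroMeasure m x) = ∑' z, (regularZeros x ∩ innerDisk m).indicator f z := by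
  have hfin := finite_zeros_innerDisk m x
  rw [← tsum_subtype, zeroMeasure, lintegral_countable _ hfin.countable]
  refine tsum_congr fun z => ?_
  rw [Measure.count_singleton, mul_one]

/-- Monotone convergence along the exhausting disks. The sums are read as integrals against counting
measure on the σ-algebra `⊤`, so that `f` need not be measurable. -/
theorem tsum_regularZeros_eq_iSup (x : ℕ → ℂ) (f : ℂ → ℝ≥0∞) :
    ∑' z, (regularZeros x).indicator f z = ⨆ m, ∫⁻ z, f z ∂(zeroMeasure m x) := by
  simp_rw [lintegral_zeroMeasure]
  have h : ∀ m, ∑' z, (regularZeros x ∩ innerDisk m).indicator f z =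
      ∫⁻ z, (regularZeros x ∩ innerDisk m).indicator f z ∂(@Measure.count ℂ ⊤) := by
    intro m
    let _ : MeasurableSpace ℂ := ⊤
    rw [lintegral_count]
  have h' : ∑' z, (regularZeros x).indicator f z =
      ∫⁻ z, (regularZeros x).indicator f z ∂(@Measure.count ℂ ⊤) := by
    let _ : MeasurableSpace ℂ := ⊤
    rw [lintegral_count]
  simp_rw [h, h']
  let _ : MeasurableSpace ℂ := ⊤
  rw [← lintegral_iSup (fun m => measurable_from_top)]
  · refine lintegral_congr fun z => ?_
    by_cases hz : z ∈ regularZeros x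
    · have hzD := regularZeros_subset x hz
      rw [← iUnion_innerDisk] at hzD
      obtain ⟨m, hm⟩ := mem_iUnion.1 hzD
      refine le_antisymm (le_iSup_of_le m ?_) (iSup_le fun k => ?_)
      · rw [indicator_of_mem hz, indicator_of_mem (mem_inter hz hm)]
      · exact indicator_le_indicator_of_subset inter_subset_left (fun _ => zero_le) z
    · simp [hz]
  · intro m n hmn z
    exact indicator_le_indicator_of_subset (inter_subset_inter_right _ (innerDisk_mono hmn))
      (fun _ => zero_le) z

theorem measurable_tsum_regularZeros {α : Type*} [MeasurableSpace α] {x : α → ℕ → ℂ}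
    (hx : Measurable x) {f : α × ℂ → ℝ≥0∞} (hf : Measurable f) :
    Measurable fun a => ∑' z, (regularZeros (x a)).indicator (fun z => f (a, z)) z := by
  simp_rw [tsum_regularZeros_eq_iSup]
  exact Measurable.iSup fun m => measurable_lintegral_finiteMeasure
    (ν := fun a => zeroMeasure m (x a)) ((measurable_zeroMeasure m).comp hx) hf

/-- The tuples with all entries in `Z`. -/
def tuples (n : ℕ) (Z : Set ℂ) : Set (Fin n → ℂ) := {a | ∀ i, a i ∈ Z}

theorem tsum_tuples_succ (n : ℕ) (Z : Set ℂ) (f : (Fin (n + 1) → ℂ) → ℝ≥0∞) :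
    ∑' a, (tuples (n + 1) Z).indicator f a =
      ∑' z, Z.indicator (fun z => ∑' a, (tuples n Z).indicator (fun a => f (Fin.cons z a)) a) z := by
  rw [← (Fin.consEquiv fun _ : Fin (n + 1) => ℂ).tsum_eq, ENNReal.tsum_prod']
  refine tsum_congr fun z => ?_
  by_cases hz : z ∈ Z
  · rw [indicator_of_mem hz]
    refine tsum_congr fun a => ?_
    have : (Fin.consEquiv (fun _ : Fin (n + 1) => ℂ) (z, a)) ∈ tuples (n + 1) Z ↔
        a ∈ tuples n Z := by
      simp [tuples, Fin.forall_fin_succ, Fin.consEquiv, hz]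
    by_cases ha : a ∈ tuples n Z
    · rw [indicator_of_mem ha, indicator_of_mem (this.2 ha)]
      rfl
    · rw [indicator_of_notMem ha, indicator_of_notMem (mt this.1 ha)]
  · rw [indicator_of_notMem hz]
    refine ENNReal.tsum_eq_zero.2 fun a => indicator_of_notMem (fun h => hz ?_) _
    exact h 0

/-- Peeling off one coordinate makes it a parameter, so the induction has to range over all
parameter spaces `α`. -/
theorem measurable_tsum_tuples (n : ℕ) {α : Type} [MeasurableSpace α] {x : α → ℕ → ℂ}
    (hx : Measurable x) {f : α × (Fin n → ℂ) → ℝ≥0∞} (hf : Measurable f) :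
    Measurable fun a => ∑' z, (tuples n (regularZeros (x a))).indicator (fun z => f (a, z)) z := by
  induction n generalizing α with
  | zero =>
    have h : ∀ a, ∑' z, (tuples 0 (regularZeros (x a))).indicator (fun z => f (a, z)) z =
        f (a, default) := by
      intro a
      rw [tsum_eq_single default fun z hz => (hz (Subsingleton.elim _ _)).elim]
      exact indicator_of_mem (fun i => i.elim0) _
    simp_rw [h]
    exact hf.comp (measurable_id.prodMk measurable_const)
  | succ n ih =>
    simp_rw [tsum_tuples_succ]
    refine measurable_tsum_regularZeros hx
      (f := fun p : α × ℂ => ∑' a, (tuples n (regularZeros (x p.1))).indicator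
        (fun a => f (p.1, Fin.cons p.2 a)) a) ?_
    refine ih (α := α × ℂ) (x := fun p => x p.1) (hx.comp measurable_fst)
      (f := fun q : (α × ℂ) × (Fin n → ℂ) => f (q.1.1, Fin.cons q.1.2 q.2)) ?_
    refine hf.comp (Measurable.prodMk (by fun_prop) ?_)
    refine measurable_pi_lambda _ fun i => ?_
    refine Fin.cases ?_ (fun i => ?_) i
    · simp only [Fin.cons_zero]
      fun_prop
    · simp only [Fin.cons_succ]
      fun_prop

/-! ### The area formula for holomorphic functions -/

theorem det_smul_one_complex (c : ℂ) : (c • (1 : ℂ →L[ℝ] ℂ)).det = ‖c‖ ^ 2 := by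
  rw [← Complex.normSq_eq_norm_sq, ← Algebra.norm_complex_apply, Algebra.norm_apply]
  change LinearMap.det _ = _
  congr 1

/-- The inverse function theorem gives injectivity neighbourhoods, the Lindelöf property countably
many of them, and disjointification makes them a partition. -/
theorem exists_countable_injOn_cover {φ : ℂ → ℂ} {V : Set ℂ} (hV : IsOpen V)
    (hφ : DifferentiableOn ℂ φ V) (h0 : ∀ z ∈ V, deriv φ z ≠ 0) :
    ∃ E : ℕ → Set ℂ, (∀ i, MeasurableSet (E i)) ∧ (∀ i, InjOn φ (E i)) ∧
      Pairwise (fun i j => Disjoint (E i) (E j)) ∧ ⋃ i, E i = V := by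
  have hloc : ∀ z ∈ V, ∃ N : Set ℂ, IsOpen N ∧ z ∈ N ∧ InjOn φ N := by
    intro z hz
    have h := ((hφ.analyticAt (hV.mem_nhds hz)).hasStrictDerivAt).hasStrictFDerivAt_equiv (h0 z hz)
    exact ⟨h.toOpenPartialHomeomorph.source, h.toOpenPartialHomeomorph.open_source,
      h.mem_toOpenPartialHomeomorph_source, h.toOpenPartialHomeomorph.injOn⟩
  choose! N hNo hNm hNi using hloc
  obtain ⟨t, htV, htc, hcov⟩ := TopologicalSpace.countable_cover_nhdsWithin
    (s := V) (f := N) fun z hz => mem_nhdsWithin_of_mem_nhds ((hNo z hz).mem_nhds (hNm z hz))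
  obtain ⟨W, hWm, hWi, hW⟩ : ∃ W : ℕ → Set ℂ, (∀ i, MeasurableSet (W i)) ∧
      (∀ i, InjOn φ (W i)) ∧ V ⊆ ⋃ i, W i := by
    rcases t.eq_empty_or_nonempty with rfl | hne
    · exact ⟨fun _ => ∅, fun _ => MeasurableSet.empty, fun _ => injOn_empty _, by simpa using hcov⟩
    · obtain ⟨s, rfl⟩ := htc.exists_eq_range hne
      refine ⟨fun i => N (s i), fun i => (hNo _ (htV ⟨i, rfl⟩)).measurableSet,
        fun i => hNi _ (htV ⟨i, rfl⟩), ?_⟩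
      simpa using hcov
  refine ⟨fun i => V ∩ disjointed W i, fun i => hV.measurableSet.inter
    (MeasurableSet.disjointed hWm i), fun i => (hWi i).mono
      (inter_subset_right.trans (disjointed_subset W i)), fun i j hij =>
      (disjoint_disjointed W hij).mono inter_subset_right inter_subset_right, ?_⟩
  rw [← inter_iUnion, iUnion_disjointed, inter_eq_left.2 hW]

theorem tsum_fiber_eq {φ : ℂ → ℂ} {E : Set ℂ} (hinj : InjOn φ E) (g : ℂ → ℝ≥0∞) {z : ℂ}
    (hz : z ∈ E) : ∑' w, {w | w ∈ E ∧ φ w = φ z}.indicator g w = g z := by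
  rw [tsum_eq_single z]
  · exact indicator_of_mem (s := {w | w ∈ E ∧ φ w = φ z}) ⟨hz, rfl⟩ g
  · intro w hw
    exact indicator_of_notMem (fun h => hw (hinj h.1 hz h.2)) g

theorem tsum_fiber_eq_zero {φ : ℂ → ℂ} {E : Set ℂ} (g : ℂ → ℝ≥0∞) {c : ℂ}
    (hc : c ∉ φ '' E) : ∑' w, {w | w ∈ E ∧ φ w = c}.indicator g w = 0 :=
  ENNReal.tsum_eq_zero.2 fun w => indicator_of_notMem (fun h => hc ⟨w, h.1, h.2⟩) g

/-- Where `φ` is injective, the fibre sum is `g` transported to the image and extended by zero, so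
the formula is the change of variables with real Jacobian `|φ'|²`. -/
theorem measurable_and_lintegral_fiber {φ φ' : ℂ → ℂ} {E : Set ℂ} (hE : MeasurableSet E)
    (hinj : InjOn φ E) (hφ : ∀ z ∈ E, HasDerivAt φ (φ' z) z) {g : ℂ → ℝ≥0∞} (hg : Measurable g) :
    Measurable (fun c => ∑' w, {w | w ∈ E ∧ φ w = c}.indicator g w) ∧
      ∫⁻ c, ∑' w, {w | w ∈ E ∧ φ w = c}.indicator g w =
        ∫⁻ z in E, ENNReal.ofReal (‖φ' z‖ ^ 2) * g z := by
  have hF : ∀ z ∈ E, HasFDerivWithinAt φ (φ' z • (1 : ℂ →L[ℝ] ℂ)) E z := fun z hz =>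
    (hφ z hz).complexToReal_fderiv.hasFDerivWithinAt
  have hemb := measurableEmbedding_of_fderivWithin hE hF hinj
  have hext : (fun c => ∑' w, {w | w ∈ E ∧ φ w = c}.indicator g w) =
      Function.extend (E.domRestrict φ) (fun z => g z) 0 := by
    ext c
    by_cases hc : c ∈ φ '' E
    · obtain ⟨z, hz, rfl⟩ := hc
      rw [tsum_fiber_eq hinj g hz]
      exact (hemb.injective.extend_apply (fun z : E => g z) 0 ⟨z, hz⟩).symm
    · rw [tsum_fiber_eq_zero g hc, Function.extend_apply']
      · rfl
      · rintro ⟨z, rfl⟩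
        exact hc ⟨z, z.2, rfl⟩
  refine ⟨?_, ?_⟩
  · rw [hext]
    exact hemb.measurable_extend (hg.comp measurable_subtype_coe) measurable_const
  · have himg : MeasurableSet (φ '' E) := measurable_image_of_fderivWithin hE hF hinj
    rw [← setLIntegral_eq_of_support_subset (s := φ '' E)
      (f := fun c => ∑' w, {w | w ∈ E ∧ φ w = c}.indicator g w),
      lintegral_image_eq_lintegral_abs_det_fderiv_mul volume hE hF hinj]
    · refine setLIntegral_congr_fun hE fun z hz => ?_
      simp only [tsum_fiber_eq hinj g hz, det_smul_one_complex, abs_of_nonneg (sq_nonneg ‖φ' z‖)]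
    · intro c hc
      by_contra h
      exact hc (tsum_fiber_eq_zero g h)

/-- Area formula: critical values form a null set by Sard, critical points contribute nothing on the
right because of the Jacobian, and the rest is a countable union of injective pieces. -/
theorem lintegral_tsum_fiber {φ : ℂ → ℂ} {U : Set ℂ} (hU : IsOpen U)
    (hφ : DifferentiableOn ℂ φ U) {g : ℂ → ℝ≥0∞} (hg : Measurable g) :
    ∫⁻ c, ∑' z, {z | z ∈ U ∧ φ z = c}.indicator g z =
      ∫⁻ z in U, ENNReal.ofReal (‖deriv φ z‖ ^ 2) * g z := by
  have hd : ContinuousOn (deriv φ) U := (hφ.deriv hU).continuousOn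
  set V := U ∩ deriv φ ⁻¹' {0}ᶜ with hVdef
  have hV : IsOpen V := hd.isOpen_inter_preimage hU isOpen_compl_singleton
  have hderiv : ∀ z ∈ U, HasDerivAt φ (deriv φ z) z := fun z hz =>
    (hφ.differentiableAt (hU.mem_nhds hz)).hasDerivAt
  obtain ⟨E, hEm, hEi, hEd, hEV⟩ := exists_countable_injOn_cover hV (hφ.mono inter_subset_left)
    fun z hz => hz.2
  have hEU : ∀ i, E i ⊆ U := fun i =>
    ((subset_iUnion E i).trans hEV.subset).trans inter_subset_left
  have hsard : volume (φ '' (U \ V)) = 0 := by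
    refine addHaar_image_eq_zero_of_det_fderivWithin_eq_zero volume
      (f' := fun z => deriv φ z • (1 : ℂ →L[ℝ] ℂ))
      (fun z hz => (hderiv z hz.1).complexToReal_fderiv.hasFDerivWithinAt) fun z hz => ?_
    have : deriv φ z = 0 := by
      by_contra h
      exact hz.2 ⟨hz.1, h⟩
    rw [det_smul_one_complex, this]
    simp
  have h1 : ∀ᵐ c, ∑' z, {z | z ∈ U ∧ φ z = c}.indicator g z =
      ∑' i, ∑' z, {z | z ∈ E i ∧ φ z = c}.indicator g z := by
    filter_upwards [compl_mem_ae_iff.2 hsard] with c hc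
    rw [ENNReal.tsum_comm]
    refine tsum_congr fun z => ?_
    by_cases hz : z ∈ U ∧ φ z = c
    · have hzV : z ∈ V := by
        by_contra h
        exact hc ⟨z, ⟨hz.1, h⟩, hz.2⟩
      rw [← hEV] at hzV
      obtain ⟨i, hi⟩ := mem_iUnion.1 hzV
      rw [tsum_eq_single i, indicator_of_mem (s := {z | z ∈ U ∧ φ z = c}) hz,
        indicator_of_mem (s := {z | z ∈ E i ∧ φ z = c}) ⟨hi, hz.2⟩]
      intro j hj
      exact indicator_of_notMem (fun h => Set.disjoint_left.1 (hEd hj) h.1 hi) _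
    · rw [indicator_of_notMem (s := {z | z ∈ U ∧ φ z = c}) hz, eq_comm]
      exact ENNReal.tsum_eq_zero.2 fun i => indicator_of_notMem (fun h => hz ⟨hEU i h.1, h.2⟩) _
  have h2 := fun i => measurable_and_lintegral_fiber (hEm i) (hEi i)
    (fun z hz => hderiv z (hEU i hz)) hg
  rw [lintegral_congr_ae h1, lintegral_tsum fun i => (h2 i).1.aemeasurable]
  simp_rw [fun i => (h2 i).2]
  rw [← lintegral_iUnion hEm hEd, hEV, ← lintegral_inter_add_sdiff (B := V) _ U hV.measurableSet,
    inter_eq_right.2 inter_subset_left]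
  have h3 : ∫⁻ z in U \ V, ENNReal.ofReal (‖deriv φ z‖ ^ 2) * g z = 0 := by
    rw [setLIntegral_congr_fun (g := fun _ => 0) (hU.measurableSet.diff hV.measurableSet),
      lintegral_zero]
    intro z hz
    have : deriv φ z = 0 := by
      by_contra h
      exact hz.2 ⟨hz.1, h⟩
    simp [this]
  rw [h3, add_zero]

/-! ### Almost sure convergence of the Gaussian power series -/

theorem integrable_norm_pow_stdComplexGaussian (n : ℕ) :
    Integrable (fun z : ℂ => ‖z‖ ^ n) stdComplexGaussian := by
  rw [stdComplexGaussian, integrable_withDensity_iff_integrable_smul'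
    measurable_complexGaussianDensity.ennreal_ofReal
    (Filter.Eventually.of_forall fun _ => ENNReal.ofReal_lt_top)]
  have h := GaussianFourier.integrable_cexp_neg_mul_sq_norm_add (V := ℂ)
    (b := ((1 / 2 : ℝ) : ℂ)) (by norm_num) 0 0
  refine (h.norm.const_mul (Real.pi⁻¹ * (n.factorial * Real.exp (1 / 2)))).mono'
    (measurable_complexGaussianDensity.ennreal_ofReal.ennreal_toReal.smul
      (by fun_prop)).aestronglyMeasurable (Filter.Eventually.of_forall fun z => ?_)
  rw [ENNReal.toReal_ofReal (complexGaussianDensity_nonneg z), smul_eq_mul, norm_mul,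
    Real.norm_of_nonneg (complexGaussianDensity_nonneg z), complexGaussianDensity,
    Real.norm_of_nonneg (by positivity), Complex.norm_exp]
  have h1 : ‖z‖ ^ n ≤ n.factorial * Real.exp ‖z‖ := by
    have := Real.pow_div_factorial_le_exp ‖z‖ (norm_nonneg z) n
    rwa [div_le_iff₀' (by positivity)] at this
  -- Completing the square: `|z| - |z|² ≤ 1/2 - |z|²/2` is `(|z| - 1)² ≥ 0`.
  have h2 : Real.exp ‖z‖ * Real.exp (-‖z‖ ^ 2) ≤
      Real.exp (1 / 2) * Real.exp (-(1 / 2) * ‖z‖ ^ 2) := by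
    rw [← Real.exp_add, ← Real.exp_add, Real.exp_le_exp]
    nlinarith [sq_nonneg (‖z‖ - 1)]
  have h3 : (-((1 / 2 : ℝ) : ℂ) * (‖z‖ : ℂ) ^ 2 + 0 * ((inner ℝ (0 : ℂ) z : ℝ) : ℂ)).re =
      -(1 / 2) * ‖z‖ ^ 2 := by
    rw [zero_mul, add_zero]
    norm_cast
  rw [h3]
  calc Real.pi⁻¹ * Real.exp (-‖z‖ ^ 2) * ‖z‖ ^ n
      ≤ Real.pi⁻¹ * Real.exp (-‖z‖ ^ 2) * (n.factorial * Real.exp ‖z‖) := by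
        gcongr
    _ = Real.pi⁻¹ * n.factorial * (Real.exp ‖z‖ * Real.exp (-‖z‖ ^ 2)) := by ring
    _ ≤ Real.pi⁻¹ * n.factorial * (Real.exp (1 / 2) * Real.exp (-(1 / 2) * ‖z‖ ^ 2)) := by
        gcongr
    _ = _ := by ring

theorem map_eval_gaussianSeq (k : ℕ) :
    gaussianSeq.map (fun x => x k) = stdComplexGaussian :=
  (measurePreserving_eval_infinitePi (fun _ : ℕ => stdComplexGaussian) k).map_eq

/-- For each `r = m / (m + 1)` the expectation of `∑ |x_k| r^k` is a convergent geometric series. -/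
theorem ae_isSubexponential : ∀ᵐ x ∂gaussianSeq, IsSubexponential x := by
  rw [show (∀ᵐ x ∂gaussianSeq, IsSubexponential x) ↔ ∀ᵐ x ∂gaussianSeq, ∀ m : ℕ,
    Summable fun k => x k * (((m : ℝ) / (m + 1) : ℝ) : ℂ) ^ k from Iff.rfl, ae_all_iff]
  intro m
  set r : ℝ := (m : ℝ) / (m + 1) with hr
  have hr0 : 0 ≤ r := by positivity
  have hr1 : r < 1 := by
    rw [hr, div_lt_one (by positivity)]
    linarith
  have hmeas : ∀ k, Measurable fun x : ℕ → ℂ => ‖x k * (r : ℂ) ^ k‖ₑ := fun k => by fun_prop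
  have hC : ∫⁻ z, ‖z‖ₑ ∂stdComplexGaussian ≠ ∞ := by
    have h := (integrable_norm_pow_stdComplexGaussian 1).hasFiniteIntegral
    simp only [pow_one] at h
    have h2 := h.ne
    simpa using h2
  have hint : ∫⁻ x, ∑' k, ‖x k * (r : ℂ) ^ k‖ₑ ∂gaussianSeq ≠ ∞ := by
    rw [lintegral_tsum fun k => (hmeas k).aemeasurable]
    have h : ∀ k, ∫⁻ x, ‖x k * (r : ℂ) ^ k‖ₑ ∂gaussianSeq =
        (∫⁻ z, ‖z‖ₑ ∂stdComplexGaussian) * ENNReal.ofReal r ^ k := by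
      intro k
      simp_rw [enorm_mul]
      rw [lintegral_mul_const _ (by fun_prop), ← map_eval_gaussianSeq k,
        lintegral_map (by fun_prop) (by fun_prop), enorm_pow]
      congr 2
      rw [← ofReal_norm, Complex.norm_real, Real.norm_of_nonneg hr0]
    simp_rw [h]
    rw [ENNReal.tsum_mul_left, ENNReal.tsum_geometric]
    refine ENNReal.mul_ne_top hC (ENNReal.inv_ne_top.2 ?_)
    rw [← ENNReal.ofReal_one, ← ENNReal.ofReal_sub _ hr0]
    exact (ENNReal.ofReal_pos.2 (by linarith)).ne'
  filter_upwards [ae_lt_top (Measurable.tsum hmeas) hint] with x hx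
  rw [← summable_norm_iff]
  have h : ∑' k, ((‖x k * (r : ℂ) ^ k‖₊ : NNReal) : ℝ≥0∞) ≠ ∞ := hx.ne
  rw [ENNReal.tsum_coe_ne_top_iff_summable, ← NNReal.summable_coe] at h
  exact h

theorem integral_cexp_of_hasSum {u : ℕ → ℂ} {Z : (ℕ → ℂ) → ℂ} {s : ℝ}
    (hZ : ∀ᵐ x ∂gaussianSeq, HasSum (fun m => u m * x m) (Z x))
    (hu : HasSum (fun m => ‖u m‖ ^ 2) s) :
    ∫ x, Complex.exp (Complex.I * ((Z x).re : ℂ)) ∂gaussianSeq = Complex.exp (-(s / 4 : ℝ)) := by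
  have h1 : Filter.Tendsto (fun M => ∫ x, Complex.exp (Complex.I *
      ((∑ m ∈ Finset.range M, u m * x m).re : ℂ)) ∂gaussianSeq) Filter.atTop
      (nhds (∫ x, Complex.exp (Complex.I * ((Z x).re : ℂ)) ∂gaussianSeq)) := by
    refine tendsto_integral_of_dominated_convergence (fun _ => 1)
      (fun M => (measurable_cexp_sum _ _).aestronglyMeasurable) (integrable_const 1) ?_ ?_
    · refine fun M => Filter.Eventually.of_forall fun x => ?_
      rw [mul_comm, Complex.norm_exp_ofReal_mul_I]
    · filter_upwards [hZ] with x hx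
      have hc : Continuous fun z : ℂ => Complex.exp (Complex.I * (z.re : ℂ)) := by fun_prop
      exact (hc.tendsto (Z x)).comp hx.tendsto_sum_nat
  have h2 : Filter.Tendsto (fun M => Complex.exp
      (-((∑ m ∈ Finset.range M, ‖u m‖ ^ 2) / 4 : ℝ))) Filter.atTop
      (nhds (Complex.exp (-(s / 4 : ℝ)))) := by
    have hc : Continuous fun y : ℝ => Complex.exp (-(y / 4 : ℝ)) := by fun_prop
    exact (hc.tendsto s).comp hu.tendsto_sum_nat
  simp_rw [integral_cexp_gaussianSeq_finset] at h1
  exact tendsto_nhds_unique h1 h2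

/-! ### Dividing out a zero -/

/-- The coefficients of `(z X(z) - a X(a)) / (z - a)`. -/
noncomputable def tailSum (a : ℂ) (x : ℕ → ℂ) (k : ℕ) : ℂ := ∑' m : ℕ, x (k + m) * a ^ m

/-- The coefficients of `(1 - ā z) (z X(z) - a X(a)) / (z - a)`. -/
noncomputable def blaschkeQuotient (a : ℂ) (x : ℕ → ℂ) : ℕ → ℂ
  | 0 => tailSum a x 0
  | k + 1 => tailSum a x (k + 1) - conj a * tailSum a x k

theorem tailSum_zero (a : ℂ) (x : ℕ → ℂ) : tailSum a x 0 = powerSum x a := by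
  simp [tailSum, powerSum]

theorem measurable_tailSum (k : ℕ) :
    Measurable fun p : ℂ × (ℕ → ℂ) => tailSum p.1 p.2 k :=
  Measurable.tsum fun m => by fun_prop

theorem measurable_blaschkeQuotient :
    Measurable fun p : ℂ × (ℕ → ℂ) => blaschkeQuotient p.1 p.2 := by
  refine measurable_pi_lambda _ fun k => ?_
  cases k with
  | zero => exact measurable_tailSum 0
  | succ k =>
    exact (measurable_tailSum (k + 1)).sub
      ((Complex.continuous_conj.measurable.comp measurable_fst).mul (measurable_tailSum k))

section
variable {x : ℕ → ℂ} {a : ℂ}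

theorem IsSubexponential.summable_tail_norm (hx : IsSubexponential x) (k : ℕ) {r : ℝ}
    (h0 : 0 < r) (hr : r < 1) : Summable fun m => ‖x (k + m)‖ * r ^ m := by
  have h := (summable_nat_add_iff k).2 (hx.summable_norm h0.le hr)
  refine (h.mul_left (r ^ k)⁻¹).congr fun m => ?_
  rw [add_comm m k, pow_add]
  field_simp

theorem IsSubexponential.hasSum_tailSum (hx : IsSubexponential x) (ha : ‖a‖ < 1) (k : ℕ) :
    HasSum (fun m => x (k + m) * a ^ m) (tailSum a x k) := by
  refine Summable.hasSum ?_
  obtain ⟨r, hr, hr1⟩ := exists_between ha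
  have hr0 := (norm_nonneg a).trans_lt hr
  rw [← summable_norm_iff]
  refine Summable.of_nonneg_of_le (fun m => norm_nonneg _) (fun m => ?_)
    (hx.summable_tail_norm k hr0 hr1)
  rw [norm_mul, norm_pow]
  gcongr

theorem IsSubexponential.tailSum_eq (hx : IsSubexponential x) (ha : ‖a‖ < 1) (k : ℕ) :
    tailSum a x k = x k + a * tailSum a x (k + 1) := by
  refine (hx.hasSum_tailSum ha k).unique ?_
  rw [hasSum_nat_add_iff' 1 |>.symm]
  simp only [Finset.range_one, Finset.sum_singleton, add_zero, pow_zero, mul_one,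
    add_sub_cancel_left]
  have e : (fun m => x (k + (m + 1)) * a ^ (m + 1)) = fun m => a * (x (k + 1 + m) * a ^ m) := by
    funext m
    rw [show k + 1 + m = k + (m + 1) by ring]
    ring
  rw [e]
  exact (hx.hasSum_tailSum ha (k + 1)).mul_left a

theorem IsSubexponential.tailSum (hx : IsSubexponential x) (ha : ‖a‖ < 1) :
    IsSubexponential (tailSum a x) := by
  refine isSubexponential_of_summable_norm fun r h0 hr => ?_
  -- With `s` above `|a|`, the `k`-th tail is at most `M s⁻ᵏ`; with `s` above `r`, this is summable
  -- against `rᵏ`.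
  obtain ⟨s, hs, hs1⟩ := exists_between (max_lt hr ha)
  have hrs : r < s := (le_max_left _ _).trans_lt hs
  have has : ‖a‖ < s := (le_max_right _ _).trans_lt hs
  have hs0 : 0 < s := h0.trans_lt hrs
  set M := ∑' k, ‖x k‖ * s ^ k
  have hbound : ∀ k, ‖_root_.tailSum a x k‖ ≤ (s ^ k)⁻¹ * M := by
    intro k
    have h1 := hx.summable_tail_norm k hs0 hs1
    refine (tsum_of_norm_bounded h1.hasSum fun m => ?_).trans ?_
    · rw [norm_mul, norm_pow]
      gcongr
    · have h2 : ∀ m, ‖x (k + m)‖ * s ^ m = (s ^ k)⁻¹ * (‖x (m + k)‖ * s ^ (m + k)) := by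
        intro m
        rw [add_comm m k, pow_add]
        field_simp
      simp_rw [h2]
      rw [tsum_mul_left]
      gcongr
      have h3 := hx.summable_norm hs0.le hs1
      rw [show M = ∑' k, ‖x k‖ * s ^ k from rfl, ← h3.sum_add_tsum_nat_add k]
      exact le_add_of_nonneg_left (Finset.sum_nonneg fun i _ => by positivity)
  refine Summable.of_nonneg_of_le (fun k => by positivity) (fun k => ?_)
    ((summable_geometric_of_lt_one (r := r / s) (by positivity)
      ((div_lt_one hs0).2 hrs)).mul_left M)
  calc ‖_root_.tailSum a x k‖ * r ^ k ≤ (s ^ k)⁻¹ * M * r ^ k := by gcongr; exact hbound k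
    _ = M * (r / s) ^ k := by rw [div_pow]; ring

theorem IsSubexponential.hasSum_powerSum (hx : IsSubexponential x) {z : ℂ} (hz : ‖z‖ < 1) :
    HasSum (fun k => x k * z ^ k) (powerSum x z) := (hx.summable hz).hasSum

/-- Generating-function form of the recursion `tailSum a x k = x k + a * tailSum a x (k + 1)`. -/
theorem IsSubexponential.powerSum_tailSum (hx : IsSubexponential x) (ha : ‖a‖ < 1) {z : ℂ}
    (hz : ‖z‖ < 1) :
    (z - a) * powerSum (_root_.tailSum a x) z = z * powerSum x z - a * powerSum x a := by
  have hD := (hx.tailSum ha).hasSum_powerSum hz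
  have h1 := hx.hasSum_powerSum hz
  have h2 := (hasSum_nat_add_iff' 1).2 hD
  simp only [Finset.range_one, Finset.sum_singleton, pow_zero, mul_one, tailSum_zero] at h2
  have h3 : HasSum (fun k => x k * z ^ k * z)
      (powerSum (_root_.tailSum a x) z * z -
        a * (powerSum (_root_.tailSum a x) z - powerSum x a)) := by
    have e : (fun k => x k * z ^ k * z) = fun k => _root_.tailSum a x k * z ^ k * z -
        a * (_root_.tailSum a x (k + 1) * z ^ (k + 1)) := by
      funext k
      rw [hx.tailSum_eq ha k]
      ring
    rw [e]
    exact (hD.mul_right z).sub (h2.mul_left a)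
  have h4 := h3.unique (h1.mul_right z)
  linear_combination h4

theorem IsSubexponential.hasSum_blaschkeQuotient (hx : IsSubexponential x) (ha : ‖a‖ < 1) {z : ℂ}
    (hz : ‖z‖ < 1) : HasSum (fun k => blaschkeQuotient a x k * z ^ k)
      ((1 - conj a * z) * powerSum (_root_.tailSum a x) z) := by
  have hD := (hx.tailSum ha).hasSum_powerSum hz
  have h2 := (hasSum_nat_add_iff' 1).2 hD
  rw [← hasSum_nat_add_iff' 1]
  have e : (fun k => _root_.blaschkeQuotient a x (k + 1) * z ^ (k + 1)) = fun k =>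
      _root_.tailSum a x (k + 1) * z ^ (k + 1) - conj a * z * (_root_.tailSum a x k * z ^ k) := by
    funext k
    simp only [_root_.blaschkeQuotient]
    ring
  have h3 := h2.sub (hD.mul_left (conj a * z))
  rw [e]
  convert h3 using 1
  simp only [Finset.range_one, Finset.sum_singleton, _root_.blaschkeQuotient]
  ring

theorem IsSubexponential.blaschkeQuotient (hx : IsSubexponential x) (ha : ‖a‖ < 1) :
    IsSubexponential (blaschkeQuotient a x) := by
  intro m
  refine (hx.hasSum_blaschkeQuotient ha ?_).summable
  rw [Complex.norm_real, Real.norm_of_nonneg (by positivity), div_lt_one (by positivity)]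
  linarith

theorem IsSubexponential.powerSum_blaschkeQuotient (hx : IsSubexponential x) (ha : ‖a‖ < 1)
    {z : ℂ} (hz : ‖z‖ < 1) : (z - a) * powerSum (_root_.blaschkeQuotient a x) z =
      (1 - conj a * z) * (z * powerSum x z - a * powerSum x a) := by
  rw [← hx.powerSum_tailSum ha hz, powerSum, (hx.hasSum_blaschkeQuotient ha hz).tsum_eq]
  ring

end

/-! ### The law of the quotient sequence -/

/-- The coefficient of `x m` in `tailSum a x k`. -/
def tailCoeff (a : ℂ) (k m : ℕ) : ℂ := if k ≤ m then a ^ (m - k) else 0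

/-- The coefficient of `x m` in the `k`-th entry of the normalized quotient sequence. -/
noncomputable def quotientCoeff (a : ℂ) : ℕ → ℕ → ℂ
  | 0, m => (Real.sqrt (1 - ‖a‖ ^ 2) : ℂ) * tailCoeff a 0 m
  | k + 1, m => tailCoeff a (k + 1) m - conj a * tailCoeff a k m

/-- The quotient sequence, with its first entry normalized to unit variance. -/
noncomputable def normalizedQuotient (a : ℂ) (x : ℕ → ℂ) : ℕ → ℂ
  | 0 => (Real.sqrt (1 - ‖a‖ ^ 2) : ℂ) * tailSum a x 0
  | k + 1 => tailSum a x (k + 1) - conj a * tailSum a x k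

theorem measurable_normalizedQuotient (a : ℂ) : Measurable (normalizedQuotient a) := by
  have h : ∀ k, Measurable fun x => tailSum a x k := fun k =>
    (measurable_tailSum k).comp (measurable_const.prodMk measurable_id)
  refine measurable_pi_lambda _ fun k => ?_
  cases k with
  | zero => exact (h 0).const_mul _
  | succ k => exact (h (k + 1)).sub ((h k).const_mul _)

section
variable {a : ℂ}

theorem HasSum.of_eq {f g : ℕ → ℂ} {s t : ℂ} (h : HasSum f s) (hfg : ∀ m, g m = f m)
    (hst : t = s) : HasSum g t := by
  rw [hst, show g = f from funext hfg]
  exact h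

theorem hasSum_tailCoeff_mul_conj (ha : ‖a‖ < 1) {k l : ℕ} (hlk : l ≤ k) :
    HasSum (fun m => tailCoeff a k m * conj (tailCoeff a l m))
      (conj a ^ (k - l) * (1 - a * conj a)⁻¹) := by
  rw [← hasSum_nat_add_iff' k]
  have h0 : ∑ m ∈ Finset.range k, tailCoeff a k m * conj (tailCoeff a l m) = 0 := by
    refine Finset.sum_eq_zero fun m hm => ?_
    rw [tailCoeff, if_neg (not_le.2 (Finset.mem_range.1 hm)), zero_mul]
  rw [h0, sub_zero]
  have h1 : (fun m => tailCoeff a k (m + k) * conj (tailCoeff a l (m + k))) =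
      fun m => conj a ^ (k - l) * (a * conj a) ^ m := by
    funext m
    rw [tailCoeff, if_pos (Nat.le_add_left k m), tailCoeff, if_pos (by omega), map_pow,
      Nat.add_sub_cancel, Nat.add_sub_assoc hlk, pow_add, mul_pow]
    ring
  rw [h1]
  have hq : ‖a * conj a‖ < 1 := by
    rw [norm_mul, Complex.norm_conj]
    nlinarith [norm_nonneg a]
  exact (hasSum_geometric_of_norm_lt_one hq).mul_left (conj a ^ (k - l))

theorem hasSum_conj_of_hasSum {f g : ℕ → ℂ} {s : ℂ}
    (h : HasSum (fun m => f m * conj (g m)) s) :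
    HasSum (fun m => g m * conj (f m)) (conj s) := by
  have h2 := Complex.hasSum_conj'.2 h
  have e : (fun m => g m * conj (f m)) = fun m => conj (f m * conj (g m)) := by
    funext m
    rw [map_mul, Complex.conj_conj, mul_comm]
  rw [e]
  exact h2

theorem one_sub_mul_conj_ne_zero (ha : ‖a‖ < 1) : 1 - a * conj a ≠ 0 := by
  rw [Complex.mul_conj, Complex.normSq_eq_norm_sq]
  have : 1 - ‖a‖ ^ 2 ≠ 0 := by nlinarith [norm_nonneg a]
  exact_mod_cast this

theorem ofReal_sqrt_mul_self (ha : ‖a‖ < 1) :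
    (Real.sqrt (1 - ‖a‖ ^ 2) : ℂ) * (Real.sqrt (1 - ‖a‖ ^ 2) : ℂ) = 1 - a * conj a := by
  rw [← Complex.ofReal_mul, Real.mul_self_sqrt (by nlinarith [norm_nonneg a]), Complex.mul_conj,
    Complex.normSq_eq_norm_sq]
  push_cast
  ring

/-- The tail rows have Gram matrix `āᵏ⁻ˡ / (1 - |a|²)` for `l ≤ k`. Subtracting `ā` times the
preceding row is Gram–Schmidt for this geometric matrix and leaves unit norms, except in row 0,
which is rescaled by hand. -/
theorem hasSum_quotientCoeff_of_le (ha : ‖a‖ < 1) {k l : ℕ} (hlk : l ≤ k) :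
    HasSum (fun m => quotientCoeff a k m * conj (quotientCoeff a l m))
      (if k = l then 1 else 0) := by
  have hne := one_sub_mul_conj_ne_zero ha
  match k, l with
  | 0, 0 =>
    have h := (hasSum_tailCoeff_mul_conj ha (le_refl 0)).mul_left (1 - a * conj a)
    rw [if_pos rfl]
    simp only [Nat.sub_self, pow_zero, one_mul, mul_inv_cancel₀ hne] at h
    refine h.of_eq (fun m => ?_) rfl
    simp only [quotientCoeff, map_mul, Complex.conj_ofReal]
    rw [← ofReal_sqrt_mul_self ha]
    ring
  | k + 1, 0 =>
    have h1 := hasSum_tailCoeff_mul_conj ha (Nat.zero_le (k + 1))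
    have h2 := (hasSum_tailCoeff_mul_conj ha (Nat.zero_le k)).mul_left (conj a)
    have h := (h1.sub h2).mul_left (Real.sqrt (1 - ‖a‖ ^ 2) : ℂ)
    rw [if_neg (Nat.succ_ne_zero k)]
    refine h.of_eq (fun m => ?_) ?_
    · simp only [quotientCoeff, map_mul, Complex.conj_ofReal]
      ring
    · simp only [Nat.sub_zero]
      ring
  | k + 1, l + 1 =>
    have hlk' : l ≤ k := Nat.le_of_succ_le_succ hlk
    have h1 := hasSum_tailCoeff_mul_conj ha hlk
    have h2 := (hasSum_tailCoeff_mul_conj ha (hlk'.trans (Nat.le_succ k))).mul_left a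
    have h4 := (hasSum_tailCoeff_mul_conj ha hlk').mul_left (a * conj a)
    rcases hlk'.eq_or_lt with rfl | hlt
    -- On the diagonal one cross term pairs row `l` with row `l + 1`, in the order reversed from
    -- `hasSum_tailCoeff_mul_conj`, hence the conjugation.
    · have h3 := (hasSum_conj_of_hasSum
        (hasSum_tailCoeff_mul_conj ha (Nat.le_succ l))).mul_left (conj a)
      have h := ((h1.sub h2).sub h3).add h4
      rw [if_pos rfl]
      refine h.of_eq (fun m => ?_) ?_
      · simp only [quotientCoeff, map_sub, map_mul, Complex.conj_conj]
        ring
      · have : conj (1 - a * conj a)⁻¹ = (1 - a * conj a)⁻¹ := by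
          simp [mul_comm]
        simp only [Nat.sub_self, Nat.succ_eq_add_one, Nat.add_sub_cancel_left, pow_zero, pow_one, map_mul,
          Complex.conj_conj, this]
        rw [eq_comm, show ∀ c : ℂ, 1 * c - a * (conj a * c) - conj a * (a * c) +
          a * conj a * (1 * c) = (1 - a * conj a) * c by intro c; ring, mul_inv_cancel₀ hne]
    · have h3 := (hasSum_tailCoeff_mul_conj ha hlt).mul_left (conj a)
      have h := ((h1.sub h2).sub h3).add h4
      rw [if_neg (by omega)]
      refine h.of_eq (fun m => ?_) ?_
      · simp only [quotientCoeff, map_sub, map_mul, Complex.conj_conj]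
        ring
      · obtain ⟨j, rfl⟩ := Nat.exists_eq_add_of_lt hlt
        rw [show l + j + 1 + 1 - (l + 1) = j + 1 by omega,
          show (l + j + 1).succ - l = j + 2 by omega, show l + j + 1 - l.succ = j by omega,
          show l + j + 1 - l = j + 1 by omega]
        ring

theorem hasSum_quotientCoeff (ha : ‖a‖ < 1) (k l : ℕ) :
    HasSum (fun m => quotientCoeff a k m * conj (quotientCoeff a l m))
      (if k = l then 1 else 0) := by
  rcases le_total l k with h | h
  · exact hasSum_quotientCoeff_of_le ha h
  · have h2 := hasSum_conj_of_hasSum (hasSum_quotientCoeff_of_le ha h)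
    refine h2.of_eq (fun _ => rfl) ?_
    by_cases hkl : k = l
    · rw [if_pos hkl, if_pos hkl.symm, map_one]
    · rw [if_neg hkl, if_neg (Ne.symm hkl), map_zero]

theorem hasSum_norm_sum_quotientCoeff (ha : ‖a‖ < 1) (K : ℕ) (t : ℕ → ℂ) :
    HasSum (fun m => ‖∑ k ∈ Finset.range K, t k * quotientCoeff a k m‖ ^ 2)
      (∑ k ∈ Finset.range K, ‖t k‖ ^ 2) := by
  rw [← Complex.hasSum_ofReal]
  have h : HasSum (fun m => ∑ k ∈ Finset.range K, ∑ l ∈ Finset.range K,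
      t k * conj (t l) * (quotientCoeff a k m * conj (quotientCoeff a l m)))
      (∑ k ∈ Finset.range K, ∑ l ∈ Finset.range K,
        t k * conj (t l) * (if k = l then 1 else 0)) :=
    hasSum_sum fun k _ => hasSum_sum fun l _ => (hasSum_quotientCoeff ha k l).mul_left _
  refine h.of_eq (fun m => ?_) ?_
  · rw [← Complex.normSq_eq_norm_sq, ← Complex.mul_conj, map_sum, Finset.sum_mul_sum]
    refine Finset.sum_congr rfl fun k _ => Finset.sum_congr rfl fun l _ => ?_
    rw [map_mul]
    ring
  · rw [Complex.ofReal_sum]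
    refine Finset.sum_congr rfl fun k hk => ?_
    simp only [mul_ite, mul_one, mul_zero]
    rw [Finset.sum_ite_eq, if_pos hk, Complex.mul_conj, Complex.normSq_eq_norm_sq]

theorem IsSubexponential.hasSum_tailCoeff {x : ℕ → ℂ} (hx : IsSubexponential x) (ha : ‖a‖ < 1)
    (k : ℕ) : HasSum (fun m => tailCoeff a k m * x m) (_root_.tailSum a x k) := by
  rw [← hasSum_nat_add_iff' k]
  have h0 : ∑ m ∈ Finset.range k, tailCoeff a k m * x m = 0 := by
    refine Finset.sum_eq_zero fun m hm => ?_
    rw [tailCoeff, if_neg (not_le.2 (Finset.mem_range.1 hm)), zero_mul]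
  rw [h0, sub_zero]
  have h1 : (fun m => tailCoeff a k (m + k) * x (m + k)) = fun m => x (k + m) * a ^ m := by
    funext m
    rw [tailCoeff, if_pos (Nat.le_add_left k m), Nat.add_sub_cancel, add_comm m k, mul_comm]
  rw [h1]
  exact hx.hasSum_tailSum ha k

theorem IsSubexponential.hasSum_normalizedQuotient {x : ℕ → ℂ} (hx : IsSubexponential x)
    (ha : ‖a‖ < 1) (k : ℕ) :
    HasSum (fun m => quotientCoeff a k m * x m) (normalizedQuotient a x k) := by
  cases k with
  | zero =>
    have e : (fun m => quotientCoeff a 0 m * x m) = fun m =>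
        (Real.sqrt (1 - ‖a‖ ^ 2) : ℂ) * (tailCoeff a 0 m * x m) := by
      funext m
      simp only [quotientCoeff]
      ring
    rw [e]
    exact (hx.hasSum_tailCoeff ha 0).mul_left _
  | succ k =>
    have e : (fun m => quotientCoeff a (k + 1) m * x m) = fun m =>
        tailCoeff a (k + 1) m * x m - conj a * (tailCoeff a k m * x m) := by
      funext m
      simp only [quotientCoeff]
      ring
    rw [e]
    exact (hx.hasSum_tailCoeff ha (k + 1)).sub ((hx.hasSum_tailCoeff ha k).mul_left _)

/-- The map has orthonormal rows, so every finite linear combination of its entries keeps variance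
`∑ |t_k|²`; the characteristic functions therefore agree. -/
theorem map_normalizedQuotient (ha : ‖a‖ < 1) :
    gaussianSeq.map (normalizedQuotient a) = gaussianSeq := by
  have hm := measurable_normalizedQuotient a
  have : IsProbabilityMeasure (gaussianSeq.map (normalizedQuotient a)) :=
    Measure.isProbabilityMeasure_map hm.aemeasurable
  refine eq_gaussianSeq_of_integral_cexp fun K t => ?_
  rw [integral_map hm.aemeasurable (measurable_cexp_sum _ _).aestronglyMeasurable]
  refine integral_cexp_of_hasSum (u := fun m => ∑ k ∈ Finset.range K, t k * quotientCoeff a k m)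
    (Z := fun x => ∑ k ∈ Finset.range K, t k * normalizedQuotient a x k) ?_
    (hasSum_norm_sum_quotientCoeff ha K t)
  filter_upwards [ae_isSubexponential] with x hx
  have e : (fun m => (∑ k ∈ Finset.range K, t k * quotientCoeff a k m) * x m) = fun m =>
      ∑ k ∈ Finset.range K, t k * (quotientCoeff a k m * x m) := by
    funext m
    rw [Finset.sum_mul]
    exact Finset.sum_congr rfl fun k _ => by ring
  rw [e]
  exact hasSum_sum fun k _ => (hx.hasSum_normalizedQuotient ha k).mul_left _

end

theorem lintegral_comp_inv_mul {s : ℝ} (hs : 0 < s) {f : ℂ → ℝ≥0∞} (hf : Measurable f) :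
    ∫⁻ c : ℂ, f ((s : ℂ)⁻¹ * c) = ENNReal.ofReal (s ^ 2) * ∫⁻ c, f c := by
  have h := Measure.map_addHaar_smul (volume : Measure ℂ) (inv_ne_zero hs.ne')
  have h2 : ∫⁻ c : ℂ, f ((s : ℂ)⁻¹ * c) = ∫⁻ c, f c ∂(volume.map fun c : ℂ => s⁻¹ • c) := by
    rw [lintegral_map hf (by fun_prop)]
    refine lintegral_congr fun c => ?_
    rw [Complex.real_smul, Complex.ofReal_inv]
  rw [h2, h, lintegral_smul_measure, smul_eq_mul, Complex.finrank_real_complex, inv_pow, inv_inv,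
    abs_of_pos (by positivity)]

theorem complexGaussianDensity_scale {a : ℂ} (ha : ‖a‖ < 1) (c : ℂ) :
    complexGaussianDensity ((Real.sqrt (1 - ‖a‖ ^ 2) : ℂ) * c) * Real.exp (-‖a * c‖ ^ 2) =
      complexGaussianDensity c := by
  have h : 0 ≤ 1 - ‖a‖ ^ 2 := by nlinarith [norm_nonneg a]
  rw [complexGaussianDensity, complexGaussianDensity, mul_assoc, ← Real.exp_add, norm_mul, norm_mul,
    Complex.norm_real, Real.norm_of_nonneg (Real.sqrt_nonneg _), mul_pow, mul_pow, Real.sq_sqrt h]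
  ring_nf

theorem blaschkeQuotient_eq_seqCons {a : ℂ} (ha : ‖a‖ < 1) (x : ℕ → ℂ) :
    blaschkeQuotient a x = seqCons ((Real.sqrt (1 - ‖a‖ ^ 2) : ℂ)⁻¹ * normalizedQuotient a x 0)
      (fun k => normalizedQuotient a x (k + 1)) := by
  have h : (Real.sqrt (1 - ‖a‖ ^ 2) : ℂ) ≠ 0 := by
    have : Real.sqrt (1 - ‖a‖ ^ 2) ≠ 0 :=
      (Real.sqrt_pos.2 (by nlinarith [norm_nonneg a])).ne'
    exact_mod_cast this
  funext k
  cases k with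
  | zero => simp only [blaschkeQuotient, seqCons, normalizedQuotient, inv_mul_cancel_left₀ h]
  | succ k => rfl

/-- Under the Gaussian density tilted by the value at `a`, the quotient sequence is again an i.i.d.
sequence of standard complex Gaussians. -/
theorem lintegral_blaschkeQuotient {a : ℂ} (ha : ‖a‖ < 1) {G : (ℕ → ℂ) → ℝ≥0∞}
    (hG : Measurable G) :
    ∫⁻ x, ENNReal.ofReal (Real.exp (-‖a * powerSum x a‖ ^ 2)) * G (blaschkeQuotient a x)
      ∂gaussianSeq = ENNReal.ofReal (1 - ‖a‖ ^ 2) * ∫⁻ x, G x ∂gaussianSeq := by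
  set s : ℝ := Real.sqrt (1 - ‖a‖ ^ 2) with hs
  have hs0 : 0 < s := Real.sqrt_pos.2 (by nlinarith [norm_nonneg a])
  have hs2 : s ^ 2 = 1 - ‖a‖ ^ 2 := Real.sq_sqrt (by nlinarith [norm_nonneg a])
  have hsC : (s : ℂ) ≠ 0 := by exact_mod_cast hs0.ne'
  let H : (ℕ → ℂ) → ℝ≥0∞ := fun y =>
    ENNReal.ofReal (Real.exp (-‖a * ((s : ℂ)⁻¹ * y 0)‖ ^ 2)) *
      G (seqCons ((s : ℂ)⁻¹ * y 0) fun k => y (k + 1))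
  have hcons : Measurable fun y : ℕ → ℂ => seqCons ((s : ℂ)⁻¹ * y 0) fun k => y (k + 1) :=
    measurable_seqCons.comp (Measurable.prodMk (by fun_prop) (by fun_prop))
  have hH : Measurable H := Measurable.mul (by fun_prop) (hG.comp hcons)
  have h1 : ∀ x, ENNReal.ofReal (Real.exp (-‖a * powerSum x a‖ ^ 2)) * G (blaschkeQuotient a x) =
      H (normalizedQuotient a x) := by
    intro x
    simp only [H]
    rw [blaschkeQuotient_eq_seqCons ha, ← hs]
    congr 5
    rw [normalizedQuotient, ← hs, inv_mul_cancel_left₀ hsC, tailSum_zero]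
  simp_rw [h1]
  -- Only coordinate 0 feels the tilt and the normalization. Substituting `c ↦ s⁻¹ c` there costs
  -- the planar Jacobian `s² = 1 - |a|²`, and `complexGaussianDensity_scale` combines tilt and
  -- density into the standard density.
  rw [← lintegral_map hH (measurable_normalizedQuotient a), map_normalizedQuotient ha,
    lintegral_gaussianSeq hH, lintegral_gaussianSeq hG, ← lintegral_const_mul']
  · refine lintegral_congr fun x => ?_
    have hG' : Measurable fun c : ℂ =>
        ENNReal.ofReal (complexGaussianDensity c) * G (seqCons c x) :=
      measurable_complexGaussianDensity.ennreal_ofReal.mul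
        (hG.comp (measurable_seqCons.comp (measurable_id.prodMk measurable_const)))
    rw [← hs2, ← lintegral_comp_inv_mul hs0 hG']
    refine lintegral_congr fun c => ?_
    have h2 := complexGaussianDensity_scale ha ((s : ℂ)⁻¹ * c)
    rw [← hs, mul_inv_cancel_left₀ hsC] at h2
    simp only [H, seqCons_zero, seqCons_succ]
    rw [← h2, ENNReal.ofReal_mul (complexGaussianDensity_nonneg c), mul_assoc]
  · exact ENNReal.ofReal_ne_top

/-! ### The one-point formula -/

section
variable {x : ℕ → ℂ} {a : ℂ}

theorem IsSubexponential.hasSum_seqCons (hx : IsSubexponential x) (c : ℂ) {z : ℂ} (hz : ‖z‖ < 1) :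
    HasSum (fun k => seqCons c x k * z ^ k) (c + z * powerSum x z) := by
  rw [← hasSum_nat_add_iff' 1]
  refine ((hx.hasSum_powerSum hz).mul_left z).of_eq (fun k => ?_) ?_
  · rw [seqCons_succ]
    ring
  · simp

theorem IsSubexponential.powerSum_seqCons (hx : IsSubexponential x) (c : ℂ) {z : ℂ}
    (hz : ‖z‖ < 1) : powerSum (seqCons c x) z = c + z * powerSum x z :=
  (hx.hasSum_seqCons c hz).tsum_eq

theorem IsSubexponential.seqCons (hx : IsSubexponential x) (c : ℂ) :
    IsSubexponential (seqCons c x) := by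
  intro m
  refine (hx.hasSum_seqCons c ?_).summable
  rw [Complex.norm_real, Real.norm_of_nonneg (by positivity), div_lt_one (by positivity)]
  linarith

/-- The value at `0` is `c`, so `c ≠ 0` excludes the identically vanishing series. -/
theorem regularZeros_seqCons (hx : IsSubexponential x) {c : ℂ} (hc : c ≠ 0) :
    regularZeros (seqCons c x) = {z | z ∈ openUnitDisk ∧ -(z * powerSum x z) = c} := by
  ext z
  have h0 : (0 : ℂ) ∈ openUnitDisk := by simp [openUnitDisk]
  have h1 : IsSubexponential (seqCons c x) ∧ ∃ w ∈ openUnitDisk, powerSum (seqCons c x) w ≠ 0 :=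
    ⟨hx.seqCons c, 0, h0, by rwa [hx.powerSum_seqCons c h0, zero_mul, add_zero]⟩
  constructor
  · rintro ⟨-, hz, h⟩
    rw [hx.powerSum_seqCons c hz] at h
    exact ⟨hz, by linear_combination -h⟩
  · rintro ⟨hz, h⟩
    refine ⟨h1, hz, ?_⟩
    rw [hx.powerSum_seqCons c hz]
    linear_combination -h

theorem one_sub_conj_mul_ne_zero {z : ℂ} (ha : ‖a‖ < 1) (hz : ‖z‖ < 1) : 1 - conj a * z ≠ 0 := by
  intro h
  have h1 : ‖conj a * z‖ = 1 := by rw [← sub_eq_zero.1 h, norm_one]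
  rw [norm_mul, Complex.norm_conj] at h1
  nlinarith [norm_nonneg a, norm_nonneg z]

theorem IsSubexponential.differentiableAt (hx : IsSubexponential x) (ha : ‖a‖ < 1) :
    DifferentiableAt ℂ (powerSum x) a :=
  hx.differentiableOn.differentiableAt (Metric.isOpen_ball.mem_nhds (mem_ball_zero_iff.2 ha))

/-- Near `a` the function is a constant minus `(z - a) V(z) / (1 - ā z)`, so its derivative at `a`
is read off from the factor of `z - a`. -/
theorem IsSubexponential.deriv_neg_mul_powerSum (hx : IsSubexponential x) (ha : ‖a‖ < 1) :
    deriv (fun z => -(z * powerSum x z)) a =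
      -(powerSum (_root_.blaschkeQuotient a x) a / (1 - conj a * a)) := by
  have hV := (hx.blaschkeQuotient ha).differentiableAt ha
  have hne := one_sub_conj_mul_ne_zero ha ha
  have hd : DifferentiableAt ℂ
      (fun z => powerSum (_root_.blaschkeQuotient a x) z / (1 - conj a * z)) a :=
    hV.div (by fun_prop) hne
  have h1 := ((hasDerivAt_id a).sub_const a).mul hd.hasDerivAt
  have h2 := (h1.neg).add_const (-(a * powerSum x a))
  have h3 : (fun z => -(z * powerSum x z)) =ᶠ[nhds a] fun z =>
      -((z - a) * (powerSum (_root_.blaschkeQuotient a x) z / (1 - conj a * z))) +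
        -(a * powerSum x a) := by
    have : ∀ᶠ z in nhds a, ‖z‖ < 1 := continuous_norm.continuousAt.eventually (gt_mem_nhds ha)
    filter_upwards [this] with z hz
    have hz' := one_sub_conj_mul_ne_zero ha hz
    rw [← mul_div_assoc, hx.powerSum_blaschkeQuotient ha hz, mul_div_cancel_left₀ _ hz']
    ring
  rw [h3.deriv_eq]
  refine HasDerivAt.deriv (h2.congr_deriv ?_)
  simp

end

theorem lintegral_tsum_regularZeros_eq {F : ℂ × (ℕ → ℂ) → ℝ≥0∞} (hF : Measurable F) :
    ∫⁻ x, ∑' z, (regularZeros x).indicator (fun z => F (z, x)) z ∂gaussianSeq =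
      ∫⁻ a in openUnitDisk, ∫⁻ x,
        ENNReal.ofReal (‖powerSum (blaschkeQuotient a x) a / (1 - conj a * a)‖ ^ 2) *
          (ENNReal.ofReal (complexGaussianDensity (-(a * powerSum x a))) *
            F (a, seqCons (-(a * powerSum x a)) x)) ∂gaussianSeq := by
  have hmS : Measurable fun p : ℂ × (ℕ → ℂ) => powerSum p.2 p.1 :=
    measurable_powerSum.comp measurable_swap
  have hmφ : Measurable fun p : ℂ × (ℕ → ℂ) => -(p.1 * powerSum p.2 p.1) :=
    (measurable_fst.mul hmS).neg
  have hmg : Measurable fun p : ℂ × (ℕ → ℂ) =>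
      ENNReal.ofReal (complexGaussianDensity (-(p.1 * powerSum p.2 p.1))) *
        F (p.1, seqCons (-(p.1 * powerSum p.2 p.1)) p.2) :=
    (measurable_complexGaussianDensity.comp hmφ).ennreal_ofReal.mul
      (hF.comp (measurable_fst.prodMk (measurable_seqCons.comp (hmφ.prodMk measurable_snd))))
  have hmV : Measurable fun p : ℂ × (ℕ → ℂ) =>
      ENNReal.ofReal (‖powerSum (blaschkeQuotient p.1 p.2) p.1 / (1 - conj p.1 * p.1)‖ ^ 2) := by
    refine Measurable.ennreal_ofReal (Measurable.pow_const (Measurable.norm (Measurable.div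
      (measurable_powerSum.comp (measurable_blaschkeQuotient.prodMk measurable_fst)) ?_)) 2)
    exact measurable_const.sub
      ((Complex.continuous_conj.measurable.comp measurable_fst).mul measurable_fst)
  have hsum : Measurable fun x : ℕ → ℂ =>
      ∑' z, (regularZeros x).indicator (fun z => F (z, x)) z :=
    measurable_tsum_regularZeros measurable_id (hF.comp measurable_swap)
  rw [lintegral_gaussianSeq hsum]
  have h1 : ∀ᵐ x ∂gaussianSeq, (∫⁻ c : ℂ, ENNReal.ofReal (complexGaussianDensity c) *
      ∑' z, (regularZeros (seqCons c x)).indicator (fun z => F (z, seqCons c x)) z) =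
      ∫⁻ a in openUnitDisk,
        ENNReal.ofReal (‖powerSum (blaschkeQuotient a x) a / (1 - conj a * a)‖ ^ 2) *
          (ENNReal.ofReal (complexGaussianDensity (-(a * powerSum x a))) *
            F (a, seqCons (-(a * powerSum x a)) x)) := by
    filter_upwards [ae_isSubexponential] with x hx
    have hd : DifferentiableOn ℂ (fun z => -(z * powerSum x z)) openUnitDisk := by
      rw [openUnitDisk_eq_ball]
      exact (differentiableOn_id.mul hx.differentiableOn).neg
    have hm := hmg.comp (measurable_id.prodMk (measurable_const (a := x)))
    have harea := lintegral_tsum_fiber isOpen_openUnitDisk hd hm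
    refine Eq.trans ?_ (harea.trans ?_)
    · refine lintegral_congr_ae ?_
      filter_upwards [compl_mem_ae_iff.2 (measure_singleton (0 : ℂ))] with c hc
      rw [regularZeros_seqCons hx hc, ← ENNReal.tsum_mul_left]
      refine tsum_congr fun z => ?_
      by_cases hz : z ∈ openUnitDisk ∧ -(z * powerSum x z) = c
      · rw [indicator_of_mem (s := {z | z ∈ openUnitDisk ∧ -(z * powerSum x z) = c}) hz,
          indicator_of_mem (s := {z | z ∈ openUnitDisk ∧ -(z * powerSum x z) = c}) hz, ← hz.2]
        rfl
      · rw [indicator_of_notMem (s := {z | z ∈ openUnitDisk ∧ -(z * powerSum x z) = c}) hz,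
          indicator_of_notMem (s := {z | z ∈ openUnitDisk ∧ -(z * powerSum x z) = c}) hz, mul_zero]
    · refine setLIntegral_congr_fun isOpen_openUnitDisk.measurableSet fun a ha => ?_
      simp only [hx.deriv_neg_mul_powerSum ha, norm_neg]
      rfl
  rw [lintegral_congr_ae h1]
  exact lintegral_lintegral_swap ((hmV.mul hmg).comp measurable_swap).aemeasurable

/-- Palm formula. `F' a y` expresses `F` at the Blaschke multiple `y'` of `y`, so that after the
change of law only the Gaussian `y` remains. The case `powerSum y a = 0` may be ignored because the
weight `|y(a)|²` vanishes there. -/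
theorem lintegral_tsum_regularZeros_of_blaschke {F : ℂ × (ℕ → ℂ) → ℝ≥0∞} (hF : Measurable F)
    {F' : ℂ → (ℕ → ℂ) → ℝ≥0∞} (hF' : ∀ a, Measurable (F' a))
    (hFF' : ∀ a ∈ openUnitDisk, ∀ y y', IsSubexponential y → IsSubexponential y' →
      (∀ z ∈ openUnitDisk, (1 - conj a * z) * powerSum y' z = (z - a) * powerSum y z) →
      powerSum y a ≠ 0 → F (a, y') = F' a y) :
    ∫⁻ x, ∑' z, (regularZeros x).indicator (fun z => F (z, x)) z ∂gaussianSeq =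
      ∫⁻ a in openUnitDisk, ENNReal.ofReal (Real.pi * (1 - ‖a‖ ^ 2))⁻¹ *
        ∫⁻ y, ENNReal.ofReal (‖powerSum y a‖ ^ 2) * F' a y ∂gaussianSeq := by
  rw [lintegral_tsum_regularZeros_eq hF]
  refine setLIntegral_congr_fun isOpen_openUnitDisk.measurableSet fun a ha => ?_
  have ha' : ‖a‖ < 1 := ha
  have hr : 0 < 1 - ‖a‖ ^ 2 := by nlinarith [norm_nonneg a]
  have hmG : Measurable fun y => ENNReal.ofReal (‖powerSum y a‖ ^ 2) * F' a y :=
    ((measurable_powerSum_left a).norm.pow_const 2).ennreal_ofReal.mul (hF' a)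
  have h1 : ∀ᵐ x ∂gaussianSeq,
      ENNReal.ofReal (‖powerSum (blaschkeQuotient a x) a / (1 - conj a * a)‖ ^ 2) *
          (ENNReal.ofReal (complexGaussianDensity (-(a * powerSum x a))) *
            F (a, seqCons (-(a * powerSum x a)) x)) =
      ENNReal.ofReal (Real.pi⁻¹ * ((1 - ‖a‖ ^ 2) ^ 2)⁻¹) *
        (ENNReal.ofReal (Real.exp (-‖a * powerSum x a‖ ^ 2)) *
          (ENNReal.ofReal (‖powerSum (blaschkeQuotient a x) a‖ ^ 2) *
            F' a (blaschkeQuotient a x))) := by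
    filter_upwards [ae_isSubexponential] with x hx
    have hn : ‖1 - conj a * a‖ = 1 - ‖a‖ ^ 2 := by
      rw [mul_comm, Complex.mul_conj, Complex.normSq_eq_norm_sq]
      rw [show (1 : ℂ) - ((‖a‖ ^ 2 : ℝ) : ℂ) = ((1 - ‖a‖ ^ 2 : ℝ) : ℂ) by push_cast; rfl,
        Complex.norm_real, Real.norm_of_nonneg hr.le]
    rw [norm_div, hn, div_pow, complexGaussianDensity, norm_neg]
    by_cases hV : powerSum (blaschkeQuotient a x) a = 0
    · simp [hV]
    · rw [hFF' a ha (blaschkeQuotient a x) _ (hx.blaschkeQuotient ha') (hx.seqCons _) ?_ hV]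
      · rw [← mul_assoc, ← mul_assoc, ← mul_assoc, ← ENNReal.ofReal_mul (by positivity),
          ← ENNReal.ofReal_mul (by positivity), ← ENNReal.ofReal_mul (by positivity)]
        congr 2
        ring
      · intro z hz
        rw [hx.powerSum_seqCons _ hz, hx.powerSum_blaschkeQuotient ha' hz]
        ring
  -- `π⁻¹` comes from the density, the inverse square from `|φ'(a)|²`, and the last factor from the
  -- change of law.
  have hconst : Real.pi⁻¹ * ((1 - ‖a‖ ^ 2) ^ 2)⁻¹ * (1 - ‖a‖ ^ 2) =
      (Real.pi * (1 - ‖a‖ ^ 2))⁻¹ := by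
    field_simp
  rw [lintegral_congr_ae h1, lintegral_const_mul', lintegral_blaschkeQuotient ha' hmG, ← mul_assoc,
    ← ENNReal.ofReal_mul (by positivity), hconst]
  exact ENNReal.ofReal_ne_top

/-! ### Correlation integrals of all orders -/

/-- The squared modulus of the Blaschke factor with zero `a`, at the point `c`. -/
noncomputable def blaschkeSq (a c : ℂ) : ℝ≥0∞ :=
  ENNReal.ofReal (‖c - a‖ ^ 2 / ‖1 - conj a * c‖ ^ 2)

/-- The squared modulus of the power series. -/
noncomputable def powerSumSq (x : ℕ → ℂ) (c : ℂ) : ℝ≥0∞ := ENNReal.ofReal (‖powerSum x c‖ ^ 2)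

/-- The weight in the iterated one-point formula. -/
noncomputable def palmWeight : (n : ℕ) → (Fin n → ℂ) → ℝ≥0∞
  | 0, _ => 1
  | n + 1, a => ENNReal.ofReal (Real.pi * (1 - ‖a 0‖ ^ 2))⁻¹ * palmWeight n (fun i => a i.succ) *
      ∏ i : Fin n, blaschkeSq (a i.succ) (a 0)

/-- The mixed second moments of the Gaussian power series. -/
noncomputable def mixedMoment {m n : ℕ} (c : Fin m → ℂ) (a : Fin n → ℂ) : ℝ≥0∞ :=
  ∫⁻ x, (∏ j, powerSumSq x (c j)) * ∏ i, powerSumSq x (a i) ∂gaussianSeq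

theorem measurable_blaschkeSq : Measurable fun p : ℂ × ℂ => blaschkeSq p.1 p.2 := by
  unfold blaschkeSq
  refine Measurable.ennreal_ofReal (Measurable.div (by fun_prop) ?_)
  exact (measurable_const.sub ((Complex.continuous_conj.measurable.comp measurable_fst).mul
    measurable_snd)).norm.pow_const 2

theorem measurable_powerSumSq : Measurable fun p : (ℕ → ℂ) × ℂ => powerSumSq p.1 p.2 :=
  (measurable_powerSum.norm.pow_const 2).ennreal_ofReal

theorem Measurable.comp_powerSumSq {α : Type*} [MeasurableSpace α] {x : α → ℕ → ℂ} {c : α → ℂ}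
    (hx : Measurable x) (hc : Measurable c) : Measurable fun p => powerSumSq (x p) (c p) := by
  have h := measurable_powerSumSq.comp (hx.prodMk hc)
  simpa only [Function.comp_def] using h

theorem Measurable.comp_blaschkeSq {α : Type*} [MeasurableSpace α] {a : α → ℂ} {c : α → ℂ}
    (ha : Measurable a) (hc : Measurable c) : Measurable fun p => blaschkeSq (a p) (c p) := by
  have h := measurable_blaschkeSq.comp (ha.prodMk hc)
  simpa only [Function.comp_def] using h

theorem measurable_prod_powerSumSq {m : ℕ} (c : Fin m → ℂ) :
    Measurable fun x : ℕ → ℂ => ∏ j, powerSumSq x (c j) :=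
  Finset.measurable_fun_prod _ fun _ _ => measurable_id.comp_powerSumSq measurable_const

theorem measurable_palmWeight (n : ℕ) : Measurable (palmWeight n) := by
  induction n with
  | zero => exact measurable_const
  | succ n ih =>
    have h : Measurable fun (a : Fin (n + 1) → ℂ) (i : Fin n) => a i.succ :=
      measurable_pi_lambda _ fun i => measurable_pi_apply _
    refine Measurable.mul (Measurable.mul ?_ (ih.comp h)) ?_
    · exact (((measurable_pi_apply 0).norm.pow_const 2).const_sub 1 |>.const_mul
        Real.pi).inv.ennreal_ofReal
    · exact Finset.measurable_fun_prod _ fun i _ =>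
        (measurable_pi_apply _).comp_blaschkeSq (measurable_pi_apply _)

theorem measurable_mixedMoment {m n : ℕ} (c : Fin m → ℂ) :
    Measurable fun a : Fin n → ℂ => mixedMoment c a := by
  refine Measurable.lintegral_prod_right' (f := fun p : (Fin n → ℂ) × (ℕ → ℂ) =>
    (∏ j, powerSumSq p.2 (c j)) * ∏ i, powerSumSq p.2 (p.1 i)) ?_
  refine Measurable.mul ?_ ?_
  · exact Finset.measurable_fun_prod _ fun _ _ => measurable_snd.comp_powerSumSq measurable_const
  · exact Finset.measurable_fun_prod _ fun i _ =>
      measurable_snd.comp_powerSumSq ((measurable_pi_apply i).comp measurable_fst)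

theorem mixedMoment_cons {m n : ℕ} (c : Fin m → ℂ) (a : ℂ) (b : Fin n → ℂ) :
    mixedMoment (Fin.cons a c : Fin (m + 1) → ℂ) b =
      mixedMoment c (Fin.cons a b : Fin (n + 1) → ℂ) := by
  refine lintegral_congr fun x => ?_
  simp only [Fin.prod_univ_succ, Fin.cons_zero, Fin.cons_succ]
  ring

theorem measurable_finCons {n : ℕ} :
    Measurable fun p : ℂ × (Fin n → ℂ) => (Fin.cons p.1 p.2 : Fin (n + 1) → ℂ) := by
  refine measurable_pi_lambda _ fun i => ?_
  refine Fin.cases ?_ (fun i => ?_) i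
  · simp only [Fin.cons_zero]
    fun_prop
  · simp only [Fin.cons_succ]
    fun_prop

theorem measurableSet_injective (n : ℕ) :
    MeasurableSet {b : Fin n → ℂ | Function.Injective b} := by
  have h : {b : Fin n → ℂ | Function.Injective b} = ⋂ i, ⋂ j, {b | b i = b j → i = j} := by
    ext b
    simp [Function.Injective]
  rw [h]
  refine MeasurableSet.iInter fun i => MeasurableSet.iInter fun j => ?_
  exact (measurableSet_eq_fun (measurable_pi_apply i) (measurable_pi_apply j)).imp
    (MeasurableSet.const _)

theorem setLIntegral_pi_succ {n : ℕ} {D : Set ℂ} (hD : MeasurableSet D)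
    {f : (Fin (n + 1) → ℂ) → ℝ≥0∞} (hf : Measurable f) :
    ∫⁻ a in univ.pi (fun _ => D), f a =
      ∫⁻ a in D, ∫⁻ b in univ.pi (fun _ : Fin n => D), f (Fin.cons a b) := by
  have hDn : ∀ k, MeasurableSet (univ.pi fun _ : Fin k => D) := fun k =>
    MeasurableSet.univ_pi fun _ => hD
  have h := (volume_preserving_piFinSuccAbove (fun _ : Fin (n + 1) => ℂ) 0).symm
  have hm := (hf.indicator (hDn (n + 1))).comp h.measurable
  rw [← lintegral_indicator (hDn _), ← h.lintegral_comp (hf.indicator (hDn _)),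
    Measure.volume_eq_prod]
  refine (lintegral_prod _ hm.aemeasurable).trans ?_
  rw [← lintegral_indicator hD]
  refine lintegral_congr fun a => ?_
  simp only [Function.comp_apply]
  have h1 : ∀ b : Fin n → ℂ,
      (MeasurableEquiv.piFinSuccAbove (fun _ : Fin (n + 1) => ℂ) 0).symm (a, b) =
      (Fin.cons a b : Fin (n + 1) → ℂ) := fun b => by
    simp [MeasurableEquiv.piFinSuccAbove_symm_apply, Fin.insertNthEquiv]
  simp_rw [h1]
  have h2 : ∀ b : Fin n → ℂ, (Fin.cons a b : Fin (n + 1) → ℂ) ∈ univ.pi (fun _ => D) ↔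
      a ∈ D ∧ b ∈ univ.pi (fun _ => D) := fun b => by
    simp [Fin.forall_fin_succ]
  by_cases ha : a ∈ D
  · rw [indicator_of_mem ha, ← lintegral_indicator (hDn _)]
    refine lintegral_congr fun b => ?_
    by_cases hb : b ∈ univ.pi fun _ : Fin n => D
    · rw [indicator_of_mem hb, indicator_of_mem ((h2 b).2 ⟨ha, hb⟩)]
    · rw [indicator_of_notMem hb, indicator_of_notMem fun h => hb ((h2 b).1 h).2]
  · rw [indicator_of_notMem ha]
    refine (lintegral_congr fun b => ?_).trans lintegral_zero
    exact indicator_of_notMem (fun h => ha ((h2 b).1 h).1) _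

section
variable {a : ℂ} {y y' : ℕ → ℂ}

theorem regularZeros_of_blaschke (ha : a ∈ openUnitDisk) (hy : IsSubexponential y)
    (hy' : IsSubexponential y')
    (h : ∀ z ∈ openUnitDisk, (1 - conj a * z) * powerSum y' z = (z - a) * powerSum y z)
    (hya : powerSum y a ≠ 0) : regularZeros y' = insert a (regularZeros y) := by
  have hne : ∀ z ∈ openUnitDisk, 1 - conj a * z ≠ 0 := fun z hz =>
    one_sub_conj_mul_ne_zero ha hz
  have hreg' : ∃ w ∈ openUnitDisk, powerSum y' w ≠ 0 := by
    have hc : ContinuousAt (powerSum y) a := (hy.differentiableAt ha).continuousAt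
    have h1 := hc.eventually_ne hya
    have h2 : ∀ᶠ z in nhds a, z ∈ openUnitDisk := isOpen_openUnitDisk.mem_nhds ha
    have h3 := (h1.and h2).filter_mono (nhdsWithin_le_nhds (s := {a}ᶜ))
    obtain ⟨w, ⟨hw1, hw2⟩, hwa⟩ := (h3.and self_mem_nhdsWithin).exists
    refine ⟨w, hw2, fun h0 => ?_⟩
    have h4 := h w hw2
    rw [h0, mul_zero, eq_comm, mul_eq_zero, sub_eq_zero] at h4
    exact h4.elim hwa hw1
  ext z
  constructor
  · rintro ⟨-, hz, h0⟩
    have h4 := h z hz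
    rw [h0, mul_zero, eq_comm, mul_eq_zero, sub_eq_zero] at h4
    exact h4.imp id fun h5 => ⟨⟨hy, a, ha, hya⟩, hz, h5⟩
  · rintro (rfl | ⟨-, hz, h0⟩)
    · refine ⟨⟨hy', hreg'⟩, ha, ?_⟩
      have h4 := h z ha
      rw [sub_self, zero_mul, mul_eq_zero] at h4
      exact h4.resolve_left (hne z ha)
    · refine ⟨⟨hy', hreg'⟩, hz, ?_⟩
      have h4 := h z hz
      rw [h0, mul_zero, mul_eq_zero] at h4
      exact h4.resolve_left (hne z hz)

theorem powerSumSq_of_blaschke (ha : a ∈ openUnitDisk) {c : ℂ} (hc : c ∈ openUnitDisk)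
    (h : ∀ z ∈ openUnitDisk, (1 - conj a * z) * powerSum y' z = (z - a) * powerSum y z) :
    powerSumSq y' c = blaschkeSq a c * powerSumSq y c := by
  have hne := one_sub_conj_mul_ne_zero ha hc
  rw [powerSumSq, blaschkeSq, powerSumSq, ← ENNReal.ofReal_mul (by positivity)]
  congr 1
  have h1 : powerSum y' c = (c - a) * powerSum y c / (1 - conj a * c) := by
    rw [← h c hc, mul_div_cancel_left₀ _ hne]
  rw [h1, norm_div, norm_mul, div_pow, mul_pow]
  ring

/-- The zeros of `y'` are those of `y` together with the new point `a`. Requiring `Fin.cons a z` to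
be injective removes exactly the tuples that reuse `a`. -/
theorem tsum_tuples_of_blaschke {n : ℕ} (ha : a ∈ openUnitDisk) (hy : IsSubexponential y)
    (hy' : IsSubexponential y')
    (h : ∀ z ∈ openUnitDisk, (1 - conj a * z) * powerSum y' z = (z - a) * powerSum y z)
    (hya : powerSum y a ≠ 0) (f : (Fin (n + 1) → ℂ) → ℝ≥0∞) :
    ∑' z, (tuples n (regularZeros y')).indicator
      (fun z => {b | Function.Injective b}.indicator f (Fin.cons a z)) z =
    ∑' z, (tuples n (regularZeros y)).indicator
      ({b | Function.Injective b}.indicator fun z => f (Fin.cons a z)) z := by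
  refine tsum_congr fun z => ?_
  have hZ := regularZeros_of_blaschke ha hy hy' h hya
  have hana : a ∉ regularZeros y := fun h0 => hya h0.2.2
  by_cases hz : z ∈ tuples n (regularZeros y) ∧ Function.Injective z
  · have h1 : z ∈ tuples n (regularZeros y') := fun i => by
      rw [hZ]
      exact Or.inr (hz.1 i)
    have h2 : (Fin.cons a z : Fin (n + 1) → ℂ) ∈
        {b : Fin (n + 1) → ℂ | Function.Injective b} := by
      refine Fin.cons_injective_iff.2 ⟨?_, hz.2⟩
      rintro ⟨i, rfl⟩
      exact hana (hz.1 i)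
    rw [indicator_of_mem h1, indicator_of_mem h2, indicator_of_mem hz.1,
      indicator_of_mem (s := {b | Function.Injective b}) hz.2]
  · have h1 : ¬ (z ∈ tuples n (regularZeros y') ∧ (Fin.cons a z : Fin (n + 1) → ℂ) ∈
        {b : Fin (n + 1) → ℂ | Function.Injective b}) := by
      rintro ⟨h1, h2⟩
      obtain ⟨h3, h4⟩ := Fin.cons_injective_iff.1 h2
      refine hz ⟨fun i => ?_, h4⟩
      have h5 := h1 i
      rw [hZ] at h5
      exact h5.resolve_left fun h6 => h3 ⟨i, h6⟩
    trans 0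
    · by_cases h2 : z ∈ tuples n (regularZeros y')
      · rw [indicator_of_mem h2, indicator_of_notMem fun h3 => h1 ⟨h2, h3⟩]
      · rw [indicator_of_notMem h2]
    · by_cases h2 : z ∈ tuples n (regularZeros y)
      · rw [indicator_of_mem h2, indicator_of_notMem fun h3 => hz ⟨h2, h3⟩]
      · rw [indicator_of_notMem h2]

end

/-- The auxiliary factors at the points `c j` make the induction close: extracting a zero `a`
multiplies each by `blaschkeSq a (c j)` and adds a new factor `|X(a)|²`, so `c` becomes `Fin.cons a
c`. -/
theorem lintegral_tsum_tuples_mul (n : ℕ) {m : ℕ} (c : Fin m → ℂ)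
    (hc : ∀ j, c j ∈ openUnitDisk) {f : (Fin n → ℂ) → ℝ≥0∞} (hf : Measurable f) :
    ∫⁻ x, (∑' z, (tuples n (regularZeros x)).indicator
        ({b | Function.Injective b}.indicator f) z) * ∏ j, powerSumSq x (c j) ∂gaussianSeq =
      ∫⁻ a in univ.pi fun _ => openUnitDisk,
        f a * palmWeight n a * (∏ i, ∏ j, blaschkeSq (a i) (c j)) * mixedMoment c a := by
  induction n generalizing m with
  | zero =>
    have h0 : ∀ x, ∑' z, (tuples 0 (regularZeros x)).indicator
        ({b | Function.Injective b}.indicator f) z = f default := fun x => by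
      rw [tsum_eq_single default fun z hz => (hz (Subsingleton.elim _ _)).elim,
        indicator_of_mem (s := tuples 0 (regularZeros x)) fun i => i.elim0,
        indicator_of_mem (s := {b | Function.Injective b}) fun i => i.elim0]
    simp_rw [h0]
    rw [lintegral_const_mul _ (measurable_prod_powerSumSq c),
      show (univ.pi fun _ : Fin 0 => openUnitDisk) = univ from by ext; simp]
    rw [Measure.restrict_univ, volume_pi, Measure.pi_of_empty _ default, lintegral_dirac]
    simp [mixedMoment, palmWeight]
  | succ n ih =>
    have hI : MeasurableSet {b : Fin (n + 1) → ℂ | Function.Injective b} :=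
      measurableSet_injective _
    have hI' : MeasurableSet {b : Fin n → ℂ | Function.Injective b} :=
      measurableSet_injective _
    simp_rw [tsum_tuples_succ]
    set F : ℂ × (ℕ → ℂ) → ℝ≥0∞ := fun p =>
      (∑' z, (tuples n (regularZeros p.2)).indicator
        (fun z => {b | Function.Injective b}.indicator f (Fin.cons p.1 z)) z) *
        ∏ j, powerSumSq p.2 (c j) with hFdef
    set F' : ℂ → (ℕ → ℂ) → ℝ≥0∞ := fun a y =>
      (∑' z, (tuples n (regularZeros y)).indicator
        ({b | Function.Injective b}.indicator fun z => f (Fin.cons a z)) z) *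
        ((∏ j, blaschkeSq a (c j)) * ∏ j, powerSumSq y (c j)) with hF'def
    have hcons : ∀ a : ℂ, Measurable fun z : Fin n → ℂ => (Fin.cons a z : Fin (n + 1) → ℂ) :=
      fun a => measurable_finCons.comp (measurable_const.prodMk measurable_id)
    have hF : Measurable F := by
      refine Measurable.mul (measurable_tsum_tuples n measurable_snd
        (f := fun q : (ℂ × (ℕ → ℂ)) × (Fin n → ℂ) =>
          {b | Function.Injective b}.indicator f (Fin.cons q.1.1 q.2)) ?_) ?_
      · exact (hf.indicator hI).comp (measurable_finCons.comp
          ((measurable_fst.comp measurable_fst).prodMk measurable_snd))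
      · exact (measurable_prod_powerSumSq c).comp measurable_snd
    have hF' : ∀ a, Measurable (F' a) := fun a => by
      refine Measurable.mul (measurable_tsum_tuples n measurable_id
        (f := fun q : (ℕ → ℂ) × (Fin n → ℂ) =>
          {b | Function.Injective b}.indicator (fun z => f (Fin.cons a z)) q.2) ?_) ?_
      · exact ((hf.comp (hcons a)).indicator hI').comp measurable_snd
      · exact (measurable_prod_powerSumSq c).const_mul _
    have hL : ∀ x, (∑' z, (regularZeros x).indicator (fun z => ∑' a,
        (tuples n (regularZeros x)).indicator
          (fun a => {b | Function.Injective b}.indicator f (Fin.cons z a)) a) z) *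
        ∏ j, powerSumSq x (c j) = ∑' z, (regularZeros x).indicator (fun z => F (z, x)) z := by
      intro x
      rw [← ENNReal.tsum_mul_right]
      refine tsum_congr fun z => ?_
      by_cases hz : z ∈ regularZeros x
      · rw [indicator_of_mem hz, indicator_of_mem hz]
      · rw [indicator_of_notMem hz, indicator_of_notMem hz, zero_mul]
    simp_rw [hL]
    rw [lintegral_tsum_regularZeros_of_blaschke hF hF' fun a ha y y' hy hy' h hya => ?_]
    swap
    · simp only [hFdef, hF'def]
      rw [tsum_tuples_of_blaschke ha hy hy' h hya, ← Finset.prod_mul_distrib]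
      congr 1
      exact Finset.prod_congr rfl fun j _ => powerSumSq_of_blaschke ha (hc j) h
    rw [setLIntegral_pi_succ isOpen_openUnitDisk.measurableSet]
    swap
    · refine Measurable.mul (Measurable.mul (hf.mul (measurable_palmWeight _)) ?_)
        (measurable_mixedMoment c)
      exact Finset.measurable_fun_prod _ fun i _ => Finset.measurable_fun_prod _ fun j _ =>
        (measurable_pi_apply i).comp_blaschkeSq measurable_const
    refine setLIntegral_congr_fun isOpen_openUnitDisk.measurableSet fun a ha => ?_
    have hc' : ∀ j, (Fin.cons a c : Fin (m + 1) → ℂ) j ∈ openUnitDisk :=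
      Fin.cases ha hc
    have h1 : ∀ y, ENNReal.ofReal (‖powerSum y a‖ ^ 2) * F' a y =
        (∏ j, blaschkeSq a (c j)) * ((∑' z, (tuples n (regularZeros y)).indicator
        ({b | Function.Injective b}.indicator fun z => f (Fin.cons a z)) z) *
          ∏ j, powerSumSq y ((Fin.cons a c : Fin (m + 1) → ℂ) j)) := fun y => by
      simp only [hF'def, Fin.prod_univ_succ, Fin.cons_zero, Fin.cons_succ, powerSumSq]
      ring
    simp_rw [h1]
    have hfa : Measurable fun z => f (Fin.cons a z) := hf.comp (hcons a)
    rw [lintegral_const_mul, ih _ hc' hfa, ← mul_assoc, ← lintegral_const_mul]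
    · refine lintegral_congr fun b => ?_
      rw [mixedMoment_cons]
      simp only [Fin.prod_univ_succ, Fin.cons_zero, Fin.cons_succ, palmWeight,
        Finset.prod_mul_distrib]
      ring
    · refine Measurable.mul (Measurable.mul ((hf.comp (hcons a)).mul (measurable_palmWeight _)) ?_)
        (measurable_mixedMoment _)
      exact Finset.measurable_fun_prod _ fun i _ => Finset.measurable_fun_prod _ fun j _ =>
        (measurable_pi_apply i).comp_blaschkeSq measurable_const
    · refine Measurable.mul (measurable_tsum_tuples n measurable_id
        (f := fun q : (ℕ → ℂ) × (Fin n → ℂ) =>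
          {b | Function.Injective b}.indicator (fun z => f (Fin.cons a z)) q.2) ?_)
        (measurable_prod_powerSumSq _)
      exact ((hf.comp (hcons a)).indicator hI').comp measurable_snd

theorem lintegral_tsum_tuples (n : ℕ) {f : (Fin n → ℂ) → ℝ≥0∞} (hf : Measurable f) :
    ∫⁻ x, ∑' z, (tuples n (regularZeros x)).indicator
        ({b | Function.Injective b}.indicator f) z ∂gaussianSeq =
      ∫⁻ a in univ.pi fun _ => openUnitDisk,
        f a * (palmWeight n a * ∫⁻ x, ∏ i, powerSumSq x (a i) ∂gaussianSeq) := by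
  have h := lintegral_tsum_tuples_mul n (Fin.elim0 : Fin 0 → ℂ) (fun j => j.elim0) hf
  simp only [mixedMoment, Finset.univ_eq_empty, Finset.prod_empty, mul_one,
    Finset.prod_const_one, one_mul] at h
  simp_rw [h, mul_assoc]

/-! ### The Wick formula for moments of complex Gaussian vectors -/

theorem measurePreserving_rotation_stdComplexGaussian (u : Circle) :
    MeasurePreserving (fun z : ℂ => (u : ℂ) * z) stdComplexGaussian stdComplexGaussian := by
  refine ⟨by fun_prop, ?_⟩
  refine Measure.ext_of_lintegral _ fun f hf => ?_
  have h1 := (rotation u).measurePreserving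
  rw [lintegral_map hf (by fun_prop), lintegral_stdComplexGaussian (by fun_prop),
    lintegral_stdComplexGaussian hf, ← h1.lintegral_comp (f := fun z =>
      ENNReal.ofReal (complexGaussianDensity z) * f z)
      (measurable_complexGaussianDensity.ennreal_ofReal.mul hf)]
  refine lintegral_congr fun z => ?_
  rw [rotation_apply, complexGaussianDensity, complexGaussianDensity, norm_mul, Circle.norm_coe,
    one_mul]

theorem integral_pow_mul_conj_pow_of_ne {p q : ℕ} (h : p ≠ q) :
    ∫ z, z ^ p * conj z ^ q ∂stdComplexGaussian = 0 := by
  -- Rotation by this angle multiplies the integrand by `exp(i (p - q) θ) = -1`, while the measure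
  -- is rotation invariant.
  set θ : ℝ := Real.pi / ((p : ℝ) - q) with hθ
  have hu : (Circle.exp θ : ℂ) ^ p * conj (Circle.exp θ : ℂ) ^ q = -1 := by
    rw [Circle.coe_exp, ← Complex.exp_conj, ← Complex.exp_nat_mul, ← Complex.exp_nat_mul,
      ← Complex.exp_add, ← Complex.exp_pi_mul_I]
    congr 1
    have h2 : ((p : ℂ) - q) * (θ : ℂ) = Real.pi := by
      have hpq : (p : ℂ) - q ≠ 0 := sub_ne_zero.2 (Nat.cast_injective.ne h)
      rw [hθ]
      push_cast
      field_simp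
    rw [← h2]
    simp only [map_mul, Complex.conj_ofReal, Complex.conj_I]
    ring
  have h1 := (measurePreserving_rotation_stdComplexGaussian (Circle.exp θ)).integral_comp
    (MeasurableEmbedding.of_measurable_inverse (by fun_prop) ?_ (g := fun z =>
      (Circle.exp θ : ℂ)⁻¹ * z) (by fun_prop) ?_) (fun z : ℂ => z ^ p * conj z ^ q)
  · have h3 : ∀ z : ℂ, ((Circle.exp θ : ℂ) * z) ^ p * conj ((Circle.exp θ : ℂ) * z) ^ q =
        -1 * (z ^ p * conj z ^ q) := fun z => by
      rw [map_mul, mul_pow, mul_pow, ← hu]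
      ring
    simp_rw [h3] at h1
    rw [integral_const_mul] at h1
    exact self_eq_neg.1 (by linear_combination (-1 : ℂ) * h1)
  · have : range (fun z => (Circle.exp θ : ℂ) * z) = univ :=
      (mul_left_surjective₀ (Circle.coe_ne_zero _)).range_eq
    rw [this]
    exact MeasurableSet.univ
  · intro z
    exact inv_mul_cancel_left₀ (Circle.coe_ne_zero _) z

theorem integral_pow_mul_conj_pow_self (p : ℕ) :
    ∫ z, z ^ p * conj z ^ p ∂stdComplexGaussian = (p.factorial : ℂ) := by
  have h := Complex.integral_rpow_mul_exp_neg_rpow (p := 2) (q := (2 * p : ℕ)) (by norm_num)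
    (lt_of_lt_of_le (by norm_num) (Nat.cast_nonneg _))
  have h1 : ∀ z : ℂ, z ^ p * conj z ^ p = ((‖z‖ ^ (2 * p) : ℝ) : ℂ) := fun z => by
    rw [← mul_pow, Complex.mul_conj, Complex.normSq_eq_norm_sq, pow_mul]
    push_cast
    ring
  simp_rw [h1]
  rw [integral_complex_ofReal, integral_stdComplexGaussian]
  have h2 : ∀ z : ℂ, complexGaussianDensity z • ‖z‖ ^ (2 * p) =
      Real.pi⁻¹ * (‖z‖ ^ ((2 * p : ℕ) : ℝ) * Real.exp (-‖z‖ ^ (2 : ℝ))) := fun z => by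
    rw [complexGaussianDensity, Real.rpow_natCast, Real.rpow_ofNat, smul_eq_mul]
    ring
  simp_rw [h2]
  rw [integral_const_mul, h, show (((2 * p : ℕ) : ℝ) + 2) / 2 = p + 1 by push_cast; ring,
    Real.Gamma_nat_eq_factorial]
  have := Real.pi_ne_zero
  norm_cast
  field_simp

theorem integrable_pow_mul_conj_pow (p q : ℕ) :
    Integrable (fun z : ℂ => z ^ p * conj z ^ q) stdComplexGaussian := by
  refine (integrable_norm_pow_stdComplexGaussian (p + q)).mono'
    (Continuous.aestronglyMeasurable (by fun_prop)) (Filter.Eventually.of_forall fun z => ?_)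
  rw [norm_mul, norm_pow, norm_pow, Complex.norm_conj, pow_add]

theorem exists_perm_comp_eq {α β : Type*} [Fintype α] [DecidableEq β] {k l : α → β}
    (h : ∀ j, Fintype.card {i // k i = j} = Fintype.card {i // l i = j}) :
    ∃ σ : Equiv.Perm α, k ∘ σ = l := by
  have e : ∀ j, Nonempty ({i // l i = j} ≃ {i // k i = j}) := fun j =>
    Fintype.card_eq.1 (h j).symm
  refine ⟨(Equiv.sigmaFiberEquiv l).symm.trans ((Equiv.sigmaCongrRight fun j => (e j).some).trans
    (Equiv.sigmaFiberEquiv k)), funext fun i => ?_⟩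
  exact ((e (l i)).some ⟨i, rfl⟩).2

/-- If one `τ` solves `k ∘ τ = l`, the solutions form a coset of the stabilizer of `k`, of order the
product of the factorials of its fibre sizes. If some fibre sizes differ, both sides are zero. -/
theorem card_perm_comp_eq {α β : Type*} [Fintype α] [DecidableEq α] [Fintype β] [DecidableEq β]
    (k l : α → β) :
    Fintype.card {σ : Equiv.Perm α // k ∘ σ = l} =
      ∏ j, if Fintype.card {i // k i = j} = Fintype.card {i // l i = j} then
        (Fintype.card {i // k i = j}).factorial else 0 := by
  by_cases h : ∀ j, Fintype.card {i // k i = j} = Fintype.card {i // l i = j}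
  · obtain ⟨τ, rfl⟩ := exists_perm_comp_eq h
    simp_rw [if_pos (h _), ← DomMulAct.stabilizer_card]
    refine Fintype.card_congr (Equiv.subtypeEquiv (Equiv.mulRight τ⁻¹) fun σ => ?_)
    simp only [Equiv.coe_mulRight, Equiv.Perm.coe_mul, ← Function.comp_assoc]
    constructor
    · intro h2
      rw [h2, Function.comp_assoc, ← Equiv.Perm.coe_mul, mul_inv_cancel]
      rfl
    · intro h2
      conv_rhs => rw [← h2]
      rw [Function.comp_assoc, ← Equiv.Perm.coe_mul, inv_mul_cancel]
      rfl
  · obtain ⟨j, hj⟩ := not_forall.1 h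
    rw [Finset.prod_eq_zero (Finset.mem_univ j) (if_neg hj), Fintype.card_eq_zero_iff]
    refine ⟨fun ⟨σ, hσ⟩ => hj ?_⟩
    subst hσ
    exact (Fintype.card_congr (Equiv.subtypeEquiv σ fun i => Iff.rfl)).symm

theorem prod_comp_eq_prod_pow_card {α β : Type*} [Fintype α] [Fintype β] [DecidableEq β]
    {M : Type*} [CommMonoid M] (k : α → β) (z : β → M) :
    ∏ i, z (k i) = ∏ j, z j ^ Fintype.card {i // k i = j} := by
  rw [← Fintype.prod_fiberwise' k z]
  simp [Finset.prod_const]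

theorem prod_mul_conj_eq {α β : Type*} [Fintype α] [Fintype β] [DecidableEq β]
    (k l : α → β) (z : β → ℂ) :
    ∏ i, z (k i) * conj (z (l i)) =
      ∏ j, z j ^ Fintype.card {i // k i = j} * conj (z j) ^ Fintype.card {i // l i = j} := by
  rw [Finset.prod_mul_distrib, Finset.prod_mul_distrib, prod_comp_eq_prod_pow_card k z,
    prod_comp_eq_prod_pow_card l fun j => conj (z j)]

theorem integrable_prod_mul_conj {α β : Type*} [Fintype α] [Fintype β] [DecidableEq β]
    (k l : α → β) :
    Integrable (fun z : β → ℂ => ∏ i, z (k i) * conj (z (l i)))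
      (Measure.pi fun _ => stdComplexGaussian) := by
  simp_rw [prod_mul_conj_eq]
  exact Integrable.fintype_prod (f := fun j z => z ^ Fintype.card {i // k i = j} *
    conj z ^ Fintype.card {i // l i = j}) fun j => integrable_pow_mul_conj_pow _ _

/-- By independence the integral factors into moments `E z^p z̄^q = p! δ_{pq}`, and their product
counts the pairings `σ`. -/
theorem integral_prod_mul_conj {α β : Type*} [Fintype α] [DecidableEq α] [Fintype β] [DecidableEq β]
    (k l : α → β) :
    ∫ z : β → ℂ, ∏ i, z (k i) * conj (z (l i)) ∂(Measure.pi fun _ => stdComplexGaussian) =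
      (Fintype.card {σ : Equiv.Perm α // k ∘ σ = l} : ℂ) := by
  simp_rw [prod_mul_conj_eq]
  rw [integral_fintype_prod_eq_prod (fun j (z : ℂ) => z ^ Fintype.card {i // k i = j} *
    conj z ^ Fintype.card {i // l i = j}), card_perm_comp_eq, Nat.cast_prod]
  refine Finset.prod_congr rfl fun j _ => ?_
  split_ifs with h
  · rw [← h, integral_pow_mul_conj_pow_self]
  · rw [integral_pow_mul_conj_pow_of_ne h, Nat.cast_zero]

theorem prod_mulVec_mul_conj {n : ℕ} (L : Matrix (Fin n) (Fin n) ℂ) (z : Fin n → ℂ) :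
    ∏ i, L.mulVec z i * conj (L.mulVec z i) =
      ∑ k : Fin n → Fin n, ∑ l : Fin n → Fin n,
        ((∏ i, L i (k i)) * ∏ i, conj (L i (l i))) * ∏ i, z (k i) * conj (z (l i)) := by
  have h1 : ∏ i, L.mulVec z i = ∑ k : Fin n → Fin n, ∏ i, L i (k i) * z (k i) := by
    simp_rw [Matrix.mulVec, dotProduct]
    rw [Finset.prod_univ_sum, Fintype.piFinset_univ]
  rw [Finset.prod_mul_distrib, ← map_prod, h1, map_sum, Finset.sum_mul_sum]
  refine Finset.sum_congr rfl fun k _ => Finset.sum_congr rfl fun l _ => ?_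
  simp only [map_prod, map_mul, Finset.prod_mul_distrib]
  ring

theorem integrable_prod_mulVec_mul_conj {n : ℕ} (L : Matrix (Fin n) (Fin n) ℂ) :
    Integrable (fun z : Fin n → ℂ => ∏ i, L.mulVec z i * conj (L.mulVec z i))
      (Measure.pi fun _ => stdComplexGaussian) := by
  simp_rw [prod_mulVec_mul_conj]
  exact integrable_finsetSum _ fun k _ => integrable_finsetSum _ fun l _ =>
    (integrable_prod_mul_conj k l).const_mul _

/-- The Wick formula for the product of the squared moduli of the entries of a complex Gaussian
vector with covariance `L Lᴴ`. -/
theorem integral_prod_mulVec_mul_conj {n : ℕ} (L : Matrix (Fin n) (Fin n) ℂ) :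
    ∫ z : Fin n → ℂ, ∏ i, L.mulVec z i * conj (L.mulVec z i)
      ∂(Measure.pi fun _ => stdComplexGaussian) = (L * L.conjTranspose).permanent := by
  simp_rw [prod_mulVec_mul_conj]
  rw [integral_finsetSum _ fun k _ => integrable_finsetSum _ fun l _ =>
    (integrable_prod_mul_conj k l).const_mul _]
  have h1 : ∀ k : Fin n → Fin n, ∫ z : Fin n → ℂ, ∑ l : Fin n → Fin n,
      ((∏ i, L i (k i)) * ∏ i, conj (L i (l i))) * ∏ i, z (k i) * conj (z (l i))
      ∂(Measure.pi fun _ => stdComplexGaussian) =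
      ∑ σ : Equiv.Perm (Fin n), ∏ i, L i (k i) * conj (L i (k (σ i))) := fun k => by
    rw [integral_finsetSum _ fun l _ => (integrable_prod_mul_conj k l).const_mul _]
    simp_rw [integral_const_mul, integral_prod_mul_conj, Fintype.card_subtype,
      Finset.card_filter, Nat.cast_sum, Finset.mul_sum]
    rw [Finset.sum_comm]
    refine Finset.sum_congr rfl fun σ _ => ?_
    rw [Finset.sum_eq_single (k ∘ σ) (fun l _ hl => by rw [if_neg hl.symm, Nat.cast_zero, mul_zero])
      fun h => (h (Finset.mem_univ _)).elim, if_pos rfl, Nat.cast_one, mul_one,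
      Finset.prod_mul_distrib]
    rfl
  simp_rw [h1]
  rw [Finset.sum_comm, Matrix.permanent]
  refine Finset.sum_congr rfl fun σ _ => ?_
  simp_rw [Matrix.mul_apply, Matrix.conjTranspose_apply]
  rw [Finset.prod_univ_sum, Fintype.piFinset_univ]
  -- Substituting `k ∘ σ` for `k` makes the conjugated factors agree; the others are then only
  -- permuted.
  refine Fintype.sum_equiv (Equiv.arrowCongr σ⁻¹ (Equiv.refl _)) _ _ fun k => ?_
  simp only [Finset.prod_mul_distrib]
  congr 1
  rw [← Equiv.prod_comp σ]
  rfl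

/-! ### Moments of the Gaussian power series -/

section
variable {n : ℕ} {a : Fin n → ℂ}

/-- The covariance matrix of the values of the Gaussian power series. -/
noncomputable def szegoMatrix (a : Fin n → ℂ) : Matrix (Fin n) (Fin n) ℂ :=
  cauchyLike a fun j => conj (a j)

theorem szegoMatrix_apply (a : Fin n → ℂ) (i j : Fin n) :
    szegoMatrix a i j = (1 - a i * conj (a j))⁻¹ := rfl

theorem szegoMatrix_isHermitian (a : Fin n → ℂ) : (szegoMatrix a).IsHermitian := by
  ext i j
  simp [szegoMatrix_apply, mul_comm]

theorem hasSum_norm_sum_mul_pow_sq (ha : ∀ i, a i ∈ openUnitDisk) (t : Fin n → ℂ) :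
    HasSum (fun m : ℕ => ((‖∑ i, t i * a i ^ m‖ ^ 2 : ℝ) : ℂ))
      (∑ i, ∑ j, t i * conj (t j) * szegoMatrix a i j) := by
  have h1 : ∀ m : ℕ, ((‖∑ i, t i * a i ^ m‖ ^ 2 : ℝ) : ℂ) =
      ∑ i, ∑ j, t i * conj (t j) * (a i * conj (a j)) ^ m := fun m => by
    rw [← Complex.normSq_eq_norm_sq, ← Complex.mul_conj, map_sum, Finset.sum_mul_sum]
    refine Finset.sum_congr rfl fun i _ => Finset.sum_congr rfl fun j _ => ?_
    rw [map_mul, map_pow, mul_pow]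
    ring
  simp_rw [h1]
  refine hasSum_sum fun i _ => hasSum_sum fun j _ => HasSum.mul_left _ ?_
  refine hasSum_geometric_of_norm_lt_one ?_
  rw [norm_mul, Complex.norm_conj]
  have hi : ‖a i‖ < 1 := ha i
  have hj : ‖a j‖ < 1 := ha j
  nlinarith [norm_nonneg (a i), norm_nonneg (a j)]

open scoped ComplexOrder in
-- Its quadratic form is a sum of squares `∑_m |∑_i t_i a_i^m|²`, by the geometric series.
theorem szegoMatrix_posSemidef (ha : ∀ i, a i ∈ openUnitDisk) : (szegoMatrix a).PosSemidef := by
  refine Matrix.PosSemidef.of_dotProduct_mulVec_nonneg (szegoMatrix_isHermitian a) fun t => ?_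
  have h := hasSum_norm_sum_mul_pow_sq ha (fun i => conj (t i))
  have h2 : star t ⬝ᵥ (szegoMatrix a).mulVec t =
      ∑ i, ∑ j, conj (t i) * conj (conj (t j)) * szegoMatrix a i j := by
    simp only [dotProduct, Matrix.mulVec, Finset.mul_sum, Pi.star_apply, Complex.conj_conj]
    refine Finset.sum_congr rfl fun i _ => Finset.sum_congr rfl fun j _ => ?_
    rw [mul_assoc, mul_comm (t j)]
    rfl
  rw [h2]
  exact h.nonneg fun m => Complex.zero_le_real.2 (by positivity)

open scoped ComplexOrder MatrixOrder in
theorem exists_szegoMatrix_eq (ha : ∀ i, a i ∈ openUnitDisk) :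
    ∃ L : Matrix (Fin n) (Fin n) ℂ, szegoMatrix a = L * L.conjTranspose := by
  obtain ⟨B, hB⟩ := CStarAlgebra.nonneg_iff_eq_star_mul_self.mp (szegoMatrix_posSemidef ha).nonneg
  refine ⟨B.conjTranspose, ?_⟩
  rw [Matrix.conjTranspose_conjTranspose, hB]
  rfl

/-- Both vectors are circular Gaussian with covariance `L Lᴴ`, so their characteristic functions
coincide. This reduces moments of the series to finitely many independent Gaussians. -/
theorem map_powerSum_gaussianSeq (ha : ∀ i, a i ∈ openUnitDisk)
    {L : Matrix (Fin n) (Fin n) ℂ} (hL : szegoMatrix a = L * L.conjTranspose) :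
    gaussianSeq.map (fun x i => powerSum x (a i)) =
      (Measure.pi fun _ : Fin n => stdComplexGaussian).map L.mulVec := by
  have hm1 : Measurable fun (x : ℕ → ℂ) i => powerSum x (a i) :=
    measurable_pi_lambda _ fun i => measurable_powerSum_left _
  have hm2 : Measurable (L.mulVec : (Fin n → ℂ) → Fin n → ℂ) := by
    refine measurable_pi_lambda _ fun i => ?_
    simp only [Matrix.mulVec, dotProduct]
    fun_prop
  have := Measure.isProbabilityMeasure_map (μ := gaussianSeq) hm1.aemeasurable
  have := Measure.isProbabilityMeasure_map (μ := Measure.pi fun _ : Fin n => stdComplexGaussian)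
    hm2.aemeasurable
  refine measure_ext_of_integral_cexp fun t => ?_
  rw [integral_map hm1.aemeasurable (measurable_cexp_sum Finset.univ t).aestronglyMeasurable,
    integral_map hm2.aemeasurable (measurable_cexp_sum Finset.univ t).aestronglyMeasurable]
  have hs : ((∑ j, ‖∑ i, t i * L i j‖ ^ 2 : ℝ) : ℂ) =
      ∑ i, ∑ j, t i * conj (t j) * szegoMatrix a i j := by
    rw [hL]
    simp_rw [Complex.ofReal_sum, Matrix.mul_apply, Matrix.conjTranspose_apply, Finset.mul_sum]
    have h2 : ∀ j, ((‖∑ i, t i * L i j‖ ^ 2 : ℝ) : ℂ) =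
        ∑ i, ∑ i', t i * conj (t i') * (L i j * star (L i' j)) := fun j => by
      rw [← Complex.normSq_eq_norm_sq, ← Complex.mul_conj, map_sum, Finset.sum_mul_sum]
      refine Finset.sum_congr rfl fun i _ => Finset.sum_congr rfl fun i' _ => ?_
      rw [map_mul, ← starRingEnd_apply]
      ring
    simp_rw [h2]
    rw [Finset.sum_comm]
    exact Finset.sum_congr rfl fun i _ => Finset.sum_comm
  have h1 := hasSum_norm_sum_mul_pow_sq ha t
  rw [← hs, Complex.hasSum_ofReal] at h1
  rw [integral_cexp_of_hasSum (u := fun m => ∑ i, t i * a i ^ m) ?_ h1,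
    ← integral_cexp_pi_stdComplexGaussian]
  · refine integral_congr_ae (Filter.Eventually.of_forall fun z => ?_)
    simp only [Matrix.mulVec, dotProduct, Finset.mul_sum, Finset.sum_mul]
    rw [Finset.sum_comm]
    simp only [mul_assoc]
  · filter_upwards [ae_isSubexponential] with x hx
    simp_rw [Finset.sum_mul]
    refine hasSum_sum fun i _ => ?_
    refine ((hx.summable (ha i)).hasSum.mul_left (t i)).of_eq (fun m => ?_) rfl
    ring

theorem lintegral_prod_powerSumSq (ha : ∀ i, a i ∈ openUnitDisk) :
    ∃ r : ℝ, 0 ≤ r ∧ (r : ℂ) = (szegoMatrix a).permanent ∧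
      ∫⁻ x, ∏ i, powerSumSq x (a i) ∂gaussianSeq = ENNReal.ofReal r := by
  obtain ⟨L, hL⟩ := exists_szegoMatrix_eq ha
  have hm1 : Measurable fun (x : ℕ → ℂ) i => powerSum x (a i) :=
    measurable_pi_lambda _ fun i => measurable_powerSum_left _
  have hm2 : Measurable (L.mulVec : (Fin n → ℂ) → Fin n → ℂ) := by
    refine measurable_pi_lambda _ fun i => ?_
    simp only [Matrix.mulVec, dotProduct]
    fun_prop
  have hg : Measurable fun w : Fin n → ℂ => ∏ i, ENNReal.ofReal (‖w i‖ ^ 2) :=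
    Finset.measurable_fun_prod _ fun i _ => by fun_prop
  have hc : ∀ z : Fin n → ℂ, ∏ i, L.mulVec z i * conj (L.mulVec z i) =
      ((∏ i, ‖L.mulVec z i‖ ^ 2 : ℝ) : ℂ) := fun z => by
    rw [Complex.ofReal_prod]
    refine Finset.prod_congr rfl fun i _ => ?_
    rw [Complex.mul_conj, Complex.normSq_eq_norm_sq]
  have hint := integrable_prod_mulVec_mul_conj L
  have hval := integral_prod_mulVec_mul_conj L
  simp_rw [hc] at hint hval
  rw [integral_complex_ofReal] at hval
  refine ⟨_, integral_nonneg fun z => by positivity, hval.trans (by rw [hL]), ?_⟩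
  have h1 : ∫⁻ x, ∏ i, powerSumSq x (a i) ∂gaussianSeq =
      ∫⁻ w, ∏ i, ENNReal.ofReal (‖w i‖ ^ 2) ∂(gaussianSeq.map fun x i => powerSum x (a i)) := by
    rw [lintegral_map hg hm1]
    rfl
  rw [h1, map_powerSum_gaussianSeq ha hL, lintegral_map hg hm2,
    ofReal_integral_eq_lintegral_ofReal]
  · refine lintegral_congr fun z => ?_
    rw [ENNReal.ofReal_prod_of_nonneg fun i _ => by positivity]
  · have := hint.re
    simpa only [RCLike.re_eq_complex_re, Complex.ofReal_re] using this
  · exact Filter.Eventually.of_forall fun z => by positivity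

end

/-! ### The determinantal form of the correlation functions -/

section
variable {n : ℕ} {a : Fin n → ℂ}

theorem one_sub_mul_conj_ne_zero_of_mem {z w : ℂ} (hz : z ∈ openUnitDisk) (hw : w ∈ openUnitDisk) :
    1 - z * conj w ≠ 0 := by
  rw [mul_comm]
  exact one_sub_conj_mul_ne_zero hw hz

/-- The recursion defining `palmWeight` is the Cauchy determinant recursion `det_cauchyLike_cons`
with conjugate nodes: the row and column factors pair up into squared Blaschke moduli. -/
theorem palmWeight_eq (ha : ∀ i, a i ∈ openUnitDisk) :
    ∃ r : ℝ, 0 ≤ r ∧ (r : ℂ) = ((Real.pi : ℂ) ^ n)⁻¹ * (szegoMatrix a).det ∧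
      palmWeight n a = ENNReal.ofReal r := by
  induction n with
  | zero => exact ⟨1, zero_le_one, by simp, by simp [palmWeight]⟩
  | succ n ih =>
    obtain ⟨r, hr0, hr, hr'⟩ := ih fun i => ha i.succ
    have h0 : ‖a 0‖ < 1 := ha 0
    have hp : 0 ≤ (Real.pi * (1 - ‖a 0‖ ^ 2))⁻¹ := by
      have : 0 ≤ 1 - ‖a 0‖ ^ 2 := by nlinarith [norm_nonneg (a 0)]
      positivity
    refine ⟨(Real.pi * (1 - ‖a 0‖ ^ 2))⁻¹ * r *
      ∏ i : Fin n, ‖a 0 - a i.succ‖ ^ 2 / ‖1 - conj (a i.succ) * a 0‖ ^ 2, by positivity, ?_, ?_⟩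
    · have hs : szegoMatrix a = cauchyLike (Fin.cons (a 0) fun i : Fin n => a i.succ)
          (Fin.cons (conj (a 0)) fun i : Fin n => conj (a i.succ)) := by
        ext i j
        rw [szegoMatrix_apply, cauchyLike_apply]
        refine Fin.cases ?_ (fun i => ?_) i <;> refine Fin.cases ?_ (fun j => ?_) j <;>
          simp only [Fin.cons_zero, Fin.cons_succ]
      rw [hs, det_cauchyLike_cons _ _ _ _
        (one_sub_mul_conj_ne_zero_of_mem (ha 0) (ha 0))
        (fun i => one_sub_mul_conj_ne_zero_of_mem (ha i.succ) (ha 0))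
        (fun i => one_sub_mul_conj_ne_zero_of_mem (ha 0) (ha i.succ))
        (fun i j => one_sub_mul_conj_ne_zero_of_mem (ha i.succ) (ha j.succ))]
      have hprod : ((∏ i : Fin n, ‖a 0 - a i.succ‖ ^ 2 / ‖1 - conj (a i.succ) * a 0‖ ^ 2 : ℝ) : ℂ) =
          (∏ i : Fin n, (a i.succ - a 0) / (1 - a i.succ * conj (a 0))) *
            ∏ i : Fin n, (conj (a i.succ) - conj (a 0)) / (1 - a 0 * conj (a i.succ)) := by
        rw [← Finset.prod_mul_distrib, Complex.ofReal_prod]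
        refine Finset.prod_congr rfl fun i _ => ?_
        rw [Complex.ofReal_div, ← Complex.normSq_eq_norm_sq, ← Complex.normSq_eq_norm_sq,
          ← Complex.mul_conj, ← Complex.mul_conj]
        simp only [map_sub, map_mul, map_one, Complex.conj_conj]
        rw [div_mul_div_comm]
        congr 1 <;> ring
      rw [Complex.ofReal_mul, Complex.ofReal_mul, hr, hprod, Complex.ofReal_inv,
        Complex.ofReal_mul, Complex.ofReal_sub, ← Complex.normSq_eq_norm_sq, ← Complex.mul_conj,
        Complex.ofReal_one, mul_inv, pow_succ, mul_inv, szegoMatrix]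
      ring
    · rw [palmWeight, hr', ENNReal.ofReal_mul (by positivity), ENNReal.ofReal_mul hp,
        ENNReal.ofReal_prod_of_nonneg fun i _ => by positivity]
      rfl

/-- The matrix `(1 - a_p conj a_q)⁻²`. -/
noncomputable def bergmanMatrix (a : Fin n → ℂ) : Matrix (Fin n) (Fin n) ℂ :=
  Matrix.of fun p q : Fin n => ((1 - a p * conj (a q)) ^ 2)⁻¹

/-- The correlation function of the zeros. -/
noncomputable def bergmanCorrelation (a : Fin n → ℂ) : ℝ :=
  (((Real.pi : ℂ) ^ n)⁻¹ * (bergmanMatrix a).det).re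

open scoped ComplexOrder Matrix in
-- Schur product theorem, the matrix being the Hadamard square of `szegoMatrix`.
theorem bergmanMatrix_posSemidef (ha : ∀ i, a i ∈ openUnitDisk) : (bergmanMatrix a).PosSemidef := by
  have h := (szegoMatrix_posSemidef ha).hadamard (szegoMatrix_posSemidef ha)
  have h2 : szegoMatrix a ⊙ szegoMatrix a = bergmanMatrix a := by
    ext i j
    rw [Matrix.hadamard_apply, szegoMatrix_apply, bergmanMatrix, Matrix.of_apply, ← mul_inv, sq]
  rwa [h2] at h

open scoped ComplexOrder in
theorem bergmanCorrelation_nonneg_and (ha : ∀ i, a i ∈ openUnitDisk) :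
    0 ≤ bergmanCorrelation a ∧
      (bergmanCorrelation a : ℂ) = ((Real.pi : ℂ) ^ n)⁻¹ * (bergmanMatrix a).det := by
  have h1 := (bergmanMatrix_posSemidef ha).det_nonneg
  have h2 : (0 : ℂ) ≤ ((Real.pi : ℂ) ^ n)⁻¹ := by
    have : (0 : ℝ) ≤ (Real.pi ^ n)⁻¹ := by positivity
    exact_mod_cast this
  have h := mul_nonneg h2 h1
  exact ⟨(Complex.nonneg_iff.1 h).1, Complex.ext rfl (Complex.nonneg_iff.1 h).2⟩

/-- Distinct nonzero points are what `borchardt` needs; the exceptional tuples are Lebesgue-null. -/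
theorem palmWeight_mul_lintegral (ha : ∀ i, a i ∈ openUnitDisk) (hinj : Function.Injective a)
    (h0 : ∀ i, a i ≠ 0) :
    palmWeight n a * ∫⁻ x, ∏ i, powerSumSq x (a i) ∂gaussianSeq =
      ENNReal.ofReal (bergmanCorrelation a) := by
  obtain ⟨r, hr0, hr, hr'⟩ := palmWeight_eq ha
  obtain ⟨s, -, hs, hs'⟩ := lintegral_prod_powerSumSq ha
  rw [hr', hs', ← ENNReal.ofReal_mul hr0]
  congr 1
  rw [← Complex.ofReal_inj, (bergmanCorrelation_nonneg_and ha).2, Complex.ofReal_mul, hr, hs,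
    mul_assoc, szegoMatrix, borchardt a (fun j => conj (a j)) hinj ((RingHom.injective (starRingEnd ℂ)).comp hinj)
      (fun j => by simpa using h0 j)
      (fun i j => one_sub_mul_conj_ne_zero_of_mem (ha i) (ha j))]
  congr 2
  ext i j
  rw [bergmanMatrix, Matrix.of_apply, Matrix.of_apply, cauchyLike_apply, inv_pow]

end

theorem ae_injective (n : ℕ) : ∀ᵐ a : Fin n → ℂ, Function.Injective a := by
  have h : ∀ i j : Fin n, ∀ᵐ a : Fin n → ℂ, a i = a j → i = j := by
    intro i j
    by_cases hij : i = j
    · exact Filter.Eventually.of_forall fun _ _ => hij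
    have hker : (LinearMap.ker ((LinearMap.proj i : (Fin n → ℂ) →ₗ[ℝ] ℂ) - LinearMap.proj j)) ≠
        ⊤ := fun h => by
      have h1 : (Pi.single i 1 : Fin n → ℂ) ∈ (⊤ : Submodule ℝ (Fin n → ℂ)) := trivial
      rw [← h, LinearMap.mem_ker] at h1
      simp [Ne.symm hij] at h1
    have h2 := Measure.addHaar_submodule (volume : Measure (Fin n → ℂ)) _ hker
    rw [ae_iff]
    refine measure_mono_null (fun a ha => ?_) h2
    simp only [mem_ofPred_eq, Classical.not_imp] at ha
    simp [LinearMap.mem_ker, ha.1]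
  filter_upwards [ae_all_iff.2 fun i => ae_all_iff.2 (h i)] with a ha i j hij
  exact ha i j hij

theorem ae_forall_ne_zero (n : ℕ) : ∀ᵐ a : Fin n → ℂ, ∀ i, a i ≠ 0 := by
  refine ae_all_iff.2 fun i => ?_
  have h := (Measure.quasiMeasurePreserving_eval (fun _ : Fin n => (volume : Measure ℂ)) i).ae
    (p := fun z => z ≠ 0) (Measure.ae_ne volume 0)
  exact h

theorem campbell_gaussianSeq (n : ℕ) {f : (Fin n → ℂ) → ℝ≥0∞} (hf : Measurable f) :
    ∫⁻ x, ∑' z, (tuples n (regularZeros x)).indicator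
        ({b | Function.Injective b}.indicator f) z ∂gaussianSeq =
      ∫⁻ a in univ.pi fun _ => openUnitDisk, f a * ENNReal.ofReal (bergmanCorrelation a) := by
  rw [lintegral_tsum_tuples n hf]
  refine setLIntegral_congr_fun_ae
    (MeasurableSet.univ_pi fun _ => isOpen_openUnitDisk.measurableSet) ?_
  filter_upwards [ae_injective n, ae_forall_ne_zero n] with a h1 h2 h3
  rw [palmWeight_mul_lintegral (fun i => h3 i trivial) h1 h2]

theorem continuousOn_bergmanCorrelation (n : ℕ) :
    ContinuousOn (bergmanCorrelation (n := n)) (univ.pi fun _ => openUnitDisk) := by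
  refine Complex.continuous_re.comp_continuousOn (ContinuousOn.mul continuousOn_const ?_)
  simp_rw [Matrix.det_apply]
  refine continuousOn_finsetSum _ fun σ _ => ContinuousOn.const_smul
    (continuousOn_finsetProd _ fun i _ => ?_) _
  refine ContinuousOn.inv₀ (Continuous.continuousOn (by fun_prop)) fun a ha => ?_
  exact pow_ne_zero 2 (one_sub_mul_conj_ne_zero_of_mem (ha _ trivial) (ha _ trivial))

theorem locallyIntegrableOn_bergmanCorrelation (n : ℕ) :
    LocallyIntegrableOn (bergmanCorrelation (n := n)) (univ.pi fun _ => openUnitDisk) :=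
  (continuousOn_bergmanCorrelation n).locallyIntegrableOn
    (isOpen_set_pi finite_univ fun _ _ => isOpen_openUnitDisk).measurableSet

/-! ### The zero process -/

theorem ae_zero_ne_zero : ∀ᵐ x : ℕ → ℂ ∂gaussianSeq, x 0 ≠ 0 := by
  have h : ∀ᵐ z ∂(gaussianSeq.map fun x => x 0), z ≠ 0 := by
    rw [map_eval_gaussianSeq]
    exact Measure.ae_ne stdComplexGaussian 0
  exact ae_of_ae_map (measurable_pi_apply 0).aemeasurable h

theorem tsum_zeroTuples_eq {n : ℕ} (Z : Set ℂ) (f : (Fin n → ℂ) → ℝ≥0∞) :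
    ∑' a : {a : Fin n → ℂ // Function.Injective a ∧ ∀ i, a i ∈ Z}, f a.1 =
      ∑' z, (tuples n Z).indicator ({b | Function.Injective b}.indicator f) z := by
  refine (tsum_subtype {a : Fin n → ℂ | Function.Injective a ∧ ∀ i, a i ∈ Z} f).trans ?_
  rw [indicator_indicator, inter_comm]
  rfl

theorem measurable_encard_regularZeros_inter {B : Set ℂ} (hB : MeasurableSet B) :
    Measurable fun x : ℕ → ℂ => (regularZeros x ∩ B).encard := by
  have h : Measurable fun x : ℕ → ℂ => ((regularZeros x ∩ B).encard : ℝ≥0∞) := by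
    have h1 : ∀ x : ℕ → ℂ, ((regularZeros x ∩ B).encard : ℝ≥0∞) =
        ∑' z, (regularZeros x).indicator (fun z => B.indicator (fun _ => (1 : ℝ≥0∞)) z) z := by
      intro x
      rw [← ENNReal.tsum_set_one, tsum_subtype (regularZeros x ∩ B) fun _ => (1 : ℝ≥0∞),
        ← indicator_indicator]
    simp_rw [h1]
    exact measurable_tsum_regularZeros measurable_id
      (f := fun p : (ℕ → ℂ) × ℂ => B.indicator (fun _ => (1 : ℝ≥0∞)) p.2)
      ((measurable_const.indicator hB).comp measurable_snd)
  -- `ℕ∞` is countable and embeds in `ℝ≥0∞`, so preimages of singletons suffice.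
  refine measurable_to_countable' fun y => ?_
  have h2 : (fun x : ℕ → ℂ => (regularZeros x ∩ B).encard) ⁻¹' {y} =
      (fun x : ℕ → ℂ => ((regularZeros x ∩ B).encard : ℝ≥0∞)) ⁻¹' {(y : ℝ≥0∞)} := by
    ext x
    simp
  rw [h2]
  exact h (measurableSet_singleton _)

section
variable {Ω : Type*} [MeasurableSpace Ω] {P : Measure Ω} {ξ : ℕ → Ω → ℂ}

theorem IsStationaryComplexGaussian.aemeasurable_seq
    (hξ : IsStationaryComplexGaussian P ξ uniformSpectralMeasure) :
    AEMeasurable (fun ω k => ξ k ω) P :=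
  aemeasurable_pi_lambda _ hξ.gaussian.aemeasurable

/-- Almost surely the series converges on the disk and `X(0) = ξ_0 ≠ 0`, so the guard in
`regularZeros` is satisfied. -/
theorem IsStationaryComplexGaussian.ae_zeroSet_eq
    (hξ : IsStationaryComplexGaussian P ξ uniformSpectralMeasure) :
    ∀ᵐ ω ∂P, zeroSet ξ ω = regularZeros fun k => ξ k ω := by
  have h : ∀ᵐ x ∂(P.map fun ω k => ξ k ω), IsSubexponential x ∧ x 0 ≠ 0 := by
    rw [hξ.map_eq_gaussianSeq]
    exact ae_isSubexponential.and ae_zero_ne_zero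
  filter_upwards [ae_of_ae_map hξ.aemeasurable_seq h] with ω hω
  have h0 : powerSum (fun k => ξ k ω) 0 = ξ 0 ω := by
    refine (tsum_eq_single 0 fun k hk => ?_).trans ?_
    · rw [zero_pow hk, mul_zero]
    · rw [pow_zero, mul_one]
  ext z
  refine ⟨fun hz => ⟨⟨hω.1, 0, by simp [openUnitDisk], ?_⟩, hz⟩, fun hz => hz.2⟩
  rw [h0]
  exact hω.2

theorem IsStationaryComplexGaussian.isSimplePointProcess_zeroSet
    (hξ : IsStationaryComplexGaussian P ξ uniformSpectralMeasure) :
    IsSimplePointProcess P openUnitDisk (zeroSet ξ) where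
  subset := Filter.Eventually.of_forall fun _ _ hz => hz.1
  locallyFinite := by
    filter_upwards [hξ.ae_zeroSet_eq] with ω hω C hC hCD
    rw [hω]
    exact finite_regularZeros_inter _ hC hCD
  measurable_count B hB := by
    refine ((measurable_encard_regularZeros_inter hB).comp_aemeasurable hξ.aemeasurable_seq).congr ?_
    filter_upwards [hξ.ae_zeroSet_eq] with ω hω
    rw [hω]
    rfl

theorem IsStationaryComplexGaussian.isCorrelationFunction_zeroSet
    (hξ : IsStationaryComplexGaussian P ξ uniformSpectralMeasure) (n : ℕ) :
    IsCorrelationFunction P openUnitDisk (zeroSet ξ) n bergmanCorrelation where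
  nonneg a ha := (bergmanCorrelation_nonneg_and fun i => ha i trivial).1
  locallyIntegrable := locallyIntegrableOn_bergmanCorrelation n
  campbell f hf := by
    rw [← campbell_gaussianSeq n hf, ← hξ.map_eq_gaussianSeq, lintegral_map' _
      hξ.aemeasurable_seq]
    · refine lintegral_congr_ae ?_
      filter_upwards [hξ.ae_zeroSet_eq] with ω hω
      rw [tsum_zeroTuples_eq, hω]
    · exact (measurable_tsum_tuples n measurable_id
        (f := fun q : (ℕ → ℂ) × (Fin n → ℂ) => {b | Function.Injective b}.indicator f q.2)
        ((hf.indicator (measurableSet_injective n)).comp measurable_snd)).aemeasurable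

end

theorem det_bergmanKernel {n : ℕ} (a : Fin n → ℂ) :
    (Matrix.of fun p q : Fin n => bergmanKernel (a p) (a q)).det =
      ((Real.pi : ℂ) ^ n)⁻¹ * (bergmanMatrix a).det := by
  have h : (Matrix.of fun p q : Fin n => bergmanKernel (a p) (a q)) =
      (Real.pi : ℂ)⁻¹ • bergmanMatrix a := by
    ext p q
    rfl
  rw [h, Matrix.det_smul, Fintype.card_fin, inv_pow]

theorem mainTheorem2 {Ω : Type*} [MeasurableSpace Ω] (P : Measure Ω) [IsProbabilityMeasure P]
    (ξ : ℕ → Ω → ℂ) (hξ : IsStationaryComplexGaussian P ξ uniformSpectralMeasure) :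
    (∀ n : ℕ, ∃ ρ : (Fin n → ℂ) → ℝ,
      IsCorrelationFunction P openUnitDisk (zeroSet ξ) n ρ ∧
      ∀ a : Fin n → ℂ, (∀ p, a p ∈ openUnitDisk) →
        (ρ a : ℂ) = ((Real.pi : ℂ) ^ n)⁻¹ *
          (Matrix.of fun p q : Fin n => ((1 - a p * conj (a q)) ^ 2)⁻¹).det) ∧
    IsDeterminantalPointProcess P openUnitDisk (zeroSet ξ) bergmanKernel := by
  refine ⟨fun n => ⟨bergmanCorrelation, hξ.isCorrelationFunction_zeroSet n, fun a ha =>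
    (bergmanCorrelation_nonneg_and ha).2⟩, hξ.isSimplePointProcess_zeroSet, fun n =>
    ⟨bergmanCorrelation, hξ.isCorrelationFunction_zeroSet n, fun a ha => ?_⟩⟩
  rw [det_bergmanKernel]
  exact (bergmanCorrelation_nonneg_and fun i => ha i trivial).2
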